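/- Let $M\subset\mathbb R^3$ be compact with smooth boundary $\partial M$ and outward unit normal $n$. Let $c\in C(M)$ be real valued with $c^2>0$ on $M$, let $g_0'\in C(M)^3$ be a real vector field, and let $\rho_0\in C^1(M)$ be real valued with $\rho_0>0$ on $M$. Assume that $g_0'$ and $\nabla\rho_0$ are parallel at every point of $M$ (that is, linearly dependent; either may vanish), that $g_0'$ and $n$ are parallel on $\partial M$, and that $g_0'\cdot n<0$ on $\partial M$. Put $\kappa=c^2\rho_0$ and $$\tilde s=\nabla\rho_0-\frac{\rho_0^2}{\kappa}\,g_0'.$$ All function spaces are complex. Let $H=L^2(M,\rho_0\,dx)^3$. Let $H_{\mathrm{Div}}(M)=\{u\in H:\nabla\cdot u\in L^2(M)\}$ with norm $\|u\|^2=\int_M(|\nabla\cdot u|^2+|u|^2)\,\rho_0\,dx$, and let $H_{\mathrm{Div},0}(M)=\{u\in H_{\mathrm{Div}}(M): u\cdot n|_{\partial M}=0\}$, where the boundary condition means $\int_M(u\cdot\nabla\chi+(\nabla\cdot u)\chi)\,dx=0$ for all $\chi\in H^1(M)$. Let $H^1(M)$ carry the norm $\|\varphi\|^2=\int_M(|\varphi|^2+|\nabla\varphi|^2)\,dx$.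 Let $T$ be the unbounded operator from $H$ to $L^2(M,\rho_0\,dx)$ with $$Tu=\nabla\cdot(\rho_0u)-\tilde s\cdot u,\qquad D(T)=H_{\mathrm{Div},0}(M).$$ Then $T$ is well defined on $H_{\mathrm{Div},0}(M)$ and densely defined, and its Hilbert space adjoint $T^*$ has domain $D(T^*)=H^1(M)$ and is given by $T^*\varphi=-(\nabla(\rho_0\varphi)+\tilde s\,\varphi)$. Moreover: 1. $\operatorname{Ran}(T^*)$ is closed in $H$. 2. $H=\operatorname{Ran}(T^*)\oplus\operatorname{Ker}(T)$, an orthogonal direct sum. 3. For every $u\in H$, among all $\varphi\in H^1(M)$ such that $u=T^*\varphi+u_2$ for some $u_2\in\operatorname{Ker}(T)$, there is exactly one of minimum $H^1(M)$ norm; call it $\Pi u$. The map $\Pi:H\to H^1(M)$ is linear and continuous. 4. The injection $\operatorname{Ran}(T^*)\cap D(T)\hookrightarrow H$, with the $H_{\mathrm{Div}}(M)$ topology on the domain, is compact. -/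

import Mathlib

open MeasureTheory Set Topology
open scoped ContDiff LinearPMap InnerProductSpace

/-- Physical space `ℝ³` with the Euclidean norm. -/
abbrev E3 : Type := EuclideanSpace ℝ (Fin 3)

/-- The values `ℂ³` of complex vector fields. -/
abbrev C3 : Type := EuclideanSpace ℂ (Fin 3)

noncomputable section

/-! ### Compact sets with smooth boundary -/

/-- Near the point `x`, on the open set `U`, the set `M` is `{r ≤ 0}` for a smooth function `r`
whose gradient does not vanish at `x`. -/
structure IsLocalDefiningFunction (M : Set E3) (x : E3) (U : Set E3) (r : E3 → ℝ) : Prop where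
  isOpen : IsOpen U
  mem : x ∈ U
  smooth : ContDiffOn ℝ ∞ r U
  gradient_ne_zero : gradient r x ≠ 0
  mem_iff : ∀ y ∈ U, y ∈ M ↔ r y ≤ 0

/-- `M` has a smooth boundary. -/
def HasSmoothBoundary (M : Set E3) : Prop :=
  ∀ x ∈ frontier M, ∃ U r, IsLocalDefiningFunction M x U r

/-- `ν` is the outward unit normal of `M` at the boundary point `x`. -/
def IsOutwardUnitNormal (M : Set E3) (x ν : E3) : Prop :=
  ∃ U r, IsLocalDefiningFunction M x U r ∧ ν = ‖gradient r x‖⁻¹ • gradient r x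

/-! ### The coefficients -/

/-- The region `M` occupied by the gas, the wave speed `c`, the density `ρ₀` and the effective
gravity `g₀'`, with the standing assumptions on them. Only the values on `M` matter. -/
structure GasPlanet where
  /-- the region -/
  M : Set E3
  /-- the acoustic wave speed -/
  c : E3 → ℝ
  /-- the unperturbed density `ρ₀` -/
  ρ : E3 → ℝ
  /-- the effective gravity `g₀'` -/
  g : E3 → E3
  isCompact : IsCompact M
  smoothBoundary : HasSmoothBoundary M
  c_continuousOn : ContinuousOn c M
  g_continuousOn : ContinuousOn g M
  ρ_contDiffOn : ContDiffOn ℝ 1 ρ M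
  ρ_pos : ∀ x ∈ M, 0 < ρ x
  c_sq_pos : ∀ x ∈ M, 0 < c x ^ 2
  /-- `g₀'` and `∇ρ₀` are parallel (one of them may vanish) in `M` -/
  g_parallel_gradient : ∀ x ∈ M, ¬ LinearIndependent ℝ ![g x, gradientWithin ρ M x]
  /-- `g₀'` is parallel to the normal on the boundary -/
  g_parallel_normal : ∀ x ∈ frontier M, ∀ ν, IsOutwardUnitNormal M x ν →
    ¬ LinearIndependent ℝ ![g x, ν]
  /-- `g₀' · n < 0` on the boundary -/
  g_inner_normal_neg : ∀ x ∈ frontier M, ∀ ν, IsOutwardUnitNormal M x ν → ⟪g x, ν⟫_ℝ < 0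

/-! ### Vector algebra -/

/-- The bilinear (not sesquilinear) dot product on `ℂ³`. -/
def cdot (a b : C3) : ℂ := ∑ i, a i * b i

/-- A real vector regarded as a complex one. -/
def toC3 (v : E3) : C3 := WithLp.toLp 2 fun i => ((v i : ℝ) : ℂ)

/-! ### Weak divergence and weak gradient on an open set -/

/-- Smooth real test functions with compact support in `Ω`. -/
structure IsTestFunction (Ω : Set E3) (ψ : E3 → ℝ) : Prop where
  smooth : ContDiff ℝ ∞ ψ
  compactSupport : HasCompactSupport ψ
  support_subset : tsupport ψ ⊆ Ω

/-- `∇ · u = d` in the sense of distributions on `Ω`. -/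
structure IsWeakDiv (Ω : Set E3) (u : E3 → C3) (d : E3 → ℂ) : Prop where
  locInt_left : LocallyIntegrableOn u Ω
  locInt_right : LocallyIntegrableOn d Ω
  eq : ∀ ψ, IsTestFunction Ω ψ →
    ∫ x in Ω, cdot (toC3 (gradient ψ x)) (u x) = -∫ x in Ω, ψ x • d x

/-- `∇φ = G` in the sense of distributions on `Ω`. -/
structure IsWeakGrad (Ω : Set E3) (φ : E3 → ℂ) (G : E3 → C3) : Prop where
  locInt_left : LocallyIntegrableOn φ Ω
  locInt_right : LocallyIntegrableOn G Ω
  eq : ∀ ψ, IsTestFunction Ω ψ →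
    ∫ x in Ω, φ x • toC3 (gradient ψ x) = -∫ x in Ω, ψ x • G x

section helpers

variable {Ω : Set E3}

theorem locInt_congr_ae {F : Type*} [NormedAddCommGroup F] {f f' : E3 → F}
    (hΩ : IsOpen Ω) (hf : LocallyIntegrableOn f Ω) (h : f =ᵐ[volume.restrict Ω] f') :
    LocallyIntegrableOn f' Ω := by
  rw [locallyIntegrableOn_iff hΩ.isLocallyClosed] at hf ⊢
  intro K hK hc
  exact (hf K hK hc).congr (ae_restrict_of_ae_restrict_of_subset hK h)

theorem locInt_integrableOn_smul {F : Type*} [NormedAddCommGroup F]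
    [NormedSpace ℝ F] {f : E3 → F} (hf : LocallyIntegrableOn f Ω) {k : E3 → ℝ}
    (hk : Continuous k) (hc : HasCompactSupport k) (hs : tsupport k ⊆ Ω) :
    IntegrableOn (fun x => k x • f x) Ω := by
  have h1 : IntegrableOn (fun x => k x • f x) (tsupport k) :=
    (hf.integrableOn_compact_subset hs hc).continuousOn_smul hk.continuousOn hc
  have h2 : Integrable (fun x => k x • f x) := by
    refine (integrableOn_iff_integrable_of_support_subset ?_).1 h1
    intro x hx
    refine subset_tsupport k ?_
    intro h0
    apply hx
    simp only [h0, zero_smul]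
  exact h2.integrableOn

theorem IsTestFunction.gradient_apply {ψ : E3 → ℝ} (hψ : IsTestFunction Ω ψ) (i : Fin 3) :
    Continuous (fun x => gradient ψ x i) ∧ HasCompactSupport (fun x => gradient ψ x i) ∧
      tsupport (fun x => gradient ψ x i) ⊆ Ω := by
  have hfd : Continuous (fderiv ℝ ψ) := hψ.smooth.continuous_fderiv (by simp)
  have hsub : Function.support (fun x => gradient ψ x i) ⊆ Function.support (fderiv ℝ ψ) := by
    intro x hx h0
    apply hx
    simp only [gradient, h0, map_zero]
    rfl
  have hsub' : tsupport (fun x => gradient ψ x i) ⊆ tsupport ψ :=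
    (closure_mono hsub).trans (tsupport_fderiv_subset ℝ)
  refine ⟨?_, ?_, hsub'.trans hψ.support_subset⟩
  · have : Continuous (fun x => gradient ψ x) := by
      unfold gradient
      exact (LinearIsometryEquiv.continuous _).comp hfd
    exact (EuclideanSpace.proj (𝕜 := ℝ) i).continuous.comp this
  · exact hψ.compactSupport.mono' (hsub.trans ((subset_tsupport _).trans
      (tsupport_fderiv_subset ℝ)))

theorem locInt_apply {u : E3 → C3} (hu : LocallyIntegrableOn u Ω) (i : Fin 3) :
    LocallyIntegrableOn (fun x => u x i) Ω := by
  intro x hx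
  obtain ⟨t, ht, hi⟩ := hu x hx
  exact ⟨t, ht, (EuclideanSpace.proj (𝕜 := ℂ) i).integrable_comp hi⟩

theorem IsTestFunction.integrableOn_cdot {ψ : E3 → ℝ} (hψ : IsTestFunction Ω ψ) {u : E3 → C3}
    (hu : LocallyIntegrableOn u Ω) :
    IntegrableOn (fun x => cdot (toC3 (gradient ψ x)) (u x)) Ω := by
  unfold cdot
  refine integrable_finsetSum _ fun i _ => ?_
  obtain ⟨h1, h2, h3⟩ := hψ.gradient_apply i
  have := locInt_integrableOn_smul (locInt_apply hu i) h1 h2 h3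
  simpa [toC3, IntegrableOn] using this

theorem IsTestFunction.integrableOn_smul {F : Type*} [NormedAddCommGroup F] [NormedSpace ℝ F]
    {ψ : E3 → ℝ} (hψ : IsTestFunction Ω ψ) {d : E3 → F} (hd : LocallyIntegrableOn d Ω) :
    IntegrableOn (fun x => ψ x • d x) Ω :=
  locInt_integrableOn_smul hd hψ.smooth.continuous hψ.compactSupport hψ.support_subset

theorem IsTestFunction.integrableOn_smul_toC3 {ψ : E3 → ℝ} (hψ : IsTestFunction Ω ψ)
    {φ : E3 → ℂ} (hφ : LocallyIntegrableOn φ Ω) :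
    IntegrableOn (fun x => φ x • toC3 (gradient ψ x)) Ω := by
  have h : (fun x => φ x • toC3 (gradient ψ x)) =
      fun x => ∑ i, (gradient ψ x i • φ x) • EuclideanSpace.single i (1 : ℂ) := by
    funext x
    ext j
    simp [toC3, mul_comm, Pi.single_apply]
  rw [h]
  refine integrable_finsetSum _ fun i _ => ?_
  obtain ⟨h1, h2, h3⟩ := hψ.gradient_apply i
  exact (locInt_integrableOn_smul hφ h1 h2 h3).smul_const _

theorem cdot_add_right (a b b' : C3) : cdot a (b + b') = cdot a b + cdot a b' := by
  simp [cdot, mul_add, Finset.sum_add_distrib]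

theorem cdot_smul_right (k : ℂ) (a b : C3) : cdot a (k • b) = k * cdot a b := by
  simp only [cdot, PiLp.smul_apply, smul_eq_mul, Finset.mul_sum]
  exact Finset.sum_congr rfl fun i _ => by ring

theorem cdot_zero_right (a : C3) : cdot a 0 = 0 := by simp [cdot]

theorem cdot_add_left (a a' b : C3) : cdot (a + a') b = cdot a b + cdot a' b := by
  simp [cdot, add_mul, Finset.sum_add_distrib]

theorem cdot_smul_left (k : ℂ) (a b : C3) : cdot (k • a) b = k * cdot a b := by
  simp only [cdot, PiLp.smul_apply, smul_eq_mul, Finset.mul_sum]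
  exact Finset.sum_congr rfl fun i _ => by ring

theorem IsWeakDiv.congr {u u' : E3 → C3} {d d' : E3 → ℂ} (hΩ : IsOpen Ω) (h : IsWeakDiv Ω u d)
    (hu : u =ᵐ[volume.restrict Ω] u') (hd : d =ᵐ[volume.restrict Ω] d') : IsWeakDiv Ω u' d' := by
  refine ⟨locInt_congr_ae hΩ h.1 hu,
    locInt_congr_ae hΩ h.2 hd, fun ψ hψ => ?_⟩
  have e1 : ∫ x in Ω, cdot (toC3 (gradient ψ x)) (u' x) =
      ∫ x in Ω, cdot (toC3 (gradient ψ x)) (u x) :=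
    integral_congr_ae (hu.mono fun x hx => by simp only [hx])
  have e2 : ∫ x in Ω, ψ x • d' x = ∫ x in Ω, ψ x • d x :=
    integral_congr_ae (hd.mono fun x hx => by simp only [hx])
  rw [e1, e2, h.eq ψ hψ]

theorem IsWeakDiv.add {u u' : E3 → C3} {d d' : E3 → ℂ} (h : IsWeakDiv Ω u d)
    (h' : IsWeakDiv Ω u' d') : IsWeakDiv Ω (u + u') (d + d') := by
  refine ⟨h.1.add h'.1, h.2.add h'.2, fun ψ hψ => ?_⟩
  simp only [Pi.add_apply, cdot_add_right, smul_add]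
  rw [integral_add (hψ.integrableOn_cdot h.1) (hψ.integrableOn_cdot h'.1),
    integral_add (hψ.integrableOn_smul h.2) (hψ.integrableOn_smul h'.2), h.eq ψ hψ, h'.eq ψ hψ]
  ring

theorem IsWeakDiv.smul {u : E3 → C3} {d : E3 → ℂ} (k : ℂ) (h : IsWeakDiv Ω u d) :
    IsWeakDiv Ω (k • u) (k • d) := by
  refine ⟨h.1.smul k, h.2.smul k, fun ψ hψ => ?_⟩
  have e : ∀ x, ψ x • (k • d x) = k * (ψ x • d x) := fun x => by
    simp only [Complex.real_smul, smul_eq_mul]; ring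
  simp only [Pi.smul_apply, cdot_smul_right, e]
  rw [integral_const_mul, integral_const_mul, h.eq ψ hψ]
  ring

theorem IsWeakDiv.zero : IsWeakDiv Ω (0 : E3 → C3) (0 : E3 → ℂ) :=
  ⟨(locallyIntegrable_zero).locallyIntegrableOn _, (locallyIntegrable_zero).locallyIntegrableOn _,
    fun ψ _ => by simp [cdot_zero_right]⟩

theorem IsWeakGrad.congr {φ φ' : E3 → ℂ} {G G' : E3 → C3} (hΩ : IsOpen Ω) (h : IsWeakGrad Ω φ G)
    (hu : φ =ᵐ[volume.restrict Ω] φ') (hd : G =ᵐ[volume.restrict Ω] G') :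
    IsWeakGrad Ω φ' G' := by
  refine ⟨locInt_congr_ae hΩ h.1 hu,
    locInt_congr_ae hΩ h.2 hd, fun ψ hψ => ?_⟩
  have e1 : ∫ x in Ω, φ' x • toC3 (gradient ψ x) = ∫ x in Ω, φ x • toC3 (gradient ψ x) :=
    integral_congr_ae (hu.mono fun x hx => by simp only [hx])
  have e2 : ∫ x in Ω, ψ x • G' x = ∫ x in Ω, ψ x • G x :=
    integral_congr_ae (hd.mono fun x hx => by simp only [hx])
  rw [e1, e2, h.eq ψ hψ]

theorem IsWeakGrad.add {φ φ' : E3 → ℂ} {G G' : E3 → C3} (h : IsWeakGrad Ω φ G)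
    (h' : IsWeakGrad Ω φ' G') : IsWeakGrad Ω (φ + φ') (G + G') := by
  refine ⟨h.1.add h'.1, h.2.add h'.2, fun ψ hψ => ?_⟩
  simp only [Pi.add_apply, add_smul, smul_add]
  rw [integral_add (hψ.integrableOn_smul_toC3 h.1) (hψ.integrableOn_smul_toC3 h'.1),
    integral_add (hψ.integrableOn_smul h.2) (hψ.integrableOn_smul h'.2), h.eq ψ hψ, h'.eq ψ hψ]
  abel

theorem IsWeakGrad.smul {φ : E3 → ℂ} {G : E3 → C3} (k : ℂ) (h : IsWeakGrad Ω φ G) :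
    IsWeakGrad Ω (k • φ) (k • G) := by
  refine ⟨h.1.smul k, h.2.smul k, fun ψ hψ => ?_⟩
  simp only [Pi.smul_apply, smul_assoc, smul_comm (ψ _) k]
  rw [integral_smul, integral_smul, h.eq ψ hψ, smul_neg]

theorem IsWeakGrad.zero : IsWeakGrad Ω (0 : E3 → ℂ) (0 : E3 → C3) :=
  ⟨(locallyIntegrable_zero).locallyIntegrableOn _, (locallyIntegrable_zero).locallyIntegrableOn _,
    fun ψ _ => by simp⟩

end helpers

/-! ### The Sobolev space `H¹(M)` -/

/-- `H¹(M)`: pairs `(φ, ∇φ)` of square integrable functions, `∇φ` the weak gradient of `φ` in the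
interior of `M`. The norm inherited from the `ℓ²` product is
`‖φ‖² = ∫_M (|φ|² + |∇φ|²) dx`. -/
def H1 (M : Set E3) : Submodule ℂ (WithLp 2
    (Lp ℂ 2 (volume.restrict (interior M)) × Lp C3 2 (volume.restrict (interior M)))) where
  carrier := {w | IsWeakGrad (interior M) w.fst w.snd}
  add_mem' {a b} ha hb := (IsWeakGrad.add ha hb).congr isOpen_interior
    (Lp.coeFn_add a.fst b.fst).symm (Lp.coeFn_add a.snd b.snd).symm
  zero_mem' := IsWeakGrad.zero.congr isOpen_interior
    (Lp.coeFn_zero ℂ 2 _).symm (Lp.coeFn_zero C3 2 _).symm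
  smul_mem' k a ha := (IsWeakGrad.smul k ha).congr isOpen_interior
    (Lp.coeFn_smul k a.fst).symm (Lp.coeFn_smul k a.snd).symm

namespace GasPlanet

variable (P : GasPlanet)

/-- The interior of `M`. (The boundary is a null set.) -/
abbrev Ω : Set E3 := interior P.M

/-- The bulk modulus `κ = c² ρ₀`. -/
def κ (x : E3) : ℝ := P.c x ^ 2 * P.ρ x

/-- The field `s̃ = ∇ρ₀ - (ρ₀² / κ) g₀'`. -/
def sTilde (x : E3) : E3 := gradientWithin P.ρ P.M x - (P.ρ x ^ 2 / P.κ x) • P.g x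

/-- The measure `ρ₀ dx` on `M`. -/
def μ : Measure E3 :=
  (volume.restrict P.Ω).withDensity fun x => ENNReal.ofReal (P.ρ x)

/-- The Hilbert space `H = L²(ρ₀ dx)³`. -/
abbrev H : Type := Lp C3 2 P.μ

/-- The scalar space `L²(ρ₀ dx)`. -/
abbrev L2 : Type := Lp ℂ 2 P.μ

theorem volume_ac : volume.restrict P.Ω ≪ P.μ := by
  have hm : AEMeasurable P.ρ (volume.restrict P.Ω) :=
    (P.ρ_contDiffOn.continuousOn.mono interior_subset).aemeasurable isOpen_interior.measurableSet
  refine withDensity_absolutelyContinuous' hm.ennreal_ofReal ?_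
  filter_upwards [ae_restrict_mem isOpen_interior.measurableSet] with x hx
  simpa using P.ρ_pos x (interior_subset hx)

theorem ae_of_ae {p : E3 → Prop} (h : ∀ᵐ x ∂P.μ, p x) : ∀ᵐ x ∂volume.restrict P.Ω, p x :=
  P.volume_ac.ae_le h

theorem aeEq_of_aeEq {F : Type*} {f f' : E3 → F} (h : f =ᵐ[P.μ] f') :
    f =ᵐ[volume.restrict P.Ω] f' := P.volume_ac.ae_le h

/-- `H_Div(M)`: pairs `(u, ∇ · u)` of square integrable functions, with
`‖u‖² = ∫_M (|∇ · u|² + |u|²) ρ₀ dx`. -/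
def HDiv : Submodule ℂ (WithLp 2 (P.H × P.L2)) where
  carrier := {w | IsWeakDiv P.Ω w.fst w.snd}
  add_mem' {a b} ha hb := (IsWeakDiv.add ha hb).congr isOpen_interior
    (P.aeEq_of_aeEq (Lp.coeFn_add a.fst b.fst)).symm (P.aeEq_of_aeEq (Lp.coeFn_add a.snd b.snd)).symm
  zero_mem' := IsWeakDiv.zero.congr isOpen_interior
    (P.aeEq_of_aeEq (Lp.coeFn_zero C3 2 _)).symm (P.aeEq_of_aeEq (Lp.coeFn_zero ℂ 2 _)).symm
  smul_mem' k a ha := (IsWeakDiv.smul k ha).congr isOpen_interior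
    (P.aeEq_of_aeEq (Lp.coeFn_smul k a.fst)).symm (P.aeEq_of_aeEq (Lp.coeFn_smul k a.snd)).symm

/-- `H_{Div,0}(M)`: the elements of `H_Div(M)` with `u · n = 0` on `∂M`. The normal trace is the
functional `χ ↦ ∫_M (u · ∇χ + (∇ · u) χ) dx` on (the traces of) `χ ∈ H¹(M)`. -/
def HDivZero : Submodule ℂ (WithLp 2 (P.H × P.L2)) where
  carrier := {w | w ∈ P.HDiv ∧ ∀ χ : H1 P.M,
    Integrable (fun x => cdot (w.fst x) (χ.1.snd x) + w.snd x * χ.1.fst x)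
      (volume.restrict P.Ω) ∧
    ∫ x in P.Ω, (cdot (w.fst x) (χ.1.snd x) + w.snd x * χ.1.fst x) = 0}
  add_mem' {a b} ha hb := by
    refine ⟨P.HDiv.add_mem ha.1 hb.1, fun χ => ?_⟩
    obtain ⟨ia, ea⟩ := ha.2 χ
    obtain ⟨ib, eb⟩ := hb.2 χ
    have key : (fun x => (cdot (a.fst x) (χ.1.snd x) + a.snd x * χ.1.fst x) +
        (cdot (b.fst x) (χ.1.snd x) + b.snd x * χ.1.fst x)) =ᵐ[volume.restrict P.Ω]
        fun x => cdot ((a + b).fst x) (χ.1.snd x) + (a + b).snd x * χ.1.fst x := by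
      filter_upwards [P.ae_of_ae (Lp.coeFn_add a.fst b.fst),
        P.ae_of_ae (Lp.coeFn_add a.snd b.snd)] with x h1 h2
      simp only [WithLp.add_fst, WithLp.add_snd, h1, h2, Pi.add_apply, cdot_add_left]
      ring
    refine ⟨(ia.add ib).congr key, ?_⟩
    rw [← integral_congr_ae key, integral_add ia ib, ea, eb, add_zero]
  zero_mem' := by
    refine ⟨P.HDiv.zero_mem, fun χ => ?_⟩
    have key : (fun _ => (0 : ℂ)) =ᵐ[volume.restrict P.Ω] fun x =>
        cdot ((0 : WithLp 2 (P.H × P.L2)).fst x) (χ.1.snd x) +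
          (0 : WithLp 2 (P.H × P.L2)).snd x * χ.1.fst x := by
      filter_upwards [P.ae_of_ae (Lp.coeFn_zero C3 2 P.μ),
        P.ae_of_ae (Lp.coeFn_zero ℂ 2 P.μ)] with x h1 h2
      simp only [WithLp.zero_fst, WithLp.zero_snd, h1, h2]
      simp [cdot]
    refine ⟨(integrable_zero _ _ _).congr key, ?_⟩
    rw [← integral_congr_ae key, integral_zero]
  smul_mem' k a ha := by
    refine ⟨P.HDiv.smul_mem k ha.1, fun χ => ?_⟩
    obtain ⟨ia, ea⟩ := ha.2 χ
    have key : (fun x => k * (cdot (a.fst x) (χ.1.snd x) + a.snd x * χ.1.fst x))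
        =ᵐ[volume.restrict P.Ω]
        fun x => cdot ((k • a).fst x) (χ.1.snd x) + (k • a).snd x * χ.1.fst x := by
      filter_upwards [P.ae_of_ae (Lp.coeFn_smul k a.fst),
        P.ae_of_ae (Lp.coeFn_smul k a.snd)] with x h1 h2
      simp only [WithLp.smul_fst, WithLp.smul_snd, h1, h2, Pi.smul_apply, cdot_smul_left,
        smul_eq_mul]
      ring
    refine ⟨(ia.const_mul k).congr key, ?_⟩
    rw [← integral_congr_ae key, integral_const_mul, ea, mul_zero]

/-- The graph of `T`: pairs `(u, f)` with `u ∈ H_{Div,0}(M)` and `f = ∇ · (ρ₀ u) - s̃ · u`. -/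
def graphT : Submodule ℂ (P.H × P.L2) where
  carrier := {w | (∃ d : P.L2, WithLp.toLp 2 (w.1, d) ∈ P.HDivZero) ∧
    IsWeakDiv P.Ω (fun x => (P.ρ x : ℂ) • w.1 x)
      (fun x => w.2 x + cdot (toC3 (P.sTilde x)) (w.1 x))}
  add_mem' := by
    rintro a b ⟨⟨d, hd⟩, ha⟩ ⟨⟨e, he⟩, hb⟩
    refine ⟨⟨d + e, P.HDivZero.add_mem hd he⟩, (ha.add hb).congr isOpen_interior ?_ ?_⟩
    · filter_upwards [P.ae_of_ae (Lp.coeFn_add a.1 b.1)] with x h1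
      simp only [Prod.fst_add, Pi.add_apply, h1, smul_add]
    · filter_upwards [P.ae_of_ae (Lp.coeFn_add a.1 b.1),
        P.ae_of_ae (Lp.coeFn_add a.2 b.2)] with x h1 h2
      simp only [Prod.fst_add, Prod.snd_add, Pi.add_apply, h1, h2, cdot_add_right]
      ring
  zero_mem' := by
    refine ⟨⟨0, P.HDivZero.zero_mem⟩, IsWeakDiv.zero.congr isOpen_interior ?_ ?_⟩
    · filter_upwards [P.ae_of_ae (Lp.coeFn_zero C3 2 P.μ)] with x h1
      simp only [Prod.fst_zero, h1, Pi.zero_apply, smul_zero]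
    · filter_upwards [P.ae_of_ae (Lp.coeFn_zero C3 2 P.μ),
        P.ae_of_ae (Lp.coeFn_zero ℂ 2 P.μ)] with x h1 h2
      simp only [Prod.fst_zero, Prod.snd_zero, h1, h2, Pi.zero_apply, cdot_zero_right, add_zero]
  smul_mem' := by
    rintro k a ⟨⟨d, hd⟩, ha⟩
    refine ⟨⟨k • d, P.HDivZero.smul_mem k hd⟩, (ha.smul k).congr isOpen_interior ?_ ?_⟩
    · filter_upwards [P.ae_of_ae (Lp.coeFn_smul k a.1)] with x h1
      simp only [Prod.smul_fst, Pi.smul_apply, h1, smul_comm k]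
    · filter_upwards [P.ae_of_ae (Lp.coeFn_smul k a.1),
        P.ae_of_ae (Lp.coeFn_smul k a.2)] with x h1 h2
      simp only [Prod.smul_fst, Prod.smul_snd, Pi.smul_apply, h1, h2, cdot_smul_right, smul_eq_mul]
      ring

/-- The unbounded operator `T u = ∇ · (ρ₀ u) - s̃ · u` from `H` to `L²(ρ₀ dx)` with domain
`H_{Div,0}(M)`. -/
def T : P.H →ₗ.[ℂ] P.L2 := P.graphT.toLinearPMap

theorem graphT_singleValued (w : P.H × P.L2) (hw : w ∈ P.graphT) (h0 : w.1 = 0) : w.2 = 0 := by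
  obtain ⟨-, hd⟩ := hw
  have hz : (w.1 : E3 → C3) =ᵐ[volume.restrict P.Ω] 0 := by
    rw [h0]; exact P.ae_of_ae (Lp.coeFn_zero C3 2 P.μ)
  have hd' : IsWeakDiv P.Ω (0 : E3 → C3) (w.2 : E3 → ℂ) := by
    refine hd.congr isOpen_interior ?_ ?_
    · filter_upwards [hz] with x hx
      simp only [hx, Pi.zero_apply, smul_zero]
    · filter_upwards [hz] with x hx
      simp only [hx, Pi.zero_apply, cdot_zero_right, add_zero]
  have h1 := isOpen_interior.ae_eq_zero_of_integral_contDiff_smul_eq_zero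
    (U := P.Ω) hd'.locInt_right (fun ψ h1 h2 h3 => by
      have h4 := hd'.eq ψ ⟨h1, h2, h3⟩
      simp only [Pi.zero_apply, cdot_zero_right, integral_zero] at h4
      have h5 : Function.support (fun x => ψ x • (w.2 : E3 → ℂ) x) ⊆ P.Ω := fun x hx => h3 <|
        subset_tsupport ψ fun h => hx (by simp only [h, zero_smul])
      rw [← setIntegral_eq_integral_of_forall_compl_eq_zero (s := P.Ω)
        (fun x hx => Function.notMem_support.1 fun h => hx (h5 h))]
      exact neg_eq_zero.1 h4.symm)
  have h2 : ∀ᵐ x ∂volume.restrict P.Ω, w.2 x = 0 :=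
    (ae_restrict_iff' isOpen_interior.measurableSet).2 h1
  have h3 : (w.2 : E3 → ℂ) =ᵐ[P.μ] 0 := (withDensity_absolutelyContinuous _ _).ae_le h2
  exact (Lp.eq_zero_iff_ae_eq_zero).2 h3

/-- `T` is well defined: its graph is the set of all pairs `(u, ∇ · (ρ₀ u) - s̃ · u)` above. -/
theorem T_graph : P.T.graph = P.graphT :=
  P.graphT.toLinearPMap_graph_eq fun x hx h0 => P.graphT_singleValued x hx h0

/-- `Ker(T)`, a subspace of `H`. -/
def kerT : Submodule ℂ P.H := (LinearMap.ker P.T.toFun).map P.T.domain.subtype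

/-- `Ran(T*)`, a subspace of `H`, where `T*` is the Hilbert space adjoint of `T`. -/
def ranTstar : Submodule ℂ P.H := LinearMap.range P.T†.toFun

/-- The element `p` of `L²(ρ₀ dx)` and the element `φ` of `H¹(M)` are the same function. -/
def SameFunction (p : P.L2) (φ : H1 P.M) : Prop :=
  (p : E3 → ℂ) =ᵐ[volume.restrict P.Ω] φ.1.fst

/-- `φ ∈ H¹(M)` satisfies `u = T* φ + u₂` for some `u₂ ∈ Ker(T)`. -/
def IsPotential (u : P.H) (φ : H1 P.M) : Prop :=
  ∃ p : P.T†.domain, P.SameFunction p φ ∧ ∃ u₂ ∈ P.kerT, u = P.T† p + u₂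

/-- `φ` has the minimum `H¹(M)` norm among all the potentials of `u`. -/
def IsMinNormPotential (u : P.H) (φ : H1 P.M) : Prop :=
  P.IsPotential u φ ∧ ∀ φ' : H1 P.M, P.IsPotential u φ' → ‖φ‖ ≤ ‖φ'‖

/-- `Ran(T*) ∩ D(T)` with the topology of `H_Div(M)`. -/
def ranTstarInterDomain : Submodule ℂ P.HDiv :=
  (P.ranTstar ⊓ P.T.domain).comap
    ((WithLp.fstₗ 2 ℂ P.H P.L2).comp P.HDiv.subtype)

end GasPlanet

end

/-! ### Compact operators and operators with closed range -/

/-! Write `b = (ρ₀²/κ) g₀'`, the field `drift`. The product rule gives `T u = ρ₀ ∇·u + b·u`, and the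
formal adjoint is `-(ρ₀ ∇φ + (2∇ρ₀ - b) φ)`, a bounded operator `tstar` from `H¹(M)` to `H`. Since
`ρ₀` is `C¹` and lies between positive constants on `M`, multiplication by powers of `ρ₀` preserves
`H¹(M)`, and the weighted and unweighted `L²` norms are equivalent.

Identification of the adjoint. The condition `u · n = 0` is by definition an integration by parts
against every `χ ∈ H¹(M)`. With `χ` the conjugate of `ρ₀² φ` it becomes `⟪T*φ, u⟫ = ⟪φ, T u⟫`
(`inner_tstar`). Conversely, if `u` is orthogonal to the range of `tstar`, taking `φ` to be the
conjugate of `ρ₀⁻² χ` shows that `u` has divergence `-b·u/ρ₀` and zero normal trace, so `u ∈ Ker T`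
(`exists_mem_HDivZero_of_inner_eq_zero`). If `q` is in the domain of the adjoint, testing on the
fields `ψ eᵢ` gives a weak gradient of `ρ₀² q` in `L²`, whence `q ∈ H¹(M)`
(`exists_eq_embed_of_inner`).

Closed range. Dividing by `ρ₀`, `T*φ` and `φ` control `∇φ`, so `‖φ‖_{H¹} ≤ C (‖T*φ‖ + ‖φ‖_{L²})`
(`exists_norm_le_tstar`). The embedding of `H¹(M)` in `L²` is compact by Rellich's theorem, so
Peetre's lemma (`exists_norm_le_of_compact`) bounds `T*` from below on the orthogonal complement of
its kernel in `H¹(M)`. Hence the range is closed, the orthogonal decomposition follows, and `Π` is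
the Moore-Penrose inverse of `tstar`.

Compactness. For `u ∈ Ran T* ∩ D(T)` one has `u = T*Πu`, so `‖u‖² = ⟪Πu, T u⟫ ≤ C ‖Πu‖_{L²}
‖u‖_{H_Div}`, and `u ↦ Πu ∈ L²` is compact because `Π` takes values in `H¹(M)`.

Rellich's theorem is proved without extending functions across the boundary. Smoothness of the
boundary gives a local cone of inward translations; a Sobolev function changes little in `L²` under
short ones, so it is close to its averages over translated balls, and finitely many such averages
suffice. -/

theorem isCompactOperator_of_norm_le {X Y : Type*} [NormedAddCommGroup X] [NormedSpace ℂ X]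
    [NormedAddCommGroup Y] [NormedSpace ℂ Y] [CompleteSpace Y] (J : X →ₗ[ℂ] Y)
    (h : ∀ ε : ℝ, 0 < ε → ∃ (Z : Type) (_ : NormedAddCommGroup Z) (_ : NormedSpace ℂ Z)
      (L : X →ₗ[ℂ] Z), IsCompactOperator L ∧ ∀ x, ‖J x‖ ≤ ε * ‖x‖ + ‖L x‖) :
    IsCompactOperator J := by
  rw [isCompactOperator_iff_isCompact_closure_image_ball (r := 1) (f := J) one_pos]
  suffices hT : TotallyBounded (J '' Metric.ball 0 1) from
    hT.closure.isCompact_of_isClosed isClosed_closure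
  rw [Metric.totallyBounded_iff]
  intro ε hε
  -- Two points of the unit ball are at distance at most 2, so an `ε / 4`-net for the image of `L`
  -- yields the bound `2 · ε / 4 + ε / 4 < ε` for `J`.
  obtain ⟨Z, _, _, L, hL, hJ⟩ := h (ε / 4) (by positivity)
  have hLt : TotallyBounded (L '' Metric.ball 0 1) := by
    rw [isCompactOperator_iff_isCompact_closure_image_ball (r := 1) (f := L) one_pos] at hL
    exact hL.totallyBounded.subset subset_closure
  obtain ⟨t, ht, htf, hcov⟩ := Metric.finite_approx_of_totallyBounded hLt (ε / 4) (by positivity)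
  have ht' : ∀ z, ∃ x, z ∈ t → x ∈ Metric.ball (0 : X) 1 ∧ L x = z := fun z => by
    by_cases hz : z ∈ t
    · obtain ⟨x, hx, hxz⟩ := ht hz
      exact ⟨x, fun _ => ⟨hx, hxz⟩⟩
    · exact ⟨0, fun h => absurd h hz⟩
  choose g hg using ht'
  refine ⟨(fun z => J (g z)) '' t, htf.image _, ?_⟩
  rintro _ ⟨x, hx, rfl⟩
  obtain ⟨z, hz, hxz⟩ := mem_iUnion₂.1 (hcov ⟨x, hx, rfl⟩)
  refine mem_iUnion₂.2 ⟨_, ⟨z, hz, rfl⟩, ?_⟩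
  obtain ⟨hgx, hgz⟩ := hg z hz
  rw [Metric.mem_ball, dist_eq_norm, ← hgz, ← map_sub] at hxz
  rw [Metric.mem_ball, dist_eq_norm, ← map_sub]
  have h1 := hJ (x - g z)
  have h2 : ‖x - g z‖ ≤ 2 := by
    have := norm_sub_le x (g z)
    simp only [mem_ball_zero_iff] at hx hgx
    linarith
  nlinarith

theorem isCompactOperator_pi {X ι : Type*} [Finite ι] [Zero X] [TopologicalSpace X]
    {Y : ι → Type*} [∀ i, TopologicalSpace (Y i)] {f : ∀ i, X → Y i}
    (hf : ∀ i, IsCompactOperator (f i)) : IsCompactOperator fun x i => f i x := by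
  choose K hK hf using hf
  refine ⟨univ.pi K, isCompact_univ_pi hK, ?_⟩
  refine Filter.mem_of_superset (Filter.iInter_mem.2 hf) fun x hx => ?_
  simpa using hx

/-- The finitely many functionals form one map into a finite-dimensional space, which is compact;
the factor `A` is absorbed by rescaling that map. -/
theorem isCompactOperator_of_norm_le_finite {X Y : Type*} [NormedAddCommGroup X] [NormedSpace ℂ X]
    [NormedAddCommGroup Y] [NormedSpace ℂ Y] [CompleteSpace Y] (J : X →L[ℂ] Y)
    (h : ∀ ε : ℝ, 0 < ε → ∃ (ι : Type) (_ : Fintype ι) (_ : Nonempty ι) (l : ι → X →L[ℂ] ℂ)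
      (A : ℝ), 0 ≤ A ∧
      ∀ x, ∀ C : ℝ, (∀ i, ‖l i x‖ ≤ C) → ‖J x‖ ≤ ε * ‖x‖ + A * C) :
    IsCompactOperator J := by
  refine isCompactOperator_of_norm_le J.toLinearMap fun ε hε => ?_
  obtain ⟨ι, _, _, l, A, hA, hle⟩ := h ε hε
  let L : X →L[ℂ] (ι → ℂ) := (A : ℂ) • ContinuousLinearMap.pi l
  have hL : IsCompactOperator L := isCompactOperator_of_locallyCompactSpace_dom L
  refine ⟨ι → ℂ, inferInstance, inferInstance, L.toLinearMap, hL, fun x => ?_⟩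
  have h1 := hle x ‖fun i => l i x‖ fun i => norm_le_pi_norm (fun i => l i x) i
  have hLx : ‖L x‖ = A * ‖fun i => l i x‖ := by
    change ‖(A : ℂ) • fun i => l i x‖ = _
    rw [norm_smul, Complex.norm_real, Real.norm_of_nonneg hA]
  calc _ ≤ _ := h1
    _ = ε * ‖x‖ + ‖L x‖ := by rw [hLx]

/-- Used to glue local compactness over a finite cover. The factor `√(card ι)` compares the
Euclidean sum with the sup norm of the product. -/
theorem isCompactOperator_of_norm_sq_le_sum {X Y : Type*} [NormedAddCommGroup X]
    [NormedSpace ℂ X] [NormedAddCommGroup Y] [NormedSpace ℂ Y] [CompleteSpace Y] {ι : Type}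
    [Fintype ι] {Z : ι → Type} [∀ i, NormedAddCommGroup (Z i)] [∀ i, NormedSpace ℂ (Z i)]
    (J : X →L[ℂ] Y) {K : ∀ i, X →L[ℂ] Z i} (hK : ∀ i, IsCompactOperator (K i))
    (h : ∀ x, ‖J x‖ ^ 2 ≤ ∑ i, ‖K i x‖ ^ 2) : IsCompactOperator J := by
  let L : X →L[ℂ] ∀ i, Z i := ContinuousLinearMap.pi K
  have hL : IsCompactOperator L := isCompactOperator_pi hK
  refine isCompactOperator_of_norm_le J.toLinearMap fun ε hε => ?_
  refine ⟨∀ i, Z i, inferInstance, inferInstance, ((Real.sqrt (Fintype.card ι) : ℂ) • L).toLinearMap,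
    hL.smul (Real.sqrt (Fintype.card ι) : ℂ), fun x => ?_⟩
  have h2 : ‖J x‖ ^ 2 ≤ Fintype.card ι * ‖L x‖ ^ 2 := by
    refine (h x).trans ((Finset.sum_le_card_nsmul _ _ (‖L x‖ ^ 2) fun i _ => ?_).trans_eq ?_)
    · exact pow_le_pow_left₀ (norm_nonneg _) (norm_le_pi_norm (L x) i) 2
    · rw [Finset.card_univ, nsmul_eq_mul]
  have h3 : ‖J x‖ ≤ Real.sqrt (Fintype.card ι) * ‖L x‖ := by
    refine abs_le_of_sq_le_sq' ?_ (by positivity) |>.2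
    rwa [mul_pow, Real.sq_sqrt (by positivity)]
  have h4 : ‖((Real.sqrt (Fintype.card ι) : ℂ) • L) x‖ = Real.sqrt (Fintype.card ι) * ‖L x‖ := by
    change ‖(Real.sqrt (Fintype.card ι) : ℂ) • L x‖ = _
    rw [norm_smul, Complex.norm_real, Real.norm_of_nonneg (Real.sqrt_nonneg _)]
  calc _ ≤ _ := h3
    _ ≤ ε * ‖x‖ + ‖((Real.sqrt (Fintype.card ι) : ℂ) • L) x‖ := by
      rw [h4]; linarith [mul_nonneg hε.le (norm_nonneg x)]

/-! ### Bounded operators between Hilbert spaces: lower bounds, closed range, pseudo-inverse -/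

section

variable {X Y Z : Type*} [NormedAddCommGroup X] [InnerProductSpace ℂ X]
  [NormedAddCommGroup Y] [InnerProductSpace ℂ Y]
  [NormedAddCommGroup Z] [InnerProductSpace ℂ Z]

/-- Peetre's lemma: an a priori estimate modulo a compact operator makes `B` bounded below
on the orthogonal complement of its kernel. -/
theorem exists_norm_le_of_compact [CompleteSpace X] (B : X →L[ℂ] Y) (J : X →L[ℂ] Z) (hJ : IsCompactOperator J)
    {C : ℝ} (hC : ∀ x, ‖x‖ ≤ C * (‖B x‖ + ‖J x‖)) :
    ∃ c : ℝ, 0 < c ∧ ∀ x ∈ (LinearMap.ker B.toLinearMap)ᗮ, ‖x‖ ≤ c * ‖B x‖ := by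
  by_contra! hcon
  have hseq : ∀ n : ℕ, ∃ x ∈ (LinearMap.ker B.toLinearMap)ᗮ, ‖x‖ = 1 ∧
      ‖B x‖ ≤ 1 / ((n : ℝ) + 1) := by
    intro n
    obtain ⟨x, hx, hlt⟩ := hcon ((n : ℝ) + 1) (by positivity)
    have hpos : 0 < ‖x‖ := lt_of_le_of_lt (by positivity) hlt
    refine ⟨((‖x‖⁻¹ : ℝ) : ℂ) • x, Submodule.smul_mem _ _ hx, ?_, ?_⟩
    · rw [norm_smul]; simp [hpos.ne']
    · rw [map_smul, norm_smul]
      simp only [Complex.ofReal_inv, norm_inv, Complex.norm_real, norm_norm]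
      rw [inv_mul_le_iff₀ hpos, mul_one_div, le_div_iff₀ (by positivity)]
      linarith
  choose x hxm hx1 hxB using hseq
  have hBt : Filter.Tendsto (fun n => B (x n)) Filter.atTop (𝓝 0) :=
    squeeze_zero_norm hxB tendsto_one_div_add_atTop_nhds_zero_nat
  obtain ⟨K, hK, hsub⟩ := IsCompactOperator.image_closedBall_subset_compact (f := J.toLinearMap)
    hJ 1
  obtain ⟨z, -, σ, hσ, hz⟩ := hK.tendsto_subseq
    (x := fun n => J (x n)) (fun n => hsub ⟨x n, by simp [hx1], rfl⟩)
  have hBσ := hBt.comp hσ.tendsto_atTop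
  -- Both `B x` and `J x` are Cauchy along the subsequence, and the a priori estimate transfers this
  -- to `x`. The constant `|C| + 1` is used because `C` carries no sign assumption.
  have hcau : CauchySeq (x ∘ σ) := by
    rw [Metric.cauchySeq_iff']
    intro ε hε
    obtain ⟨N1, h1⟩ := Metric.cauchySeq_iff.1 hBσ.cauchySeq (ε / (2 * (|C| + 1))) (by positivity)
    obtain ⟨N2, h2⟩ := Metric.cauchySeq_iff.1 hz.cauchySeq (ε / (2 * (|C| + 1))) (by positivity)
    refine ⟨max N1 N2, fun n hn => ?_⟩
    have e1 := h1 n (le_of_max_le_left hn) (max N1 N2) (le_max_left _ _)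
    have e2 := h2 n (le_of_max_le_right hn) (max N1 N2) (le_max_right _ _)
    simp only [Function.comp_apply, dist_eq_norm, ← map_sub] at e1 e2 ⊢
    have e3 := hC (x (σ n) - x (σ (max N1 N2)))
    have hs : ‖B (x (σ n) - x (σ (max N1 N2)))‖ + ‖J (x (σ n) - x (σ (max N1 N2)))‖
        < ε / (|C| + 1) := by
      have : ε / (|C| + 1) = ε / (2 * (|C| + 1)) + ε / (2 * (|C| + 1)) := by field_simp; ring
      linarith
    have hC0 : 0 < |C| + 1 := by positivity
    rw [lt_div_iff₀ hC0] at hs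
    have hC1 : C ≤ |C| + 1 := (le_abs_self C).trans (by linarith)
    calc _ ≤ C * _ := e3
      _ ≤ (|C| + 1) * _ := mul_le_mul_of_nonneg_right hC1 (by positivity)
      _ < ε := by rw [mul_comm]; exact hs
  obtain ⟨w, hw⟩ := cauchySeq_tendsto_of_complete hcau
  -- The limit is a unit vector lying in the kernel and in its orthogonal complement.
  have hw1 : ‖w‖ = 1 := by
    refine tendsto_nhds_unique hw.norm ?_
    simp [hx1]
  have hwm : w ∈ (LinearMap.ker B.toLinearMap)ᗮ :=
    (Submodule.isClosed_orthogonal _).mem_of_tendsto hw (Filter.Eventually.of_forall fun n => hxm _)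
  have hwk : w ∈ LinearMap.ker B.toLinearMap := by
    rw [LinearMap.mem_ker]
    exact tendsto_nhds_unique ((B.continuous.tendsto w).comp hw) hBσ
  have h0 := Submodule.inner_right_of_mem_orthogonal hwk hwm
  rw [inner_self_eq_norm_sq_to_K, hw1] at h0
  simp at h0

theorem exists_mem_orthogonal_ker_map_eq [CompleteSpace X] (B : X →L[ℂ] Y) (x : X) :
    ∃ x' ∈ (LinearMap.ker B.toLinearMap)ᗮ, B x' = B x := by
  have : CompleteSpace (LinearMap.ker B.toLinearMap) := B.isClosed_ker.completeSpace_coe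
  refine ⟨x - (LinearMap.ker B.toLinearMap).starProjection x,
    (LinearMap.ker B.toLinearMap).sub_starProjection_mem_orthogonal x, ?_⟩
  have h : B ((LinearMap.ker B.toLinearMap).starProjection x) = 0 :=
    LinearMap.mem_ker.1 ((LinearMap.ker B.toLinearMap).starProjection_apply_mem x)
  rw [map_sub, h, sub_zero]

variable {B : X →L[ℂ] Y} {c : ℝ}

/-- Preimages can be chosen orthogonal to the kernel, and there the lower bound turns a convergent
sequence of values into a Cauchy sequence of preimages. -/
theorem isClosed_range_of_norm_le [CompleteSpace X]
    (hc : ∀ x ∈ (LinearMap.ker B.toLinearMap)ᗮ, ‖x‖ ≤ c * ‖B x‖) :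
    IsClosed (LinearMap.range B.toLinearMap : Set Y) := by
  rw [← isSeqClosed_iff_isClosed]
  intro y l hy hl
  have : ∀ n, ∃ x ∈ (LinearMap.ker B.toLinearMap)ᗮ, B x = y n := fun n => by
    obtain ⟨x, hx⟩ := hy n
    obtain ⟨x', h1, h2⟩ := exists_mem_orthogonal_ker_map_eq B x
    exact ⟨x', h1, h2.trans hx⟩
  choose x hxm hxy using this
  have hcau : CauchySeq x := by
    rw [Metric.cauchySeq_iff]
    intro ε hε
    obtain ⟨N, hN⟩ := Metric.cauchySeq_iff.1 hl.cauchySeq (ε / (|c| + 1)) (by positivity)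
    refine ⟨N, fun m hm n hn => ?_⟩
    have h1 := hN m hm n hn
    have h2 := hc _ (Submodule.sub_mem _ (hxm m) (hxm n))
    rw [map_sub, hxy, hxy] at h2
    rw [dist_eq_norm] at h1 ⊢
    have hC0 : 0 < |c| + 1 := by positivity
    rw [lt_div_iff₀ hC0] at h1
    have hC1 : c ≤ |c| + 1 := (le_abs_self c).trans (by linarith)
    calc _ ≤ c * _ := h2
      _ ≤ (|c| + 1) * _ := mul_le_mul_of_nonneg_right hC1 (by positivity)
      _ < ε := by rw [mul_comm]; exact h1
  obtain ⟨w, hw⟩ := cauchySeq_tendsto_of_complete hcau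
  refine ⟨w, tendsto_nhds_unique ((B.continuous.tendsto w).comp hw) ?_⟩
  simpa [Function.comp_def, hxy] using hl

/-- The Moore-Penrose inverse of an operator with closed range. -/
theorem exists_pseudoInverse [CompleteSpace X] [CompleteSpace Y]
    (hc : ∀ x ∈ (LinearMap.ker B.toLinearMap)ᗮ, ‖x‖ ≤ c * ‖B x‖) :
    ∃ Φ : Y →L[ℂ] X, ∀ y, Φ y ∈ (LinearMap.ker B.toLinearMap)ᗮ ∧
      y - B (Φ y) ∈ (LinearMap.range B.toLinearMap)ᗮ := by
  set R := LinearMap.range B.toLinearMap with hR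
  have hRc : CompleteSpace R := (isClosed_range_of_norm_le hc).completeSpace_coe
  have key : ∀ y : Y, ∃ x ∈ (LinearMap.ker B.toLinearMap)ᗮ, B x = R.starProjection y := fun y => by
    obtain ⟨x, hx⟩ := R.starProjection_apply_mem y
    obtain ⟨x', h1, h2⟩ := exists_mem_orthogonal_ker_map_eq B x
    exact ⟨x', h1, h2.trans hx⟩
  choose f hf hfB using key
  -- The lower bound makes the preimage orthogonal to the kernel unique; linearity of `f` is a
  -- consequence of this uniqueness.
  have huniq : ∀ x ∈ (LinearMap.ker B.toLinearMap)ᗮ, ∀ y, B x = R.starProjection y → x = f y := by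
    intro x hx y hxy
    have h := hc _ (Submodule.sub_mem _ hx (hf y))
    rw [map_sub, hfB, hxy, sub_self, norm_zero, mul_zero] at h
    exact sub_eq_zero.1 (norm_le_zero_iff.1 h)
  let F : Y →ₗ[ℂ] X :=
    { toFun := f
      map_add' := fun y y' => (huniq _ (Submodule.add_mem _ (hf y) (hf y')) _
        (by rw [map_add, map_add, hfB, hfB])).symm
      map_smul' := fun k y => (huniq _ (Submodule.smul_mem _ k (hf y)) _
        (by simp only [map_smul, hfB])).symm }
  refine ⟨F.mkContinuous |c| fun y => ?_, fun y => ⟨hf y, ?_⟩⟩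
  · calc ‖f y‖ ≤ c * ‖B (f y)‖ := hc _ (hf y)
      _ ≤ |c| * ‖B (f y)‖ := mul_le_mul_of_nonneg_right (le_abs_self c) (norm_nonneg _)
      _ ≤ |c| * ‖y‖ := by
        rw [hfB]
        exact mul_le_mul_of_nonneg_left (R.norm_starProjection_apply_le y) (abs_nonneg c)
  · change y - B (f y) ∈ Rᗮ
    rw [hfB]
    exact R.sub_starProjection_mem_orthogonal y

/-- The Moore-Penrose inverse selects the solution of minimal norm. -/
theorem pseudoInverse_eq_iff {Φ : Y →L[ℂ] X}
    (hΦ : ∀ y, Φ y ∈ (LinearMap.ker B.toLinearMap)ᗮ ∧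
      y - B (Φ y) ∈ (LinearMap.range B.toLinearMap)ᗮ) (y : Y) (x : X) :
    Φ y = x ↔ y - B x ∈ (LinearMap.range B.toLinearMap)ᗮ ∧
      ∀ x', y - B x' ∈ (LinearMap.range B.toLinearMap)ᗮ → ‖x‖ ≤ ‖x'‖ := by
  -- Pythagoras: for two least-squares solutions, the image of their difference lies in the range
  -- and in its orthogonal complement. The difference is thus in the kernel, to which `Φ y` is
  -- orthogonal.
  have hsol : ∀ x', y - B x' ∈ (LinearMap.range B.toLinearMap)ᗮ →
      ‖x'‖ * ‖x'‖ = ‖Φ y‖ * ‖Φ y‖ + ‖x' - Φ y‖ * ‖x' - Φ y‖ := by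
    intro x' hx'
    have h1 : B (x' - Φ y) ∈ (LinearMap.range B.toLinearMap)ᗮ := by
      have := Submodule.sub_mem _ (hΦ y).2 hx'
      simpa using this
    have h2 : B (x' - Φ y) = 0 := by
      have := Submodule.inner_right_of_mem_orthogonal (LinearMap.mem_range_self B.toLinearMap (x' - Φ y)) h1
      exact inner_self_eq_zero.1 this
    have h3 : ⟪Φ y, x' - Φ y⟫_ℂ = 0 :=
      Submodule.inner_left_of_mem_orthogonal (LinearMap.mem_ker.2 h2) (hΦ y).1
    have := norm_add_sq_eq_norm_sq_add_norm_sq_of_inner_eq_zero (Φ y) (x' - Φ y) h3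
    simpa using this
  constructor
  · rintro rfl
    refine ⟨(hΦ y).2, fun x' hx' => ?_⟩
    have := hsol x' hx'
    nlinarith [norm_nonneg x', norm_nonneg (Φ y), mul_self_nonneg ‖x' - Φ y‖]
  · rintro ⟨h1, h2⟩
    have e1 := hsol x h1
    have e2 := h2 (Φ y) (hΦ y).2
    have e3 : ‖x - Φ y‖ * ‖x - Φ y‖ = 0 := by
      nlinarith [norm_nonneg x, norm_nonneg (Φ y), mul_self_nonneg ‖x - Φ y‖]
    exact (sub_eq_zero.1 (norm_eq_zero.1 (mul_self_eq_zero.1 e3))).symm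

end

/-! ### Calculus of weak derivatives -/

@[simp] theorem toC3_apply (v : E3) (i : Fin 3) : toC3 v i = (v i : ℂ) := rfl

theorem norm_toC3 (v : E3) : ‖toC3 v‖ = ‖v‖ := by
  simp [EuclideanSpace.norm_eq]

theorem toC3_add (v w : E3) : toC3 (v + w) = toC3 v + toC3 w := by
  ext i; simp

theorem toC3_sub (v w : E3) : toC3 (v - w) = toC3 v - toC3 w := by
  ext i; simp

theorem toC3_smul (k : ℝ) (v : E3) : toC3 (k • v) = (k : ℂ) • toC3 v := by
  ext i; simp

theorem continuous_toC3 : Continuous toC3 := by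
  refine (PiLp.continuous_toLp 2 _).comp (continuous_pi fun i => ?_)
  exact Complex.continuous_ofReal.comp (EuclideanSpace.proj (𝕜 := ℝ) i).continuous

/-- Componentwise complex conjugation. -/
noncomputable def conj3 (v : C3) : C3 := WithLp.toLp 2 fun i => starRingEnd ℂ (v i)

@[simp] theorem conj3_apply (v : C3) (i : Fin 3) : conj3 v i = starRingEnd ℂ (v i) := rfl

theorem norm_conj3 (v : C3) : ‖conj3 v‖ = ‖v‖ := by
  simp [EuclideanSpace.norm_eq]

theorem continuous_conj3 : Continuous conj3 := by
  refine (PiLp.continuous_toLp 2 _).comp (continuous_pi fun i => ?_)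
  exact Complex.continuous_conj.comp (EuclideanSpace.proj (𝕜 := ℂ) i).continuous

theorem inner_eq_cdot (a b : C3) : ⟪a, b⟫_ℂ = cdot (conj3 a) b := by
  simp [PiLp.inner_apply, cdot, mul_comm]

theorem norm_cdot_le (a b : C3) : ‖cdot a b‖ ≤ ‖a‖ * ‖b‖ := by
  have h := norm_inner_le_norm (𝕜 := ℂ) (conj3 a) b
  rw [inner_eq_cdot, norm_conj3] at h
  have e : conj3 (conj3 a) = a := by ext i; simp
  rwa [e] at h

theorem norm_gradient (ψ : E3 → ℝ) (x : E3) : ‖gradient ψ x‖ = ‖fderiv ℝ ψ x‖ := by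
  simp [gradient]

theorem gradient_sub_eq {ψ θ : E3 → ℝ} {x : E3} (h1 : DifferentiableAt ℝ ψ x)
    (h2 : DifferentiableAt ℝ θ x) :
    gradient (fun y => ψ y - θ y) x = gradient ψ x - gradient θ x := by
  simp only [gradient]
  rw [← map_sub]
  congr 1
  exact fderiv_sub h1 h2

theorem gradient_mul_eq {ψ θ : E3 → ℝ} {x : E3} (h1 : DifferentiableAt ℝ ψ x)
    (h2 : DifferentiableAt ℝ θ x) :
    gradient (fun y => ψ y * θ y) x = ψ x • gradient θ x + θ x • gradient ψ x := by
  simp only [gradient]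
  rw [← map_smul, ← map_smul, ← map_add]
  congr 1
  exact fderiv_mul h1 h2

theorem inner_gradient (ψ : E3 → ℝ) (x v : E3) : ⟪gradient ψ x, v⟫_ℝ = fderiv ℝ ψ x v := by
  simp [gradient]

theorem continuous_gradient {ψ : E3 → ℝ} (h : ContDiff ℝ 1 ψ) : Continuous (gradient ψ) :=
  (LinearIsometryEquiv.continuous _).comp (h.continuous_fderiv one_ne_zero)

theorem tsupport_gradient_subset (ψ : E3 → ℝ) : tsupport (gradient ψ) ⊆ tsupport ψ := by
  refine (closure_mono ?_).trans (tsupport_fderiv_subset ℝ)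
  intro x hx h0
  exact hx (by simp [gradient, h0])

/-- `C¹` functions of compact support are limits in `C¹` of test functions. -/
theorem exists_isTestFunction_near {Ω : Set E3} (hΩ : IsOpen Ω) {ψ : E3 → ℝ}
    (hψ : ContDiff ℝ 1 ψ) (hc : HasCompactSupport ψ) (hs : tsupport ψ ⊆ Ω) :
    ∃ K, IsCompact K ∧ K ⊆ Ω ∧ tsupport ψ ⊆ K ∧ ∀ ε > 0, ∃ θ, IsTestFunction Ω θ ∧
      tsupport θ ⊆ K ∧ ∀ x, ‖ψ x - θ x‖ ≤ ε ∧ ‖fderiv ℝ ψ x - fderiv ℝ θ x‖ ≤ ε := by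
  obtain ⟨δ, hδ, hδΩ⟩ := IsCompact.exists_cthickening_subset_open hc hΩ hs
  refine ⟨Metric.cthickening δ (tsupport ψ), IsCompact.cthickening hc, hδΩ,
    Metric.self_subset_cthickening _, fun ε hε => ?_⟩
  have hfc : HasCompactSupport (fderiv ℝ ψ) := hc.fderiv ℝ
  have hfcont := hψ.continuous_fderiv one_ne_zero
  obtain ⟨δ₁, h1, hu1⟩ := Metric.uniformContinuous_iff.1
    (hc.uniformContinuous_of_continuous hψ.continuous) ε hε
  obtain ⟨δ₂, h2, hu2⟩ := Metric.uniformContinuous_iff.1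
    (hfc.uniformContinuous_of_continuous hfcont) ε hε
  -- The mollification radius is below the width of the thickening, for the support, and below both
  -- moduli of uniform continuity, for `ψ` and for its derivative.
  set R := min δ (min δ₁ δ₂) with hR
  have hR0 : 0 < R := by positivity
  let φ : ContDiffBump (0 : E3) := ⟨R / 2, R, by positivity, by linarith⟩
  let θ : E3 → ℝ := convolution (φ.normed volume) ψ (ContinuousLinearMap.lsmul ℝ ℝ) volume
  have hli : LocallyIntegrable (φ.normed (volume : Measure E3)) volume :=
    φ.continuous_normed.locallyIntegrable
  have hsub : tsupport θ ⊆ Metric.cthickening δ (tsupport ψ) := by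
    refine closure_minimal ?_ Metric.isClosed_cthickening
    intro x hx
    have := support_convolution_subset (ContinuousLinearMap.lsmul ℝ ℝ) hx
    obtain ⟨y, hy, z, hz, rfl⟩ := this
    rw [φ.support_normed_eq] at hy
    refine Metric.mem_cthickening_of_dist_le _ z _ _ (subset_tsupport _ hz) ?_
    have : ‖y‖ < R := by simpa using hy
    simp only [dist_eq_norm, add_sub_cancel_right]
    exact this.le.trans (min_le_left _ _)
  refine ⟨θ, ⟨?_, ?_, hsub.trans hδΩ⟩, hsub, fun x => ⟨?_, ?_⟩⟩
  · exact φ.hasCompactSupport_normed.contDiff_convolution_left _ φ.contDiff_normed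
      hψ.continuous.locallyIntegrable
  · exact (IsCompact.cthickening hc).of_isClosed_subset (isClosed_tsupport _) hsub
  · rw [← dist_eq_norm, dist_comm]
    refine φ.dist_normed_convolution_le hψ.continuous.aestronglyMeasurable fun y hy => ?_
    exact (hu1 (lt_of_lt_of_le hy ((min_le_right _ _).trans (min_le_left _ _)))).le
  · have hd := hc.hasFDerivAt_convolution_right (ContinuousLinearMap.lsmul ℝ ℝ) hli hψ x
    have hpre : (ContinuousLinearMap.lsmul ℝ ℝ : ℝ →L[ℝ] ℝ →L[ℝ] ℝ).precompR E3 =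
        ContinuousLinearMap.lsmul ℝ ℝ := by
      ext; rfl
    rw [hpre] at hd
    rw [hd.fderiv, ← dist_eq_norm, dist_comm]
    refine φ.dist_normed_convolution_le hfcont.aestronglyMeasurable fun y hy => ?_
    exact (hu2 (lt_of_lt_of_le hy ((min_le_right _ _).trans (min_le_right _ _)))).le

theorem locallyIntegrableOn_sum_three {Ω : Set E3} {F : Type*} [NormedAddCommGroup F]
    {f : Fin 3 → E3 → F} (h : ∀ i, LocallyIntegrableOn (f i) Ω) :
    LocallyIntegrableOn (fun x => ∑ i, f i x) Ω := by
  simp only [Fin.sum_univ_three]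
  exact ((h 0).add (h 1)).add (h 2)

theorem locallyIntegrableOn_cdot {Ω : Set E3} (hΩ : IsOpen Ω) {u : E3 → C3}
    (hu : LocallyIntegrableOn u Ω) {w : E3 → E3} (hw : ContinuousOn w Ω) :
    LocallyIntegrableOn (fun x => cdot (toC3 (w x)) (u x)) Ω := by
  have e : (fun x => cdot (toC3 (w x)) (u x)) =
      fun x => ∑ i : Fin 3, w x i • u x i := by
    funext x; simp [cdot]
  rw [e]
  refine locallyIntegrableOn_sum_three fun i => ?_
  exact (locInt_apply hu i).continuousOn_smul hΩ.isLocallyClosed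
    ((EuclideanSpace.proj (𝕜 := ℝ) i).continuous.comp_continuousOn hw)

theorem integrableOn_cdot_of_hasCompactSupport {Ω : Set E3} {u : E3 → C3}
    (hu : LocallyIntegrableOn u Ω) {w : E3 → E3} (hw : Continuous w) {K : Set E3}
    (hK : IsCompact K) (hKΩ : K ⊆ Ω) (hs : tsupport w ⊆ K) :
    IntegrableOn (fun x => cdot (toC3 (w x)) (u x)) Ω := by
  have hi : ∀ i, tsupport (fun x => w x i) ⊆ K := fun i => by
    refine (closure_mono (Function.support_subset_iff'.2 fun x hx => ?_)).trans hs
    rw [Function.notMem_support.1 hx]; rfl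
  have e : (fun x => cdot (toC3 (w x)) (u x)) = fun x => ∑ i : Fin 3, w x i • u x i := by
    funext x; simp [cdot]
  rw [e]
  refine integrable_finsetSum _ fun i _ => ?_
  exact locInt_integrableOn_smul (locInt_apply hu i)
    ((EuclideanSpace.proj (𝕜 := ℝ) i).continuous.comp hw)
    (hK.of_isClosed_subset (isClosed_tsupport _) (hi i)) ((hi i).trans hKΩ)

theorem norm_setIntegral_le_of_support {F : Type*} [NormedAddCommGroup F] [NormedSpace ℝ F]
    {Ω K : Set E3} (hΩ : IsOpen Ω) (hKΩ : K ⊆ Ω) {f : E3 → F} {g : E3 → ℝ}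
    (hg : IntegrableOn g K) (hfg : ∀ x, ‖f x‖ ≤ g x) (hf : ∀ x ∉ K, f x = 0) :
    ‖∫ x in Ω, f x‖ ≤ ∫ x in K, g x := by
  have e : ∫ x in Ω, f x = ∫ x in K, f x :=
    
    setIntegral_eq_of_subset_of_forall_sdiff_eq_zero hΩ.measurableSet hKΩ fun x hx => hf x hx.2
  rw [e]
  exact norm_integral_le_of_norm_le hg (ae_of_all _ hfg)

/-- The defining identity of the weak divergence extends to `C¹` functions. -/
theorem IsWeakDiv.eq_of_contDiff_one {Ω : Set E3} (hΩ : IsOpen Ω) {u : E3 → C3} {d : E3 → ℂ}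
    (h : IsWeakDiv Ω u d) {ψ : E3 → ℝ} (hψ : ContDiff ℝ 1 ψ) (hc : HasCompactSupport ψ)
    (hs : tsupport ψ ⊆ Ω) :
    ∫ x in Ω, cdot (toC3 (gradient ψ x)) (u x) = -∫ x in Ω, ψ x • d x := by
  obtain ⟨K, hK, hKΩ, hψK, happ⟩ := exists_isTestFunction_near hΩ hψ hc hs
  have iu : IntegrableOn (fun x => ‖u x‖) K := (h.1.integrableOn_compact_subset hKΩ hK).norm
  have id : IntegrableOn (fun x => ‖d x‖) K := (h.2.integrableOn_compact_subset hKΩ hK).norm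
  -- The compact set `K` does not depend on the accuracy, so approximation within `ε / (A + 1)`
  -- costs at most `A ε / (A + 1) ≤ ε` in the identity.
  set A := (∫ x in K, ‖u x‖) + ∫ x in K, ‖d x‖ with hA
  have hA0 : 0 ≤ A := add_nonneg (integral_nonneg fun _ => norm_nonneg _)
    (integral_nonneg fun _ => norm_nonneg _)
  rw [← sub_eq_zero, sub_neg_eq_add, ← norm_eq_zero]
  refine le_antisymm (le_of_forall_pos_le_add fun ε hε => ?_) (norm_nonneg _)
  obtain ⟨θ, hθ, hθK, hclose⟩ := happ (ε / (A + 1)) (by positivity)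
  have hθ1 : ContDiff ℝ 1 θ := hθ.smooth.of_le (by norm_cast)
  set η : E3 → ℝ := fun x => ψ x - θ x with hη
  have hη1 : ContDiff ℝ 1 η := hψ.sub hθ1
  have hηK : tsupport η ⊆ K := by
    refine closure_minimal (fun x hx => ?_) hK.isClosed
    by_contra hxK
    refine hx ?_
    simp only [hη, image_eq_zero_of_notMem_tsupport fun h => hxK (hψK h),
      image_eq_zero_of_notMem_tsupport fun h => hxK (hθK h), sub_zero]
  have hgrad : ∀ x, gradient η x = gradient ψ x - gradient θ x := fun x =>
    gradient_sub_eq (hψ.differentiable one_ne_zero x) (hθ1.differentiable one_ne_zero x)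
  have i1 : ∀ {f : E3 → ℝ}, ContDiff ℝ 1 f → tsupport f ⊆ K →
      IntegrableOn (fun x => cdot (toC3 (gradient f x)) (u x)) Ω := fun hf hfK =>
    integrableOn_cdot_of_hasCompactSupport h.1 (continuous_gradient hf) hK hKΩ
      ((tsupport_gradient_subset _).trans hfK)
  have i2 : ∀ {f : E3 → ℝ}, ContDiff ℝ 1 f → tsupport f ⊆ K →
      IntegrableOn (fun x => f x • d x) Ω := fun hf hfK =>
    locInt_integrableOn_smul h.2 hf.continuous (hK.of_isClosed_subset (isClosed_tsupport _) hfK)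
      (hfK.trans hKΩ)
  have e1 : ∫ x in Ω, cdot (toC3 (gradient ψ x)) (u x) =
      (∫ x in Ω, cdot (toC3 (gradient η x)) (u x)) +
        ∫ x in Ω, cdot (toC3 (gradient θ x)) (u x) := by
    rw [← integral_add (i1 hη1 hηK) (i1 hθ1 hθK)]
    simp only [hgrad, ← cdot_add_left, ← toC3_add, sub_add_cancel]
  have e2 : ∫ x in Ω, ψ x • d x = (∫ x in Ω, η x • d x) + ∫ x in Ω, θ x • d x := by
    rw [← integral_add (i2 hη1 hηK) (i2 hθ1 hθK)]
    simp only [hη, ← add_smul, sub_add_cancel]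
  -- The identity is exact for the test function `θ`, so only the small difference `η = ψ - θ`
  -- contributes to the defect.
  have e3 := h.eq θ hθ
  have e4 : (∫ x in Ω, cdot (toC3 (gradient ψ x)) (u x)) + ∫ x in Ω, ψ x • d x =
      (∫ x in Ω, cdot (toC3 (gradient η x)) (u x)) + ∫ x in Ω, η x • d x := by
    rw [e1, e2, e3]; ring
  rw [e4, zero_add]
  have b1 : ‖∫ x in Ω, cdot (toC3 (gradient η x)) (u x)‖ ≤
      ∫ x in K, ε / (A + 1) * ‖u x‖ := by
    refine norm_setIntegral_le_of_support hΩ hKΩ (iu.const_mul _) (fun x => ?_) fun x hx => ?_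
    · refine (norm_cdot_le _ _).trans (mul_le_mul_of_nonneg_right ?_ (norm_nonneg _))
      rw [norm_toC3, hgrad]
      simpa [gradient, ← map_sub] using (hclose x).2
    · rw [image_eq_zero_of_notMem_tsupport fun h => hx (hηK (tsupport_gradient_subset _ h))]
      simp [cdot]
  have b2 : ‖∫ x in Ω, η x • d x‖ ≤ ∫ x in K, ε / (A + 1) * ‖d x‖ := by
    refine norm_setIntegral_le_of_support hΩ hKΩ (id.const_mul _) (fun x => ?_) fun x hx => ?_
    · rw [norm_smul]
      exact mul_le_mul_of_nonneg_right (hclose x).1 (norm_nonneg _)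
    · rw [image_eq_zero_of_notMem_tsupport fun h => hx (hηK h), zero_smul]
  rw [integral_const_mul] at b1 b2
  calc _ ≤ _ := norm_add_le _ _
    _ ≤ _ := add_le_add b1 b2
    _ = ε * (A / (A + 1)) := by rw [hA]; ring
    _ ≤ ε * 1 := by
      refine mul_le_mul_of_nonneg_left ?_ hε.le
      rw [div_le_one (by positivity)]; linarith
    _ = ε := mul_one ε

theorem contDiff_mul_of_tsupport_subset {Ω : Set E3} (hΩ : IsOpen Ω) {a ψ : E3 → ℝ}
    (ha : ContDiffOn ℝ 1 a Ω) (hψ : ContDiff ℝ 1 ψ) (hs : tsupport ψ ⊆ Ω) :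
    ContDiff ℝ 1 fun x => a x * ψ x := by
  rw [contDiff_iff_contDiffAt]
  intro x
  by_cases hx : x ∈ tsupport ψ
  · exact (ha.contDiffAt (hΩ.mem_nhds (hs hx))).mul hψ.contDiffAt
  · have : (fun x => a x * ψ x) =ᶠ[𝓝 x] fun _ => 0 := by
      filter_upwards [(isClosed_tsupport ψ).isOpen_compl.mem_nhds hx] with y hy
      rw [image_eq_zero_of_notMem_tsupport hy, mul_zero]
    exact contDiffAt_const.congr_of_eventuallyEq this

theorem continuousOn_gradient {Ω : Set E3} (hΩ : IsOpen Ω) {a : E3 → ℝ}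
    (ha : ContDiffOn ℝ 1 a Ω) : ContinuousOn (gradient a) Ω :=
  (LinearIsometryEquiv.continuous _).comp_continuousOn
    (ha.continuousOn_fderiv_of_isOpen hΩ le_rfl)

/-- The product rule `∇ · (a u) = a ∇ · u + ∇a · u`. -/
theorem IsWeakDiv.mul {Ω : Set E3} (hΩ : IsOpen Ω) {u : E3 → C3} {d : E3 → ℂ}
    (h : IsWeakDiv Ω u d) {a : E3 → ℝ} (ha : ContDiffOn ℝ 1 a Ω) :
    IsWeakDiv Ω (fun x => (a x : ℂ) • u x)
      (fun x => (a x : ℂ) * d x + cdot (toC3 (gradient a x)) (u x)) := by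
  have hd : LocallyIntegrableOn (fun x => (a x : ℂ) * d x) Ω := by
    simpa using h.2.continuousOn_smul hΩ.isLocallyClosed ha.continuousOn
  have hg := locallyIntegrableOn_cdot hΩ h.1 (continuousOn_gradient hΩ ha)
  refine ⟨?_, hd.add hg, fun ψ hψ => ?_⟩
  · simpa [Complex.coe_smul] using h.1.continuousOn_smul hΩ.isLocallyClosed ha.continuousOn
  have hψ1 : ContDiff ℝ 1 ψ := hψ.smooth.of_le (by norm_cast)
  have hsub : tsupport (fun x => a x * ψ x) ⊆ tsupport ψ := tsupport_mul_subset_right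
  -- The product `a ψ` is only `C¹`; this is why the defining identity had to be extended beyond
  -- smooth test functions.
  have haψ := contDiff_mul_of_tsupport_subset hΩ ha hψ1 hψ.support_subset
  have key := h.eq_of_contDiff_one hΩ haψ
    (hψ.compactSupport.of_isClosed_subset (isClosed_tsupport _) hsub)
    (hsub.trans hψ.support_subset)
  have i1 : IntegrableOn (fun x => cdot (toC3 (gradient (fun x => a x * ψ x) x)) (u x)) Ω :=
    integrableOn_cdot_of_hasCompactSupport h.1 (continuous_gradient haψ) hψ.compactSupport
      hψ.support_subset ((tsupport_gradient_subset _).trans hsub)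
  have i2 := hψ.integrableOn_smul hg
  have i3 := hψ.integrableOn_smul hd
  have e1 : ∫ x in Ω, cdot (toC3 (gradient ψ x)) ((a x : ℂ) • u x) =
      ∫ x in Ω, (cdot (toC3 (gradient (fun x => a x * ψ x) x)) (u x) -
        ψ x • cdot (toC3 (gradient a x)) (u x)) := by
    refine setIntegral_congr_fun hΩ.measurableSet fun x hx => ?_
    have hax : DifferentiableAt ℝ a x :=
      (ha.contDiffAt (hΩ.mem_nhds hx)).differentiableAt one_ne_zero
    simp only [gradient_mul_eq hax (hψ1.differentiable one_ne_zero x), toC3_add, toC3_smul,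
      cdot_add_left, cdot_smul_left, cdot_smul_right, Complex.real_smul]
    ring
  have e2 : ∫ x in Ω, ψ x • ((a x : ℂ) * d x + cdot (toC3 (gradient a x)) (u x)) =
      (∫ x in Ω, (a x * ψ x) • d x) + ∫ x in Ω, ψ x • cdot (toC3 (gradient a x)) (u x) := by
    simp only [smul_add]
    rw [integral_add i3 i2]
    congr 2
    funext x
    simp only [Complex.real_smul, Complex.ofReal_mul]; ring
  rw [e1, e2, integral_sub i1 i2, key]
  ring

theorem cdot_single (v : C3) (k : ℂ) (i : Fin 3) :
    cdot v (k • EuclideanSpace.single i 1) = v i * k := by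
  simp [cdot]

theorem setIntegral_C3_apply {Ω : Set E3} {f : E3 → C3} (hf : IntegrableOn f Ω) (i : Fin 3) :
    (∫ x in Ω, f x) i = ∫ x in Ω, f x i :=
  ((EuclideanSpace.proj (𝕜 := ℂ) i).integral_comp_comm hf).symm

/-- A weak gradient is given by the weak divergences of the fields `φ eᵢ`. -/
theorem isWeakGrad_iff {Ω : Set E3} {φ : E3 → ℂ} {G : E3 → C3} :
    IsWeakGrad Ω φ G ↔ ∀ i : Fin 3,
      IsWeakDiv Ω (fun x => φ x • EuclideanSpace.single i (1 : ℂ)) (fun x => G x i) := by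
  constructor
  · intro h i
    refine ⟨?_, locInt_apply h.2 i, fun ψ hψ => ?_⟩
    · intro x hx
      obtain ⟨t, ht, hi⟩ := h.1 x hx
      exact ⟨t, ht, hi.smul_const _⟩
    · have := congrArg (fun v : C3 => v i) (h.eq ψ hψ)
      simp only [PiLp.neg_apply] at this
      rw [setIntegral_C3_apply (hψ.integrableOn_smul_toC3 h.1),
        setIntegral_C3_apply (hψ.integrableOn_smul h.2)] at this
      simpa [cdot_single, mul_comm] using this
  · intro h
    have h1 : LocallyIntegrableOn φ Ω := by
      simpa using locInt_apply (h 0).1 0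
    have h2 : LocallyIntegrableOn G Ω := by
      have e : G = fun x => ∑ i : Fin 3, G x i • EuclideanSpace.single i (1 : ℂ) := by
        funext x; ext j; simp [Pi.single_apply]
      rw [e]
      refine locallyIntegrableOn_sum_three fun i x hx => ?_
      obtain ⟨t, ht, hi⟩ := (h i).2 x hx
      exact ⟨t, ht, hi.smul_const _⟩
    refine ⟨h1, h2, fun ψ hψ => ?_⟩
    ext i
    rw [PiLp.neg_apply, setIntegral_C3_apply (hψ.integrableOn_smul_toC3 h1),
      setIntegral_C3_apply (hψ.integrableOn_smul h2)]
    have := (h i).eq ψ hψ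
    simpa [cdot_single, mul_comm] using this

/-- The product rule `∇(a φ) = a ∇φ + φ ∇a`. -/
theorem IsWeakGrad.mul {Ω : Set E3} (hΩ : IsOpen Ω) {φ : E3 → ℂ} {G : E3 → C3}
    (h : IsWeakGrad Ω φ G) {a : E3 → ℝ} (ha : ContDiffOn ℝ 1 a Ω) :
    IsWeakGrad Ω (fun x => (a x : ℂ) * φ x)
      (fun x => (a x : ℂ) • G x + φ x • toC3 (gradient a x)) := by
  rw [isWeakGrad_iff] at h ⊢
  intro i
  convert (h i).mul hΩ ha using 2 with x x
  · rw [smul_smul]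
  · simp [cdot_single, mul_comm]

/-- Test functions are real, so conjugation passes through the defining identity. -/
theorem IsWeakGrad.conj {Ω : Set E3} {φ : E3 → ℂ} {G : E3 → C3} (h : IsWeakGrad Ω φ G) :
    IsWeakGrad Ω (fun x => starRingEnd ℂ (φ x)) (fun x => conj3 (G x)) := by
  rw [isWeakGrad_iff] at h ⊢
  intro i
  have hl : ∀ {f : E3 → ℂ}, LocallyIntegrableOn f Ω →
      LocallyIntegrableOn (fun x => starRingEnd ℂ (f x)) Ω := by
    intro f hf x hx
    obtain ⟨t, ht, hi⟩ := hf x hx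
    exact ⟨t, ht, Complex.conjCLE.toContinuousLinearMap.integrable_comp hi⟩
  refine ⟨?_, hl (h i).2, fun ψ hψ => ?_⟩
  · have h0 : LocallyIntegrableOn φ Ω := by
      simpa using locInt_apply (h 0).1 0
    intro x hx
    obtain ⟨t, ht, hi⟩ := hl h0 x hx
    exact ⟨t, ht, hi.smul_const _⟩
  · have := congrArg (starRingEnd ℂ) ((h i).eq ψ hψ)
    rw [map_neg, ← integral_conj, ← integral_conj] at this
    simpa [cdot_single] using this

/-! ### Square integrable functions -/

theorem eLpNorm_two_sq {α F : Type*} [MeasurableSpace α] [NormedAddCommGroup F]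
    (m : Measure α) (f : α → F) :
    eLpNorm f 2 m ^ 2 = ∫⁻ x, ‖f x‖ₑ ^ 2 ∂m := by
  have := eLpNorm_nnreal_pow_eq_lintegral (μ := m) (f := f) (p := 2) two_ne_zero
  simpa using this

theorem enorm_integral_smul_le {α F : Type*} [MeasurableSpace α] [NormedAddCommGroup F]
    [NormedSpace ℝ F] {m : Measure α} {f : α → ℝ} {g : α → F} (hf : AEStronglyMeasurable f m)
    (hg : AEStronglyMeasurable g m) :
    ‖∫ x, f x • g x ∂m‖ₑ ≤ eLpNorm f 2 m * eLpNorm g 2 m := by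
  refine (enorm_integral_le_lintegral_enorm _).trans ?_
  rw [← eLpNorm_one_eq_lintegral_enorm]
  exact eLpNorm_smul_le_mul_eLpNorm hg hf

theorem enorm_integral_sq_le {α F : Type*} [MeasurableSpace α] [NormedAddCommGroup F]
    [NormedSpace ℝ F] {m : Measure α} {g : α → F} (hg : AEStronglyMeasurable g m) :
    ‖∫ x, g x ∂m‖ₑ ^ 2 ≤ m univ * ∫⁻ x, ‖g x‖ₑ ^ 2 ∂m := by
  have h := enorm_integral_smul_le (f := fun _ => (1 : ℝ)) aestronglyMeasurable_const hg
  simp only [one_smul] at h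
  calc _ ≤ (eLpNorm (fun _ => (1 : ℝ)) 2 m * eLpNorm g 2 m) ^ 2 := by gcongr
    _ = _ := by rw [mul_pow, eLpNorm_two_sq, eLpNorm_two_sq]; simp

/-- Test functions are dense in `L²`, in dual form. -/
theorem eLpNorm_le_of_forall_isTestFunction_real {U : Set E3} (hU : IsOpen U) {f : E3 → ℝ}
    (hf : MemLp f 2 (volume.restrict U)) {C : ℝ} (hC0 : 0 ≤ C)
    (h : ∀ ψ, IsTestFunction U ψ →
      |∫ x in U, ψ x * f x| ≤ C * (eLpNorm ψ 2 (volume.restrict U)).toReal) :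
    (eLpNorm f 2 (volume.restrict U)).toReal ≤ C := by
  let S : Submodule ℝ (Lp ℝ 2 (volume.restrict U)) :=
    { carrier := {g | ∃ ψ, IsTestFunction U ψ ∧ g =ᵐ[volume.restrict U] ψ}
      add_mem' := by
        rintro a b ⟨ψ, hψ, ha⟩ ⟨θ, hθ, hb⟩
        refine ⟨ψ + θ, ⟨hψ.1.add hθ.1, hψ.2.add hθ.2, (tsupport_add _ _).trans
          (union_subset hψ.3 hθ.3)⟩, (Lp.coeFn_add a b).trans (ha.add hb)⟩
      zero_mem' := ⟨0, ⟨contDiff_const, HasCompactSupport.zero, by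
        simp [tsupport]⟩, Lp.coeFn_zero _ _ _⟩
      smul_mem' := by
        rintro k a ⟨ψ, hψ, ha⟩
        refine ⟨k • ψ, ⟨hψ.1.const_smul k, hψ.2.smul_left (f := fun _ => k), ?_⟩,
          (Lp.coeFn_smul k a).trans (ha.const_smul k)⟩
        exact (closure_mono (Function.support_const_smul_subset k ψ)).trans hψ.3 }
  have hinner : ∀ g : Lp ℝ 2 (volume.restrict U), ∀ k : Lp ℝ 2 (volume.restrict U),
      ⟪g, k⟫_ℝ = ∫ x in U, g x * k x := fun g k => by
    rw [L2.inner_def]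
    simp [mul_comm]
  have memLp : ∀ {ψ}, IsTestFunction U ψ → MemLp ψ 2 (volume.restrict U) := fun hψ =>
    (hψ.smooth.continuous.memLp_of_hasCompactSupport hψ.compactSupport).restrict U
  -- An element orthogonal to every test function vanishes by the fundamental lemma of the calculus
  -- of variations, so test functions are dense.
  have hS : Sᗮ = ⊥ := by
    rw [Submodule.eq_bot_iff]
    intro g hg
    have hli : LocallyIntegrableOn (g : E3 → ℝ) U := by
      rw [locallyIntegrableOn_iff hU.isLocallyClosed]
      intro K hKU hK
      have := isFiniteMeasure_restrict.2 (hK.measure_lt_top (μ := volume)).ne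
      exact (((Lp.memLp g).mono_measure (Measure.restrict_mono hKU le_rfl)).integrable
        (by norm_num) : Integrable _ (volume.restrict K))
    have h1 := hU.ae_eq_zero_of_integral_contDiff_smul_eq_zero hli (fun ψ h1 h2 h3 => by
      have hψ : IsTestFunction U ψ := ⟨h1, h2, h3⟩
      have h4 := Submodule.inner_right_of_mem_orthogonal
        (show (memLp hψ).toLp ψ ∈ S from ⟨ψ, hψ, (memLp hψ).coeFn_toLp⟩) hg
      rw [hinner] at h4
      rw [← setIntegral_eq_integral_of_forall_compl_eq_zero (s := U), ← h4]
      · refine integral_congr_ae ?_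
        filter_upwards [(memLp hψ).coeFn_toLp] with x hx
        rw [hx, smul_eq_mul]
      · intro x hx
        rw [image_eq_zero_of_notMem_tsupport fun h => hx (h3 h), zero_smul])
    rw [Lp.eq_zero_iff_ae_eq_zero]
    exact (ae_restrict_iff' hU.measurableSet).2 h1
  have hdense : Dense (S : Set (Lp ℝ 2 (volume.restrict U))) := by
    rw [Submodule.dense_iff_topologicalClosure_eq_top, Submodule.topologicalClosure_eq_top_iff, hS]
  set F := hf.toLp f with hF
  have key : ∀ g : Lp ℝ 2 (volume.restrict U), |⟪g, F⟫_ℝ| ≤ C * ‖g‖ := by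
    intro g
    refine (isClosed_le (f := fun g : Lp ℝ 2 (volume.restrict U) => |⟪g, F⟫_ℝ|)
      (g := fun g => C * ‖g‖) (by fun_prop) (by fun_prop)).closure_subset_iff.2 ?_ (hdense g)
    rintro g ⟨ψ, hψ, hg⟩
    have e1 : ⟪g, F⟫_ℝ = ∫ x in U, ψ x * f x := by
      rw [hinner]
      refine integral_congr_ae ?_
      filter_upwards [hg, hf.coeFn_toLp] with x h1 h2
      rw [h1, h2]
    simp only [mem_ofPred_eq]
    rw [e1, Lp.norm_def, eLpNorm_congr_ae hg]
    exact h ψ hψ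
  -- Testing with `F` itself gives `‖F‖² ≤ C ‖F‖`.
  have h1 := key F
  rw [real_inner_self_eq_norm_sq, abs_of_nonneg (by positivity)] at h1
  have h2 : ‖F‖ = (eLpNorm f 2 (volume.restrict U)).toReal := by
    rw [Lp.norm_def, eLpNorm_congr_ae hf.coeFn_toLp]
  rw [← h2]
  have hC : 0 ≤ ‖F‖ := norm_nonneg F
  rcases hC.eq_or_lt with h0 | h0
  · rwa [← h0]
  · nlinarith

/-- Real test functions see the real and imaginary parts separately; adding the two estimates
produces the factor 2. -/
theorem eLpNorm_le_of_forall_isTestFunction {U : Set E3} (hU : IsOpen U) {f : E3 → ℂ}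
    (hf : MemLp f 2 (volume.restrict U)) {C : ℝ} (hC0 : 0 ≤ C)
    (h : ∀ ψ, IsTestFunction U ψ →
      ‖∫ x in U, ψ x • f x‖ ≤ C * (eLpNorm ψ 2 (volume.restrict U)).toReal) :
    eLpNorm f 2 (volume.restrict U) ≤ ENNReal.ofReal (2 * C) := by
  have hi : ∀ ψ, IsTestFunction U ψ → IntegrableOn (fun x => ψ x • f x) U := fun ψ hψ =>
    memLp_one_iff_integrable.1 (hf.smul
      ((hψ.smooth.continuous.memLp_of_hasCompactSupport hψ.compactSupport (p := 2)).restrict U))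
  have hre := eLpNorm_le_of_forall_isTestFunction_real hU hf.re hC0 fun ψ hψ => by
    refine le_trans ?_ (h ψ hψ)
    have : ∫ x in U, ψ x * RCLike.re (f x) = RCLike.re (∫ x in U, ψ x • f x) := by
      rw [← integral_re (hi ψ hψ)]
      simp
    rw [this]
    exact Complex.abs_re_le_norm _
  have him := eLpNorm_le_of_forall_isTestFunction_real hU hf.im hC0 fun ψ hψ => by
    refine le_trans ?_ (h ψ hψ)
    have : ∫ x in U, ψ x * RCLike.im (f x) = RCLike.im (∫ x in U, ψ x • f x) := by
      rw [← integral_im (hi ψ hψ)]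
      simp
    rw [this]
    exact Complex.abs_im_le_norm _
  have e : eLpNorm f 2 (volume.restrict U) ≤
      eLpNorm (fun x => RCLike.re (f x)) 2 (volume.restrict U) +
        eLpNorm (fun x => RCLike.im (f x)) 2 (volume.restrict U) := by
    refine le_trans (eLpNorm_mono_real (g := fun x => ‖RCLike.re (f x)‖ + ‖RCLike.im (f x)‖)
      fun x => ?_) ((eLpNorm_add_le hf.re.1.norm hf.im.1.norm (by norm_num)).trans_eq ?_)
    · exact Complex.norm_le_abs_re_add_abs_im _
    · rw [eLpNorm_norm, eLpNorm_norm]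
  refine e.trans ?_
  rw [two_mul, ENNReal.ofReal_add hC0 hC0]
  exact add_le_add ((ENNReal.le_ofReal_iff_toReal_le hf.re.2.ne hC0).2 hre)
    ((ENNReal.le_ofReal_iff_toReal_le hf.im.2.ne hC0).2 him)

/-! ### Differences of Sobolev functions -/

theorem IsTestFunction.comp_sub {Ω : Set E3} {ψ : E3 → ℝ} (hψ : IsTestFunction univ ψ) {z : E3}
    (hz : ∀ y ∈ tsupport ψ, y + z ∈ Ω) : IsTestFunction Ω fun x => ψ (x - z) := by
  have hs : tsupport (fun x => ψ (x - z)) ⊆ (fun x => x - z) ⁻¹' tsupport ψ :=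
    tsupport_comp_subset_preimage ψ (by fun_prop)
  refine ⟨hψ.smooth.comp (by fun_prop), ?_, fun x hx => ?_⟩
  · exact hψ.compactSupport.comp_homeomorph (Homeomorph.subRight z)
  · simpa using hz _ (hs hx)

theorem IsWeakGrad.integral_directional {Ω : Set E3} {φ : E3 → ℂ} {G : E3 → C3}
    (h : IsWeakGrad Ω φ G) {ψ : E3 → ℝ} (hψ : IsTestFunction Ω ψ) (z : E3) :
    ∫ x in Ω, fderiv ℝ ψ x z • φ x = -∫ x in Ω, ψ x • ⟪toC3 z, G x⟫_ℂ := by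
  have h1 := congrArg (fun v => ⟪toC3 z, v⟫_ℂ) (h.eq ψ hψ)
  simp only [inner_neg_right] at h1
  rw [← integral_inner (hψ.integrableOn_smul_toC3 h.1),
    ← integral_inner (hψ.integrableOn_smul h.2)] at h1
  have e : ∀ x, ⟪toC3 z, φ x • toC3 (gradient ψ x)⟫_ℂ = fderiv ℝ ψ x z • φ x := by
    intro x
    have hf : fderiv ℝ ψ x z = ∑ i, z i * gradient ψ x i := by
      rw [← inner_gradient]
      simp only [PiLp.inner_apply, RCLike.inner_apply, conj_trivial]
    rw [inner_smul_right, hf, Complex.real_smul, mul_comm]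
    congr 1
    simp [PiLp.inner_apply, mul_comm]
  simpa only [e, inner_smul_right_eq_smul] using h1

/-- Pairing the difference `φ(· + z) - φ` with a test function. -/
theorem norm_integral_difference_le {Ω : Set E3} {φ : E3 → ℂ} {G : E3 → C3}
    (h : IsWeakGrad Ω φ G) (hφ : IntegrableOn φ Ω) (hG : MemLp G 2 (volume.restrict Ω))
    {ψ : E3 → ℝ} (hψ : IsTestFunction univ ψ) {z : E3}
    (hz : ∀ y ∈ tsupport ψ, ∀ s ∈ Icc (0 : ℝ) 1, y + s • z ∈ Ω) :
    ‖(∫ x in Ω, ψ (x - z) • φ x) - ∫ x in Ω, ψ x • φ x‖ ≤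
      ‖z‖ * (eLpNorm G 2 (volume.restrict Ω)).toReal * (eLpNorm ψ 2 volume).toReal := by
  have hfd : Continuous (fderiv ℝ ψ) := hψ.smooth.continuous_fderiv (by simp)
  obtain ⟨C, hC⟩ := hfd.bounded_above_of_compact_support (hψ.compactSupport.fderiv ℝ)
  -- The translation is placed on the smooth function `ψ`, so `s ↦ ∫ ψ(x - s z) φ(x)` can be
  -- differentiated under the integral although `φ` is only integrable.
  have hderiv : ∀ s : ℝ, HasDerivAt (fun s : ℝ => ∫ x in Ω, ψ (x - s • z) • φ x)
      (∫ x in Ω, (-(fderiv ℝ ψ (x - s • z) z)) • φ x) s := by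
    intro s
    have hline : ∀ x : E3, ∀ s : ℝ, HasDerivAt (fun s : ℝ => ψ (x - s • z))
        (-(fderiv ℝ ψ (x - s • z) z)) s := by
      intro x s
      have h1 : HasDerivAt (fun s : ℝ => x - s • z) (-z) s := by
        simpa using ((hasDerivAt_id s).smul_const z).const_sub x
      have h2 := (hψ.smooth.differentiable (by simp) (x - s • z)).hasFDerivAt
      simpa [Function.comp_def] using! h2.comp_hasDerivAt s h1
    refine (hasDerivAt_integral_of_dominated_loc_of_deriv_le (s := univ)
      (F := fun (s : ℝ) x => ψ (x - s • z) • φ x)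
      (F' := fun (s : ℝ) x => (-(fderiv ℝ ψ (x - s • z) z)) • φ x)
      (bound := fun x => C * ‖z‖ * ‖φ x‖) Filter.univ_mem ?_ ?_ ?_ ?_ ?_ ?_).2
    · refine Filter.Eventually.of_forall fun s => AEStronglyMeasurable.fun_smul ?_ hφ.1
      exact (hψ.smooth.continuous.comp (by fun_prop)).aestronglyMeasurable
    · obtain ⟨C', hC'⟩ := hψ.smooth.continuous.bounded_above_of_compact_support hψ.compactSupport
      refine hφ.bdd_smul C' ?_ (ae_of_all _ fun x => hC' _)
      exact (hψ.smooth.continuous.comp (by fun_prop)).aestronglyMeasurable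
    · refine AEStronglyMeasurable.fun_smul ?_ hφ.1
      refine Continuous.aestronglyMeasurable ?_
      exact ((hfd.comp (by fun_prop)).clm_apply continuous_const).neg
    · refine ae_of_all _ fun x s _ => ?_
      rw [norm_smul, norm_neg]
      gcongr
      exact (ContinuousLinearMap.le_opNorm _ _).trans
        (mul_le_mul_of_nonneg_right (hC _) (norm_nonneg _))
    · exact hφ.norm.const_mul _
    · exact ae_of_all _ fun x s _ => (hline x s).smul_const _
  -- The translate `ψ(· - s z)` is still a test function on `Ω`, so the derivative equals `∫ ψ(x - s
  -- z) ⟪z, G x⟫`, and Cauchy-Schwarz bounds it. The mean value inequality on `[0, 1]` then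
  -- concludes.
  have hbound : ∀ s ∈ Ico (0 : ℝ) 1, ‖∫ x in Ω, (-(fderiv ℝ ψ (x - s • z) z)) • φ x‖ ≤
      ‖z‖ * (eLpNorm G 2 (volume.restrict Ω)).toReal * (eLpNorm ψ 2 volume).toReal := by
    intro s hs
    have hθ : IsTestFunction Ω fun x => ψ (x - s • z) :=
      hψ.comp_sub fun y hy => hz y hy s ⟨hs.1, hs.2.le⟩
    have e1 := h.integral_directional hθ z
    simp only [fderiv_comp_sub] at e1
    simp only [neg_smul, integral_neg, e1, neg_neg]
    have hGm : AEStronglyMeasurable (fun x => ⟪toC3 z, G x⟫_ℂ) (volume.restrict Ω) :=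
      hG.1.const_inner
    have e2 := enorm_integral_smul_le (hθ.smooth.continuous.aestronglyMeasurable
      (μ := volume.restrict Ω)) hGm
    have e3 : eLpNorm (fun x => ψ (x - s • z)) 2 (volume.restrict Ω) ≤ eLpNorm ψ 2 volume := by
      refine (eLpNorm_mono_measure _ Measure.restrict_le_self).trans_eq ?_
      exact eLpNorm_comp_measurePreserving hψ.smooth.continuous.aestronglyMeasurable
        (measurePreserving_sub_right volume (s • z))
    have e4 : eLpNorm (fun x => ⟪toC3 z, G x⟫_ℂ) 2 (volume.restrict Ω) ≤
        ENNReal.ofReal ‖z‖ * eLpNorm G 2 (volume.restrict Ω) := by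
      refine eLpNorm_le_mul_eLpNorm_of_ae_le_mul (ae_of_all _ fun x => ?_) 2
      rw [← norm_toC3]
      exact norm_inner_le_norm _ _
    have e5 : eLpNorm ψ 2 volume ≠ ⊤ :=
      (hψ.smooth.continuous.memLp_of_hasCompactSupport hψ.compactSupport).2.ne
    have e6 := e2.trans (mul_le_mul' e3 e4)
    have e7 := ENNReal.toReal_mono
      (ENNReal.mul_ne_top e5 (ENNReal.mul_ne_top ENNReal.ofReal_ne_top hG.2.ne)) e6
    rw [toReal_enorm, ENNReal.toReal_mul, ENNReal.toReal_mul,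
      ENNReal.toReal_ofReal (norm_nonneg _), mul_comm] at e7
    exact e7
  have := norm_image_sub_le_of_norm_deriv_le_segment_01'
    (fun s _ => (hderiv s).hasDerivWithinAt) hbound
  simpa using this

/-- The difference `φ(· + z) - φ` of a Sobolev function, extended by zero, is of size `z`
wherever the segments `[y, y + z]` lie in the domain. -/
theorem eLpNorm_difference_le {Ω U : Set E3} (hΩ : IsOpen Ω) (hU : IsOpen U)
    {φ : E3 → ℂ} {G : E3 → C3} (h : IsWeakGrad Ω φ G) (hφ1 : IntegrableOn φ Ω)
    (hφ : MemLp φ 2 (volume.restrict Ω)) (hG : MemLp G 2 (volume.restrict Ω)) {z : E3}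
    (hz : ∀ y ∈ U, ∀ s ∈ Icc (0 : ℝ) 1, y + s • z ∈ Ω) :
    eLpNorm (fun y => Ω.indicator φ (y + z) - Ω.indicator φ y) 2 (volume.restrict U) ≤
      ENNReal.ofReal (2 * (‖z‖ * (eLpNorm G 2 (volume.restrict Ω)).toReal)) := by
  have hind : MemLp (Ω.indicator φ) 2 volume := (memLp_indicator_iff_restrict hΩ.measurableSet).2 hφ
  have hind1 : Integrable (Ω.indicator φ) volume :=
    (integrable_indicator_iff hΩ.measurableSet).2 hφ1
  have hsh : MemLp (fun y => Ω.indicator φ (y + z)) 2 volume :=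
    hind.comp_measurePreserving (measurePreserving_add_right volume z)
  have hsh1 : Integrable (fun y => Ω.indicator φ (y + z)) volume :=
    hind1.comp_add_right z
  -- By duality it suffices to pair with test functions on `U`; a change of variables moves the
  -- translation from `φ` to `ψ`.
  refine eLpNorm_le_of_forall_isTestFunction hU ((hsh.sub hind).restrict U) (by positivity)
    fun ψ hψ => ?_
  have hψu : IsTestFunction univ ψ := ⟨hψ.1, hψ.2, subset_univ _⟩
  have hψ0 : ∀ x ∉ U, ψ x = 0 := fun x hx =>
    image_eq_zero_of_notMem_tsupport fun hx' => hx (hψ.3 hx')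
  obtain ⟨C, hC⟩ := hψ.smooth.continuous.bounded_above_of_compact_support hψ.compactSupport
  have key := norm_integral_difference_le h hφ1 hG hψu (z := z) fun y hy => hz y (hψ.3 hy)
  have e0 : eLpNorm ψ 2 (volume.restrict U) = eLpNorm ψ 2 volume := by
    rw [← eLpNorm_indicator_eq_eLpNorm_restrict hU.measurableSet]
    congr 1
    exact indicator_eq_self.2 fun x hx => by_contra fun hxU => hx (hψ0 x hxU)
  rw [e0]
  convert key using 2
  have e1 : ∫ x in U, ψ x • (Ω.indicator φ (x + z) - Ω.indicator φ x) =
      ∫ x, ψ x • (Ω.indicator φ (x + z) - Ω.indicator φ x) :=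
    setIntegral_eq_integral_of_forall_compl_eq_zero fun x hx => by rw [hψ0 x hx, zero_smul]
  have e2 : ∀ θ : E3 → ℝ, ∫ x in Ω, θ x • φ x = ∫ x, θ x • Ω.indicator φ x := by
    intro θ
    rw [← integral_indicator hΩ.measurableSet]
    congr 1
    funext x
    rw [indicator_smul]
  have e3 : ∫ x, ψ (x - z) • Ω.indicator φ x = ∫ x, ψ x • Ω.indicator φ (x + z) := by
    rw [← integral_add_right_eq_self _ z]
    simp
  refine e1.trans ?_
  rw [e2, e2, e3, ← integral_sub]
  · simp only [smul_sub]
  · exact hsh1.bdd_smul C hψ.smooth.continuous.aestronglyMeasurable (ae_of_all _ hC)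
  · exact hind1.bdd_smul C hψ.smooth.continuous.aestronglyMeasurable (ae_of_all _ hC)

/-! ### The cone condition -/

/-- The uniform interior cone condition near a boundary point. -/
theorem IsLocalDefiningFunction.exists_cone {M : Set E3} {x : E3} {U : Set E3} {r : E3 → ℝ}
    (h : IsLocalDefiningFunction M x U r) :
    ∃ δ > 0, ∃ v : E3, ∃ ε > 0, ∀ y ∈ M ∩ Metric.ball x δ, ∀ s ∈ Icc (0 : ℝ) 1,
      ∀ z ∈ Metric.ball v ε, y + s • z ∈ M := by
  have hstrict : HasStrictFDerivAt r (fderiv ℝ r x) x :=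
    (h.smooth.contDiffAt (h.isOpen.mem_nhds h.mem)).hasStrictFDerivAt (by simp)
  set N := gradient r x with hN
  have hN0 : 0 < ‖N‖ := norm_pos_iff.2 h.gradient_ne_zero
  have hev := hstrict.isLittleO.def (c := ‖N‖ / 4) (by positivity)
  obtain ⟨δ₀, hδ₀, hball⟩ := Metric.eventually_nhds_iff_ball.1
    (hev.and ((h.isOpen.prod h.isOpen).mem_nhds ⟨h.mem, h.mem⟩))
  set l := δ₀ / (4 * ‖N‖) with hl
  have hl0 : 0 < l := by positivity
  have hlN : l * ‖N‖ = δ₀ / 4 := by rw [hl]; field_simp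
  -- The cone points along `-∇r`. For `z` in the ball, `⟪N, z⟫ ≤ -(3/4) l ‖N‖²`, while the
  -- linearization error is at most `‖N‖/4 · ‖s z‖ ≤ (5/16) s l ‖N‖²`, so `r` does not increase
  -- along the segment. The choice `l ‖N‖ = δ₀ / 4` keeps the segment inside the ball of radius
  -- `δ₀`.
  refine ⟨δ₀ / 2, by positivity, -(l • N), l * ‖N‖ / 4, by positivity, ?_⟩
  rintro y ⟨hyM, hy⟩ s ⟨hs0, hs1⟩ z hz
  have hzn : ‖z + l • N‖ < l * ‖N‖ / 4 := by
    simpa [dist_eq_norm] using hz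
  have hz1 : ‖z‖ ≤ 5 / 4 * (l * ‖N‖) := by
    have : z = (z + l • N) - l • N := by abel
    rw [this]
    refine (norm_sub_le _ _).trans ?_
    rw [norm_smul, Real.norm_of_nonneg hl0.le]
    linarith
  have hsz : ‖s • z‖ ≤ s * (5 / 4 * (l * ‖N‖)) := by
    rw [norm_smul, Real.norm_of_nonneg hs0]
    exact mul_le_mul_of_nonneg_left hz1 hs0
  have hyx : dist y x < δ₀ / 2 := hy
  have hyz : dist (y + s • z) x < δ₀ := by
    calc dist (y + s • z) x ≤ dist (y + s • z) y + dist y x := dist_triangle _ _ _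
      _ < δ₀ := by
        rw [dist_eq_norm, add_sub_cancel_left]
        have : s * (5 / 4 * (l * ‖N‖)) ≤ 1 * (5 / 4 * (l * ‖N‖)) :=
          mul_le_mul_of_nonneg_right hs1 (by positivity)
        linarith
  obtain ⟨h1, h2⟩ := hball (y + s • z, y) (by
    rw [Metric.mem_ball, Prod.dist_eq]
    exact max_lt hyz (hyx.trans (by linarith)))
  have hy0 : r y ≤ 0 := (h.mem_iff y h2.2).1 hyM
  refine (h.mem_iff _ h2.1).2 ?_
  simp only [add_sub_cancel_left] at h1
  rw [← inner_gradient, ← hN, inner_smul_right] at h1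
  have hin : ⟪N, z⟫_ℝ ≤ -(3 / 4 * (l * ‖N‖ ^ 2)) := by
    have e : ⟪N, z⟫_ℝ = ⟪N, z + l • N⟫_ℝ - l * ‖N‖ ^ 2 := by
      rw [inner_add_right, inner_smul_right, real_inner_self_eq_norm_sq]; ring
    have := real_inner_le_norm N (z + l • N)
    nlinarith
  have h3 := (le_abs_self _).trans h1
  have h4 : s * ⟪N, z⟫_ℝ ≤ s * -(3 / 4 * (l * ‖N‖ ^ 2)) := mul_le_mul_of_nonneg_left hin hs0
  have h5 : ‖N‖ / 4 * ‖s • z‖ ≤ ‖N‖ / 4 * (s * (5 / 4 * (l * ‖N‖))) :=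
    mul_le_mul_of_nonneg_left hsz (by positivity)
  have h6 : 0 ≤ s * (l * ‖N‖ ^ 2) := by positivity
  nlinarith

theorem exists_cone {M : Set E3} (hM : IsClosed M) (hs : HasSmoothBoundary M) {x : E3}
    (hx : x ∈ M) :
    ∃ δ > 0, ∃ v : E3, ∃ ε > 0, ∀ y ∈ interior M ∩ Metric.ball x δ, ∀ s ∈ Icc (0 : ℝ) 1,
      ∀ z ∈ Metric.ball v ε, y + s • z ∈ interior M := by
  by_cases hxi : x ∈ interior M
  · obtain ⟨δ, hδ, hsub⟩ := Metric.isOpen_iff.1 isOpen_interior x hxi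
    refine ⟨δ / 2, by positivity, 0, δ / 2, by positivity, ?_⟩
    rintro y ⟨-, hy⟩ s ⟨hs0, hs1⟩ z hz
    refine hsub ?_
    rw [mem_ball_zero_iff] at hz
    calc dist (y + s • z) x ≤ dist (y + s • z) y + dist y x := dist_triangle _ _ _
      _ < δ / 2 + δ / 2 := by
        refine add_lt_add_of_le_of_lt ?_ hy
        rw [dist_eq_norm, add_sub_cancel_left, norm_smul, Real.norm_of_nonneg hs0]
        nlinarith [norm_nonneg z]
      _ = δ := by ring
  · obtain ⟨U, r, hr⟩ := hs x (by rw [hM.frontier_eq]; exact ⟨hx, hxi⟩)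
    obtain ⟨δ, hδ, v, ε, hε, h⟩ := hr.exists_cone
    refine ⟨δ, hδ, v, ε, hε, fun y hy s hs z hz => ?_⟩
    -- A translate of an open set is open, so containment in `M` improves to containment in the
    -- interior.
    have hopen : IsOpen ((fun y => y + s • z) '' (interior M ∩ Metric.ball x δ)) :=
      (Homeomorph.addRight (s • z)).isOpenMap _ (isOpen_interior.inter Metric.isOpen_ball)
    refine interior_maximal ?_ hopen ⟨y, hy, rfl⟩
    rintro _ ⟨y', hy', rfl⟩
    exact h y' ⟨interior_subset hy'.1, hy'.2⟩ s hs z hz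

/-- Shrinking the cone towards its vertex makes the translations as short as desired while they
still fill a ball, over which one can average. -/
theorem exists_small_cone {U Ω : Set E3} {v : E3} {ε : ℝ} (hε : 0 < ε)
    (h : ∀ y ∈ U, ∀ s ∈ Icc (0 : ℝ) 1, ∀ z ∈ Metric.ball v ε, y + s • z ∈ Ω) {κ : ℝ}
    (hκ : 0 < κ) :
    ∃ w : E3, ∃ η > 0, ∀ z ∈ Metric.ball w η, ‖z‖ ≤ κ ∧
      ∀ y ∈ U, ∀ s ∈ Icc (0 : ℝ) 1, y + s • z ∈ Ω := by
  set A := ‖v‖ + ε with hA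
  have hA0 : 0 < A := by positivity
  set t := min 1 (κ / A) with ht
  have ht0 : 0 < t := by positivity
  refine ⟨t • v, t * ε, by positivity, fun z hz => ?_⟩
  have hz' : ‖t⁻¹ • z - v‖ < ε := by
    have e : t⁻¹ • z - v = t⁻¹ • (z - t • v) := by
      rw [smul_sub, smul_smul, inv_mul_cancel₀ ht0.ne', one_smul]
    rw [Metric.mem_ball, dist_eq_norm] at hz
    rw [e, norm_smul, norm_inv, Real.norm_of_nonneg ht0.le, inv_mul_lt_iff₀ ht0]
    exact hz
  have hzt : z = t • (t⁻¹ • z) := by rw [smul_smul, mul_inv_cancel₀ ht0.ne', one_smul]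
  refine ⟨?_, fun y hy s hs => ?_⟩
  · have h1 : ‖t⁻¹ • z‖ ≤ A := by
      have := norm_add_le (t⁻¹ • z - v) v
      rw [sub_add_cancel] at this
      linarith
    rw [hzt, norm_smul, Real.norm_of_nonneg ht0.le]
    calc t * ‖t⁻¹ • z‖ ≤ κ / A * A :=
          mul_le_mul (min_le_right _ _) h1 (norm_nonneg _) (by positivity)
      _ = κ := by field_simp
  · rw [hzt, smul_smul]
    refine h y hy _ ⟨mul_nonneg hs.1 ht0.le, ?_⟩ _ (by simpa [dist_eq_norm] using hz')
    exact mul_le_one₀ hs.2 ht0.le (min_le_left _ _)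

/-! ### Approximation by local averages -/

/-- Cauchy-Schwarz for the normalized restriction of Lebesgue measure to `S`. -/
theorem enorm_sub_setAverage_sq_le {f : E3 → ℂ} (hf : Integrable f) (a : ℂ) {S : Set E3}
    (h0 : volume S ≠ 0) (h1 : volume S ≠ ⊤) :
    ‖a - ⨍ x in S, f x‖ₑ ^ 2 ≤ (volume S)⁻¹ * ∫⁻ x in S, ‖a - f x‖ₑ ^ 2 := by
  rw [setAverage_eq']
  set m : Measure E3 := (volume S)⁻¹ • volume.restrict S with hm
  have hprob : IsProbabilityMeasure m := ⟨by
    rw [hm, Measure.smul_apply, Measure.restrict_apply_univ, smul_eq_mul,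
      ENNReal.inv_mul_cancel h0 h1]⟩
  have hfm : Integrable f m := hf.integrableOn.smul_measure (by simpa using h0)
  have e : a - ∫ x, f x ∂m = ∫ x, (a - f x) ∂m := by
    rw [integral_sub (integrable_const a) hfm]; simp
  rw [e]
  refine (enorm_integral_sq_le ((integrable_const a).sub hfm).1).trans_eq ?_
  rw [measure_univ, one_mul, hm, lintegral_smul_measure, smul_eq_mul]
  rfl

/-- The ball around `π y + w` lies in the ball of radius `η` around `y + w`, so the error at `y` is
dominated by an integral of `|f(y + z) - f(y)|²` over `z` near `w`. Tonelli's theorem then reduces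
to the bound for each fixed `z`. Rounding `y` to `π y` leaves only finitely many averages. -/
theorem lintegral_sub_average_le {f : E3 → ℂ} (hfm : StronglyMeasurable f) (hf : Integrable f)
    {U : Set E3} (hU : MeasurableSet U) {w : E3} {η : ℝ} (hη : 0 < η) {π : E3 → E3}
    (hπ : ∀ y ∈ U, dist (π y) y < η / 2) {K : ENNReal}
    (hK : ∀ z ∈ Metric.ball w η, ∫⁻ y in U, ‖f (y + z) - f y‖ₑ ^ 2 ≤ K) :
    ∫⁻ y in U, ‖f y - ⨍ x in Metric.ball (π y + w) (η / 2), f x‖ₑ ^ 2 ≤ 8 * K := by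
  set V := volume (Metric.ball (0 : E3) (η / 2)) with hV
  have hV0 : V ≠ 0 := (Metric.measure_ball_pos _ _ (by positivity)).ne'
  have hV1 : V ≠ ⊤ := measure_ball_lt_top.ne
  have hVx : ∀ x, volume (Metric.ball x (η / 2)) = V := fun x =>
    Measure.addHaar_ball_center volume x _
  have hmeas : Measurable (Function.uncurry fun (y z : E3) => ‖f (y + z) - f y‖ₑ ^ 2) := by
    refine Measurable.pow_const (Measurable.enorm ?_) 2
    exact (hfm.measurable.comp (measurable_fst.add measurable_snd)).sub
      (hfm.measurable.comp measurable_fst)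
  have hpt : ∀ y ∈ U, ‖f y - ⨍ x in Metric.ball (π y + w) (η / 2), f x‖ₑ ^ 2 ≤
      V⁻¹ * ∫⁻ z in Metric.ball w η, ‖f (y + z) - f y‖ₑ ^ 2 := by
    intro y hy
    refine (enorm_sub_setAverage_sq_le hf _ (by rwa [hVx]) (by rwa [hVx])).trans ?_
    rw [hVx]
    refine mul_le_mul_right ?_ _
    have hsub : Metric.ball (π y + w) (η / 2) ⊆ Metric.ball (y + w) η := by
      refine Metric.ball_subset_ball' ?_
      rw [dist_add_right]
      have := hπ y hy
      linarith
    refine (lintegral_mono_set hsub).trans_eq ?_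
    have hmp := measurePreserving_add_left (volume : Measure E3) y
    have hpre : (fun z => y + z) ⁻¹' Metric.ball (y + w) η = Metric.ball w η := by
      ext z; simp
    rw [← hpre, hmp.setLIntegral_comp_preimage_emb (measurableEmbedding_addLeft y)
      (fun x => ‖f x - f y‖ₑ ^ 2)]
    refine lintegral_congr fun x => ?_
    rw [← enorm_neg, neg_sub]
  calc _ ≤ ∫⁻ y in U, V⁻¹ * ∫⁻ z in Metric.ball w η, ‖f (y + z) - f y‖ₑ ^ 2 :=
        setLIntegral_mono' hU hpt
    _ = V⁻¹ * ∫⁻ y in U, ∫⁻ z in Metric.ball w η, ‖f (y + z) - f y‖ₑ ^ 2 :=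
        lintegral_const_mul' _ _ (ENNReal.inv_ne_top.2 hV0)
    _ = V⁻¹ * ∫⁻ z in Metric.ball w η, ∫⁻ y in U, ‖f (y + z) - f y‖ₑ ^ 2 := by
        rw [lintegral_lintegral_swap hmeas.aemeasurable]
    _ ≤ V⁻¹ * ∫⁻ z in Metric.ball w η, K := by
        exact mul_le_mul_right (setLIntegral_mono' measurableSet_ball hK) _
    _ = 8 * K := by
        rw [setLIntegral_const, Measure.addHaar_ball_center]
        -- Doubling the radius multiplies the volume by `2³` in dimension three.
        have : volume (Metric.ball (0 : E3) η) = 8 * V := by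
          rw [hV, Measure.addHaar_ball_of_pos _ _ hη, Measure.addHaar_ball_of_pos _ _ (half_pos hη),
            ← mul_assoc]
          congr 1
          rw [show (8 : ENNReal) = ENNReal.ofReal 8 by norm_num, ← ENNReal.ofReal_mul (by norm_num)]
          congr 1
          simp
          ring
        rw [this, mul_comm K, ← mul_assoc, mul_left_comm, ENNReal.inv_mul_cancel hV0 hV1, mul_one]

/-! ### The Rellich compactness theorem -/

theorem exists_simpleFunc_dist_lt {U : Set E3} (hU : TotallyBounded U) {r : ℝ} (hr : 0 < r) :
    ∃ π : SimpleFunc E3 E3, ∀ y ∈ U, dist (π y) y < r := by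
  obtain ⟨t, -, htf, hcov⟩ := Metric.finite_approx_of_totallyBounded hU r hr
  set l := htf.toFinset.toList with hl
  -- `nearestPt` also considers the index `l.length`, where the list takes its default value `0`.
  -- This extra candidate is harmless, since the nearest point can only get closer.
  refine ⟨SimpleFunc.nearestPt (fun n => l.getD n 0) l.length, fun y hy => ?_⟩
  obtain ⟨p, hp, hyp⟩ := mem_iUnion₂.1 (hcov hy)
  have hpl : p ∈ l := by simpa [hl] using hp
  obtain ⟨k, hk, rfl⟩ := List.mem_iff_getElem.1 hpl
  have h := SimpleFunc.edist_nearestPt_le (fun n => l.getD n 0) y hk.le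
  rw [edist_dist, edist_dist, ENNReal.ofReal_le_ofReal_iff dist_nonneg] at h
  refine h.trans_lt ?_
  rw [List.getD_eq_getElem _ _ hk, dist_comm]
  exact hyp

/-- `H¹(M)` embeds in `L²(M)`. -/
noncomputable def H1.toL2 (M : Set E3) : H1 M →L[ℂ] Lp ℂ 2 (volume.restrict (interior M)) :=
  (WithLp.fstL 2 ℂ _ _).comp (H1 M).subtypeL

theorem H1.norm_sq {M : Set E3} (φ : H1 M) : ‖φ‖ ^ 2 = ‖φ.1.fst‖ ^ 2 + ‖φ.1.snd‖ ^ 2 :=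
  WithLp.prod_norm_sq_eq_of_L2 φ.1

theorem H1.norm_snd_le {M : Set E3} (φ : H1 M) : ‖φ.1.snd‖ ≤ ‖φ‖ :=
  WithLp.norm_snd_le (p := 2) _ φ.1

/-- The restriction of functions in `H¹(M)` to a part of `M`. -/
noncomputable def H1.restrict (M U : Set E3) :
    H1 M →L[ℂ] Lp ℂ 2 ((volume.restrict (interior M)).restrict U) :=
  (LpToLpRestrictCLM E3 ℂ ℂ _ 2 U).comp (H1.toL2 M)

/-- The average over a ball. -/
noncomputable def ballAverage (M : Set E3) (x : E3) (r : ℝ) :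
    Lp ℂ 2 (volume.restrict (interior M)) →L[ℂ] ℂ :=
  (((volume.real (Metric.ball x r))⁻¹ : ℝ) : ℂ) • innerSL ℂ
    (indicatorConstLp 2 (measurableSet_ball (x := x) (ε := r))
      ((Measure.restrict_apply_le _ _).trans_lt measure_ball_lt_top).ne (1 : ℂ))

theorem ballAverage_apply (M : Set E3) (x : E3) (r : ℝ)
    (φ : Lp ℂ 2 (volume.restrict (interior M))) :
    ballAverage M x r φ = ⨍ y in Metric.ball x r, (interior M).indicator φ y := by
  rw [setAverage_eq]
  change (((volume.real (Metric.ball x r))⁻¹ : ℝ) : ℂ) * ⟪indicatorConstLp 2 _ _ (1 : ℂ), φ⟫_ℂ = _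
  rw [L2.inner_indicatorConstLp_one, setIntegral_indicator isOpen_interior.measurableSet,
    Measure.restrict_restrict measurableSet_ball, Complex.real_smul]

/-- A Sobolev function is close in `L²` to the step functions given by averages over small
balls. -/
theorem IsWeakGrad.eLpNorm_le {Ω U : Set E3} (hΩ : IsOpen Ω) (hU : IsOpen U) (hUΩ : U ⊆ Ω)
    (hΩt : TotallyBounded Ω) (hΩfin : volume Ω ≠ ⊤) {v : E3} {ε : ℝ} (hε : 0 < ε)
    (hcone : ∀ y ∈ U, ∀ s ∈ Icc (0 : ℝ) 1, ∀ z ∈ Metric.ball v ε, y + s • z ∈ Ω)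
    {κ : ℝ} (hκ : 0 < κ) :
    ∃ (π : SimpleFunc E3 E3) (w : E3) (r A : ℝ), 0 ≤ A ∧ ∀ (φ : E3 → ℂ) (G : E3 → C3),
      StronglyMeasurable φ → MemLp φ 2 (volume.restrict Ω) → MemLp G 2 (volume.restrict Ω) →
      IsWeakGrad Ω φ G → ∀ C : ℝ,
      (∀ p ∈ π.range, ‖⨍ y in Metric.ball (p + w) r, Ω.indicator φ y‖ ≤ C) →
      (eLpNorm φ 2 (volume.restrict U)).toReal ≤
        6 * κ * (eLpNorm G 2 (volume.restrict Ω)).toReal + A * C := by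
  have hUfin : volume U ≠ ⊤ := ((measure_mono hUΩ).trans_lt hΩfin.lt_top).ne
  have : IsFiniteMeasure (volume.restrict Ω) := isFiniteMeasure_restrict.2 hΩfin
  obtain ⟨w, η, hη, hw⟩ := exists_small_cone hε hcone hκ
  obtain ⟨π, hπ⟩ := exists_simpleFunc_dist_lt (hΩt.subset hUΩ) (half_pos hη)
  -- All these data are fixed before `φ`, so the same finite family of averages serves every Sobolev
  -- function.
  refine ⟨π, w, η / 2, (volume U ^ ((2 : ENNReal).toReal⁻¹)).toReal, ENNReal.toReal_nonneg,
    fun φ G hφm hφ2 hG h C hC => ?_⟩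
  have hC0 : 0 ≤ C := (norm_nonneg _).trans (hC (π 0) (π.mem_range_self 0))
  set f : E3 → ℂ := Ω.indicator φ with hf
  set N := (eLpNorm G 2 (volume.restrict Ω)).toReal with hN
  have hN0 : 0 ≤ N := ENNReal.toReal_nonneg
  have hφ1 : IntegrableOn φ Ω := hφ2.integrable (by norm_num)
  have hfm : StronglyMeasurable f := hφm.indicator hΩ.measurableSet
  have hfi : Integrable f := (integrable_indicator_iff hΩ.measurableSet).2 hφ1
  set K := ENNReal.ofReal (2 * (κ * N)) ^ 2 with hK
  have hdiff : ∀ z ∈ Metric.ball w η, ∫⁻ y in U, ‖f (y + z) - f y‖ₑ ^ 2 ≤ K := by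
    intro z hz
    have h := eLpNorm_difference_le hΩ hU h hφ1 hφ2 hG (hw z hz).2
    rw [← eLpNorm_two_sq]
    refine pow_le_pow_left' (h.trans (ENNReal.ofReal_le_ofReal ?_)) 2
    have := mul_le_mul_of_nonneg_right (hw z hz).1 hN0
    linarith
  set a : E3 → ℂ := fun y => ⨍ x in Metric.ball (π y + w) (η / 2), f x with ha
  have h1 := lintegral_sub_average_le hfm hfi hU.measurableSet hη hπ hdiff
  -- The factor 6 comes from `8 · (2 κ N)² = 32 (κ N)² ≤ (6 κ N)²`.
  have h2 : eLpNorm (fun y => f y - a y) 2 (volume.restrict U) ≤ ENNReal.ofReal (6 * κ * N) := by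
    rw [← ENNReal.pow_le_pow_left_iff two_ne_zero, eLpNorm_two_sq]
    refine h1.trans ?_
    rw [hK, show (8 : ENNReal) = ENNReal.ofReal 8 by norm_num, ← ENNReal.ofReal_pow (by positivity),
      ← ENNReal.ofReal_pow (by positivity), ← ENNReal.ofReal_mul (by norm_num)]
    refine ENNReal.ofReal_le_ofReal ?_
    nlinarith [sq_nonneg (κ * N)]
  have h3 : eLpNorm a 2 (volume.restrict U) ≤
      volume U ^ ((2 : ENNReal).toReal⁻¹) * ENNReal.ofReal C := by
    have := eLpNorm_le_of_ae_bound (p := 2) (f := a) (C := C) (ae_of_all (volume.restrict U)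
      fun y => hC (π y) (π.mem_range_self y))
    rwa [Measure.restrict_apply_univ] at this
  have ham : AEStronglyMeasurable a (volume.restrict U) :=
    ((π.map fun p => ⨍ x in Metric.ball (p + w) (η / 2), f x).stronglyMeasurable).aestronglyMeasurable
  have h4 : eLpNorm f 2 (volume.restrict U) ≤
      ENNReal.ofReal (6 * κ * N) + volume U ^ ((2 : ENNReal).toReal⁻¹) * ENNReal.ofReal C := by
    have e : f = (fun y => f y - a y) + a := by funext y; simp
    rw [e]
    exact (eLpNorm_add_le (hfm.aestronglyMeasurable.sub ham) ham (by norm_num)).trans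
      (add_le_add h2 h3)
  have hUpow : volume U ^ ((2 : ENNReal).toReal⁻¹) ≠ ⊤ :=
    ENNReal.rpow_ne_top_of_nonneg (by positivity) hUfin
  have h5 : eLpNorm φ 2 (volume.restrict U) = eLpNorm f 2 (volume.restrict U) := by
    refine eLpNorm_congr_ae ?_
    filter_upwards [ae_restrict_mem hU.measurableSet] with y hy
    rw [hf, indicator_of_mem (hUΩ hy)]
  have h6 := ENNReal.toReal_mono (ENNReal.add_ne_top.2 ⟨ENNReal.ofReal_ne_top,
    ENNReal.mul_ne_top hUpow ENNReal.ofReal_ne_top⟩) h4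
  rwa [ENNReal.toReal_add ENNReal.ofReal_ne_top (ENNReal.mul_ne_top hUpow ENNReal.ofReal_ne_top),
    ENNReal.toReal_mul, ENNReal.toReal_ofReal hC0, ENNReal.toReal_ofReal (by positivity),
    ← h5] at h6

theorem H1.norm_restrict {M U : Set E3} (hU : U ⊆ interior M) (φ : H1 M) :
    ‖H1.restrict M U φ‖ = (eLpNorm φ.1.fst 2 (volume.restrict U)).toReal := by
  have e1 : (volume.restrict (interior M)).restrict U = volume.restrict U :=
    Measure.restrict_restrict_of_subset hU
  have e2 : (H1.restrict M U φ : E3 → ℂ) =ᵐ[(volume.restrict (interior M)).restrict U] φ.1.fst :=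
    LpToLpRestrictCLM_coeFn ℂ U φ.1.fst
  rw [Lp.norm_def]
  refine congrArg ENNReal.toReal ((eLpNorm_congr_ae e2).trans ?_)
  rw [e1]

/-- Up to an error `e ‖φ‖`, finitely many ball averages control the local `L²` norm, and they are
continuous linear functionals. The choice `κ = e / 6` cancels the factor in `IsWeakGrad.eLpNorm_le`.
-/
theorem H1.isCompactOperator_restrict {M : Set E3} (hM : IsCompact M) {x v : E3} {δ ε : ℝ}
    (hε : 0 < ε)
    (hcone : ∀ y ∈ interior M ∩ Metric.ball x δ, ∀ s ∈ Icc (0 : ℝ) 1, ∀ z ∈ Metric.ball v ε,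
      y + s • z ∈ interior M) :
    IsCompactOperator (H1.restrict M (interior M ∩ Metric.ball x δ)) := by
  choose π w r A hA h using fun (e : ℝ) (he : 0 < e) => IsWeakGrad.eLpNorm_le isOpen_interior
    (isOpen_interior.inter Metric.isOpen_ball) inter_subset_left
    (hM.totallyBounded.subset interior_subset)
    ((measure_mono interior_subset).trans_lt hM.measure_lt_top).ne hε hcone
    (κ := e / 6) (by positivity)
  refine isCompactOperator_of_norm_le_finite _ fun e he => ⟨(π e he).range, inferInstance,
    ⟨π e he 0, (π e he).mem_range_self 0⟩, fun p =>
    (ballAverage M (p + w e he) (r e he)).comp (H1.toL2 M), A e he, hA e he, fun φ C hC => ?_⟩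
  have h1 := h e he φ.1.fst φ.1.snd (Lp.stronglyMeasurable _) (Lp.memLp _) (Lp.memLp _) φ.2 C
    fun p hp => by
      rw [← ballAverage_apply]
      exact hC ⟨p, hp⟩
  rw [H1.norm_restrict inter_subset_left]
  refine h1.trans ?_
  have h2 : (eLpNorm φ.1.snd 2 (volume.restrict (interior M))).toReal ≤ ‖φ‖ := H1.norm_snd_le φ
  have := mul_le_mul_of_nonneg_left h2 he.le
  linarith

/-- The Rellich theorem for compact sets with smooth boundary. -/
theorem H1.isCompactOperator_toL2 {M : Set E3} (hM : IsCompact M) (hs : HasSmoothBoundary M) :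
    IsCompactOperator (H1.toL2 M) := by
  choose! δ hδ v ε hε hcone using fun x (hx : x ∈ M) => exists_cone hM.isClosed hs hx
  obtain ⟨t, ht, hcov⟩ := hM.elim_nhds_subcover (fun x => Metric.ball x (δ x))
    fun x hx => Metric.ball_mem_nhds x (hδ x hx)
  refine isCompactOperator_of_norm_sq_le_sum (ι := t)
    (K := fun i => H1.restrict M (interior M ∩ Metric.ball i (δ i))) _ (fun i =>
    H1.isCompactOperator_restrict hM (hε _ (ht i i.2)) (hcone _ (ht i i.2))) fun φ => ?_
  have hcovΩ : interior M ⊆ ⋃ i : t, interior M ∩ Metric.ball i (δ i) := fun y hy => by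
    obtain ⟨x, hx, hyx⟩ := mem_iUnion₂.1 (hcov (interior_subset hy))
    exact mem_iUnion.2 ⟨⟨x, hx⟩, hy, hyx⟩
  have hmem : MemLp φ.1.fst 2 (volume.restrict (interior M)) := Lp.memLp _
  have h1 : eLpNorm φ.1.fst 2 (volume.restrict (interior M)) ^ 2 ≤
      ∑ i : t, eLpNorm φ.1.fst 2 (volume.restrict (interior M ∩ Metric.ball i (δ i))) ^ 2 := by
    simp only [eLpNorm_two_sq]
    refine (lintegral_mono_set hcovΩ).trans ((lintegral_iUnion_le _ _).trans_eq ?_)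
    rw [tsum_fintype]
  have hfin : ∀ i : t,
      eLpNorm φ.1.fst 2 (volume.restrict (interior M ∩ Metric.ball i (δ i))) ≠ ⊤ := fun i =>
    (hmem.mono_measure (Measure.restrict_mono inter_subset_left le_rfl)).2.ne
  have h2 := ENNReal.toReal_mono
    (ENNReal.sum_ne_top.2 fun i _ => ENNReal.pow_ne_top (hfin i)) h1
  rw [ENNReal.toReal_pow, ENNReal.toReal_sum fun i _ => ENNReal.pow_ne_top (hfin i)] at h2
  simp only [ENNReal.toReal_pow] at h2
  simp only [H1.norm_restrict inter_subset_left]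
  exact h2

/-! ### Test functions and multipliers in `H¹(M)` -/

theorem locallyIntegrableOn_of_memLp {Ω : Set E3} (hΩ : IsOpen Ω) {F : Type*}
    [NormedAddCommGroup F] {f : E3 → F} (hf : MemLp f 2 (volume.restrict Ω)) :
    LocallyIntegrableOn f Ω := by
  rw [locallyIntegrableOn_iff hΩ.isLocallyClosed]
  intro K hKΩ hK
  have := isFiniteMeasure_restrict.2 (hK.measure_lt_top (μ := volume)).ne
  exact ((hf.mono_measure (Measure.restrict_mono hKΩ le_rfl)).integrable
    (by norm_num) : Integrable _ (volume.restrict K))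

theorem IsTestFunction.memLp {Ω : Set E3} {ψ : E3 → ℝ} (hψ : IsTestFunction Ω ψ)
    (m : Measure E3) [IsFiniteMeasureOnCompacts m] : MemLp ψ 2 m :=
  hψ.smooth.continuous.memLp_of_hasCompactSupport hψ.compactSupport

theorem IsTestFunction.memLp_gradient {Ω : Set E3} {ψ : E3 → ℝ} (hψ : IsTestFunction Ω ψ)
    (m : Measure E3) [IsFiniteMeasureOnCompacts m] (i : Fin 3) :
    MemLp (fun x => gradient ψ x i) 2 m :=
  (hψ.gradient_apply i).1.memLp_of_hasCompactSupport (hψ.gradient_apply i).2.1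

theorem isWeakGrad_of_forall {Ω : Set E3} {φ : E3 → ℂ} {G : E3 → C3}
    (h1 : LocallyIntegrableOn φ Ω) (h2 : LocallyIntegrableOn G Ω)
    (h : ∀ ψ, IsTestFunction Ω ψ → ∀ i,
      ∫ x in Ω, gradient ψ x i • φ x = -∫ x in Ω, ψ x • G x i) : IsWeakGrad Ω φ G := by
  rw [isWeakGrad_iff]
  refine fun i => ⟨fun x hx => ?_, locInt_apply h2 i, fun ψ hψ => ?_⟩
  · obtain ⟨t, ht, hi⟩ := h1 x hx
    exact ⟨t, ht, hi.smul_const _⟩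
  · simpa [cdot_single] using h ψ hψ i

theorem IsWeakGrad.integral_partial {Ω : Set E3} {φ : E3 → ℂ} {G : E3 → C3}
    (h : IsWeakGrad Ω φ G) {ψ : E3 → ℝ} (hψ : IsTestFunction Ω ψ) (i : Fin 3) :
    ∫ x in Ω, gradient ψ x i • φ x = -∫ x in Ω, ψ x • G x i := by
  simpa [cdot_single] using (isWeakGrad_iff.1 h i).eq ψ hψ

theorem gradient_apply_eq (ψ : E3 → ℝ) (x : E3) (i : Fin 3) :
    gradient ψ x i = fderiv ℝ ψ x (EuclideanSpace.single i 1) := by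
  rw [← inner_gradient, EuclideanSpace.inner_single_right]
  simp

/-- The integral of a partial derivative of a test function vanishes. Combined with the product rule
for `ψ · 1`, this yields the weak gradient of a test function. -/
theorem isWeakGrad_one {Ω : Set E3} : IsWeakGrad Ω (fun _ => 1) 0 := by
  refine isWeakGrad_of_forall ((locallyIntegrable_const _).locallyIntegrableOn _)
    (locallyIntegrable_zero.locallyIntegrableOn _) fun ψ hψ i => ?_
  obtain ⟨h1, h2, h3⟩ := hψ.gradient_apply i
  have e1 : ∫ x, gradient ψ x i = 0 := by
    have := integral_mul_fderiv_eq_neg_fderiv_mul_of_integrable (μ := volume) (𝕜 := ℝ)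
      (f := fun _ => (1 : ℝ)) (g := ψ) (v := EuclideanSpace.single i (1 : ℝ)) (by simp)
      (by simpa [gradient_apply_eq] using h1.integrable_of_hasCompactSupport h2)
      (by simpa using hψ.smooth.continuous.integrable_of_hasCompactSupport hψ.compactSupport)
      (by fun_prop) fun x _ => hψ.smooth.differentiable (by simp) x
    simpa [gradient_apply_eq] using this
  have e2 : ∫ x in Ω, gradient ψ x i = 0 := by
    rw [setIntegral_eq_integral_of_forall_compl_eq_zero, e1]
    exact fun x hx => image_eq_zero_of_notMem_tsupport (f := fun x => gradient ψ x i)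
      fun h => hx (h3 h)
  have e3 : ∫ x in Ω, gradient ψ x i • (1 : ℂ) = ((∫ x in Ω, gradient ψ x i : ℝ) : ℂ) := by
    rw [← integral_complex_ofReal]
    simp
  rw [e3, e2]
  simp

theorem IsTestFunction.isWeakGrad {Ω Ω' : Set E3} (hΩ : IsOpen Ω) {ψ : E3 → ℝ}
    (hψ : IsTestFunction Ω' ψ) :
    IsWeakGrad Ω (fun x => (ψ x : ℂ)) (fun x => toC3 (gradient ψ x)) := by
  have := isWeakGrad_one.mul hΩ (hψ.smooth.of_le (by norm_cast) : ContDiff ℝ 1 ψ).contDiffOn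
  simpa using this

theorem exists_H1 {M : Set E3} {φ : E3 → ℂ} {G : E3 → C3}
    (h : IsWeakGrad (interior M) φ G) (hφ : MemLp φ 2 (volume.restrict (interior M)))
    (hG : MemLp G 2 (volume.restrict (interior M))) :
    ∃ w : H1 M, w.1.fst =ᵐ[volume.restrict (interior M)] φ ∧
      w.1.snd =ᵐ[volume.restrict (interior M)] G :=
  ⟨⟨WithLp.toLp 2 (hφ.toLp φ, hG.toLp G), h.congr isOpen_interior hφ.coeFn_toLp.symm
    hG.coeFn_toLp.symm⟩, hφ.coeFn_toLp, hG.coeFn_toLp⟩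

theorem IsTestFunction.exists_H1 {M : Set E3} {ψ : E3 → ℝ}
    (hψ : IsTestFunction (interior M) ψ) :
    ∃ w : H1 M, w.1.fst =ᵐ[volume.restrict (interior M)] (fun x => (ψ x : ℂ)) ∧
      w.1.snd =ᵐ[volume.restrict (interior M)] fun x => toC3 (gradient ψ x) := by
  refine _root_.exists_H1 (hψ.isWeakGrad isOpen_interior) (hψ.memLp _).ofReal ?_
  refine MemLp.of_le_mul (c := 1) (g := fun x => fderiv ℝ ψ x) ?_ ?_ ?_
  · exact (hψ.smooth.continuous_fderiv (by simp)).memLp_of_hasCompactSupport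
      (hψ.compactSupport.fderiv ℝ)
  · exact (continuous_toC3.comp
      (continuous_gradient (hψ.smooth.of_le (by norm_cast)))).aestronglyMeasurable
  · exact ae_of_all _ fun x => by rw [norm_toC3, norm_gradient, one_mul]

/-- Multipliers of `H¹`: bounded `C¹` functions with bounded gradient. -/
structure IsMultiplier (Ω : Set E3) (a : E3 → ℝ) : Prop where
  contDiffOn : ContDiffOn ℝ 1 a Ω
  bounded : ∃ C, ∀ x ∈ Ω, |a x| ≤ C
  gradient_bounded : ∃ C, ∀ x ∈ Ω, ‖gradient a x‖ ≤ C

theorem IsMultiplier.differentiableAt {Ω : Set E3} (hΩ : IsOpen Ω) {a : E3 → ℝ}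
    (ha : IsMultiplier Ω a) {x : E3} (hx : x ∈ Ω) : DifferentiableAt ℝ a x :=
  (ha.contDiffOn.contDiffAt (hΩ.mem_nhds hx)).differentiableAt one_ne_zero

theorem IsMultiplier.mul {Ω : Set E3} (hΩ : IsOpen Ω) {a b : E3 → ℝ} (ha : IsMultiplier Ω a)
    (hb : IsMultiplier Ω b) : IsMultiplier Ω fun x => a x * b x := by
  obtain ⟨A, hA⟩ := ha.bounded
  obtain ⟨A', hA'⟩ := ha.gradient_bounded
  obtain ⟨B, hB⟩ := hb.bounded
  obtain ⟨B', hB'⟩ := hb.gradient_bounded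
  refine ⟨ha.contDiffOn.mul hb.contDiffOn, ⟨A * B, fun x hx => ?_⟩, ⟨A * B' + B * A', fun x hx => ?_⟩⟩
  · rw [abs_mul]
    exact mul_le_mul (hA x hx) (hB x hx) (abs_nonneg _) ((abs_nonneg _).trans (hA x hx))
  · rw [gradient_mul_eq (ha.differentiableAt hΩ hx) (hb.differentiableAt hΩ hx)]
    refine (norm_add_le _ _).trans (add_le_add ?_ ?_)
    · rw [norm_smul]
      exact mul_le_mul (hA x hx) (hB' x hx) (norm_nonneg _) ((abs_nonneg _).trans (hA x hx))
    · rw [norm_smul]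
      exact mul_le_mul (hB x hx) (hA' x hx) (norm_nonneg _) ((abs_nonneg _).trans (hB x hx))

/-- `a ∇(1/a) = -(1/a) ∇a`. -/
theorem smul_gradient_inv {a : E3 → ℝ} {x : E3} (ha : DifferentiableAt ℝ a x) (h0 : a x ≠ 0) :
    a x • gradient (fun y => (a y)⁻¹) x = -((a x)⁻¹ • gradient a x) := by
  have h1 := gradient_mul_eq ha (ha.fun_inv h0)
  have h2 : (fun y => a y * (a y)⁻¹) =ᶠ[𝓝 x] fun _ => 1 := by
    filter_upwards [ha.continuousAt.eventually_ne h0] with y hy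
    exact mul_inv_cancel₀ hy
  have h3 : gradient (fun y => a y * (a y)⁻¹) x = 0 := by
    simp only [gradient]
    rw [h2.fderiv_eq]
    simp
  rw [h3] at h1
  exact eq_neg_of_add_eq_zero_left h1.symm

theorem IsMultiplier.inv {Ω : Set E3} (hΩ : IsOpen Ω) {a : E3 → ℝ} (ha : IsMultiplier Ω a)
    {m : ℝ} (hm : 0 < m) (ham : ∀ x ∈ Ω, m ≤ a x) : IsMultiplier Ω fun x => (a x)⁻¹ := by
  obtain ⟨A', hA'⟩ := ha.gradient_bounded
  have hinv : ∀ x ∈ Ω, |(a x)⁻¹| ≤ m⁻¹ := fun x hx => by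
    rw [abs_inv, abs_of_pos (hm.trans_le (ham x hx))]
    exact inv_anti₀ hm (ham x hx)
  refine ⟨ha.contDiffOn.inv fun x hx => (hm.trans_le (ham x hx)).ne', ⟨m⁻¹, hinv⟩,
    ⟨m⁻¹ * (m⁻¹ * A'), fun x hx => ?_⟩⟩
  have h0 : a x ≠ 0 := (hm.trans_le (ham x hx)).ne'
  have h1 := smul_gradient_inv (ha.differentiableAt hΩ hx) h0
  have h2 : gradient (fun y => (a y)⁻¹) x = (a x)⁻¹ • -((a x)⁻¹ • gradient a x) := by
    rw [← h1, smul_smul, inv_mul_cancel₀ h0, one_smul]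
  rw [h2, norm_smul, norm_neg, norm_smul]
  have h3 := hinv x hx
  rw [← Real.norm_eq_abs] at h3
  have h4 : 0 ≤ A' := (norm_nonneg _).trans (hA' x hx)
  gcongr
  exact hA' x hx

theorem MemLp.bounded_smul {Ω : Set E3} (hΩ : IsOpen Ω) {F : Type*} [NormedAddCommGroup F]
    [NormedSpace ℝ F] {f : E3 → F} (hf : MemLp f 2 (volume.restrict Ω)) {a : E3 → ℝ}
    (ha : ContinuousOn a Ω) {C : ℝ} (hC : ∀ x ∈ Ω, |a x| ≤ C) :
    MemLp (fun x => a x • f x) 2 (volume.restrict Ω) := by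
  refine MemLp.of_le_mul (c := C) hf
    ((ha.aestronglyMeasurable hΩ.measurableSet).fun_smul hf.1) ?_
  filter_upwards [ae_restrict_mem hΩ.measurableSet] with x hx
  rw [norm_smul]
  exact mul_le_mul_of_nonneg_right (hC x hx) (norm_nonneg _)

theorem MemLp.smul_toC3 {Ω : Set E3} (hΩ : IsOpen Ω) {f : E3 → ℂ}
    (hf : MemLp f 2 (volume.restrict Ω)) {v : E3 → E3} (hv : ContinuousOn v Ω) {C : ℝ}
    (hC : ∀ x ∈ Ω, ‖v x‖ ≤ C) : MemLp (fun x => f x • toC3 (v x)) 2 (volume.restrict Ω) := by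
  refine MemLp.of_le_mul (c := C) hf (hf.1.fun_smul
    ((continuous_toC3.comp_continuousOn hv).aestronglyMeasurable hΩ.measurableSet)) ?_
  filter_upwards [ae_restrict_mem hΩ.measurableSet] with x hx
  rw [norm_smul, norm_toC3, mul_comm]
  exact mul_le_mul_of_nonneg_right (hC x hx) (norm_nonneg _)

theorem aestronglyMeasurable_cdot {m : Measure E3} {f g : E3 → C3}
    (hf : AEStronglyMeasurable f m) (hg : AEStronglyMeasurable g m) :
    AEStronglyMeasurable (fun x => cdot (f x) (g x)) m := by
  unfold cdot
  refine Finset.aestronglyMeasurable_fun_sum _ fun i _ => ?_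
  exact ((EuclideanSpace.proj (𝕜 := ℂ) i).continuous.comp_aestronglyMeasurable hf).mul
    ((EuclideanSpace.proj (𝕜 := ℂ) i).continuous.comp_aestronglyMeasurable hg)

/-- The conjugate of a multiple of a function in `H¹(M)` is in `H¹(M)`. -/
theorem IsMultiplier.exists_H1_conj_mul {M : Set E3} {a : E3 → ℝ}
    (ha : IsMultiplier (interior M) a) (φ : H1 M) :
    ∃ w : H1 M, w.1.fst =ᵐ[volume.restrict (interior M)]
        (fun x => starRingEnd ℂ ((a x : ℂ) * φ.1.fst x)) ∧
      w.1.snd =ᵐ[volume.restrict (interior M)]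
        fun x => conj3 ((a x : ℂ) • φ.1.snd x + φ.1.fst x • toC3 (gradient a x)) := by
  obtain ⟨A, hA⟩ := ha.bounded
  obtain ⟨A', hA'⟩ := ha.gradient_bounded
  have h1 : MemLp (fun x => (a x : ℂ) * φ.1.fst x) 2 (volume.restrict (interior M)) := by
    simpa using MemLp.bounded_smul isOpen_interior (Lp.memLp φ.1.fst) ha.contDiffOn.continuousOn hA
  have h2 : MemLp (fun x => (a x : ℂ) • φ.1.snd x + φ.1.fst x • toC3 (gradient a x)) 2
      (volume.restrict (interior M)) := by
    have h3 := MemLp.bounded_smul isOpen_interior (Lp.memLp φ.1.snd)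
      ha.contDiffOn.continuousOn hA
    simp only [← Complex.coe_smul] at h3
    exact h3.add (MemLp.smul_toC3 isOpen_interior (Lp.memLp φ.1.fst)
      (continuousOn_gradient isOpen_interior ha.contDiffOn) hA')
  refine exists_H1 (IsWeakGrad.mul isOpen_interior φ.2 ha.contDiffOn).conj ?_ ?_
  · exact h1.of_le (Complex.continuous_conj.comp_aestronglyMeasurable h1.1)
      (ae_of_all _ fun x => by simp)
  · exact h2.of_le (continuous_conj3.comp_aestronglyMeasurable h2.1)
      (ae_of_all _ fun x => by rw [norm_conj3])

theorem IsTestFunction.memLp_field {Ω : Set E3} {ψ : E3 → ℝ} (hψ : IsTestFunction Ω ψ)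
    (m : Measure E3) [IsFiniteMeasureOnCompacts m] (i : Fin 3) :
    MemLp (fun x => (ψ x : ℂ) • EuclideanSpace.single i (1 : ℂ)) 2 m := by
  refine MemLp.of_le_mul (c := 1) (hψ.memLp m) ?_ (ae_of_all _ fun x => by simp [norm_smul])
  have := hψ.smooth.continuous
  exact Continuous.aestronglyMeasurable (by fun_prop)

theorem inner_real_smul_single (k : ℝ) (v : C3) (i : Fin 3) :
    ⟪(k : ℂ) • EuclideanSpace.single i (1 : ℂ), v⟫_ℂ = k • v i := by
  rw [inner_smul_left, EuclideanSpace.inner_single_left]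
  simp

/-- Each test function and each component impose the vanishing of one `L²`-continuous functional, so
`H¹(M)` is an intersection of closed sets. The resulting completeness is what Peetre's lemma and the
pseudo-inverse require. -/
theorem H1.isClosed (M : Set E3) : IsClosed (H1 M : Set (WithLp 2
    (Lp ℂ 2 (volume.restrict (interior M)) × Lp C3 2 (volume.restrict (interior M))))) := by
  have hΛ : ∀ (ψ : {ψ // IsTestFunction (interior M) ψ}) (i : Fin 3), ∃ Λ : WithLp 2
      (Lp ℂ 2 (volume.restrict (interior M)) × Lp C3 2 (volume.restrict (interior M))) →L[ℂ] ℂ,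
      ∀ w, Λ w = (∫ x in interior M, gradient ψ.1 x i • w.fst x) +
        ∫ x in interior M, ψ.1 x • w.snd x i := by
    rintro ⟨ψ, hψ⟩ i
    have m1 : MemLp (fun x => (gradient ψ x i : ℂ)) 2 (volume.restrict (interior M)) :=
      (hψ.memLp_gradient _ i).ofReal
    have m2 := hψ.memLp_field (volume.restrict (interior M)) i
    refine ⟨(innerSL ℂ m1.toLp).comp (WithLp.fstL 2 ℂ _ _) +
      (innerSL ℂ m2.toLp).comp (WithLp.sndL 2 ℂ _ _), fun w => ?_⟩
    change ⟪m1.toLp, w.fst⟫_ℂ + ⟪m2.toLp, w.snd⟫_ℂ = _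
    rw [L2.inner_def, L2.inner_def]
    congr 1
    · refine integral_congr_ae ?_
      filter_upwards [m1.coeFn_toLp] with x hx
      rw [hx]
      simp [mul_comm]
    · refine integral_congr_ae ?_
      filter_upwards [m2.coeFn_toLp] with x hx
      rw [hx, inner_real_smul_single]
  choose Λ hΛ using hΛ
  have key : (H1 M : Set (WithLp 2 (Lp ℂ 2 (volume.restrict (interior M)) ×
      Lp C3 2 (volume.restrict (interior M))))) = ⋂ ψ, ⋂ i, {w | Λ ψ i w = 0} := by
    ext w
    simp only [mem_iInter, mem_ofPred_eq, hΛ]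
    constructor
    · intro h ψ i
      rw [IsWeakGrad.integral_partial h ψ.2 i, neg_add_cancel]
    · intro h
      exact isWeakGrad_of_forall (locallyIntegrableOn_of_memLp isOpen_interior (Lp.memLp _))
        (locallyIntegrableOn_of_memLp isOpen_interior (Lp.memLp _))
        fun ψ hψ i => eq_neg_of_add_eq_zero_left (h ⟨ψ, hψ⟩ i)
  rw [key]
  exact isClosed_iInter fun ψ => isClosed_iInter fun i =>
    isClosed_eq (Λ ψ i).continuous continuous_const

instance H1.completeSpace (M : Set E3) : CompleteSpace (H1 M) :=
  (H1.isClosed M).completeSpace_coe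

/-! ### The coefficients -/

/-- The gradient of a `C¹` function on a compact set is bounded in the interior. -/
theorem exists_norm_gradient_le {M : Set E3} (hM : IsCompact M) {a : E3 → ℝ}
    (ha : ContDiffOn ℝ 1 a M) : ∃ C, ∀ x ∈ interior M, ‖gradient a x‖ ≤ C := by
  have hloc : ∀ x ∈ M, ∃ V ∈ 𝓝 x, ∃ C : ℝ, ∀ y ∈ interior M ∩ V, ‖gradient a y‖ ≤ C := by
    intro x hx
    have h := ha x hx
    -- Near `x`, being `C¹` on `M` supplies a derivative `f'` within a set `u` that is continuous at
    -- `x` from within `u`, hence bounded near `x`.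
    rw [show (1 : WithTop ℕ∞) = 0 + 1 by rfl,
      contDiffWithinAt_succ_iff_hasFDerivWithinAt (by simp)] at h
    obtain ⟨u, hu, -, f', hf', hc⟩ := h
    rw [insert_eq_of_mem hx] at hu
    have hxu : x ∈ u := mem_of_mem_nhdsWithin hx hu
    have hev : ∀ᶠ y in 𝓝[u] x, ‖f' y‖ < ‖f' x‖ + 1 :=
      hc.continuousWithinAt.norm.eventually (eventually_lt_nhds (lt_add_one _))
    have hev' : ∀ᶠ y in 𝓝[M] x, y ∈ u ∧ ‖f' y‖ < ‖f' x‖ + 1 := by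
      filter_upwards [hu, nhdsWithin_le_of_mem hu hev] with y h1 h2 using ⟨h1, h2⟩
    obtain ⟨V, hVo, hxV, hV⟩ := mem_nhdsWithin.1 hev'
    refine ⟨V, hVo.mem_nhds hxV, ‖f' x‖ + 1, ?_⟩
    rintro y ⟨hyM, hyV⟩
    obtain ⟨hyu, hyn⟩ := hV ⟨hyV, interior_subset hyM⟩
    -- At an interior point `u` is a full neighbourhood, so `f'` agrees there with the ordinary
    -- derivative.
    have hun : u ∈ 𝓝 y := by
      filter_upwards [hVo.mem_nhds hyV, isOpen_interior.mem_nhds hyM] with z hz hz'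
      exact (hV ⟨hz, interior_subset hz'⟩).1
    rw [norm_gradient, ((hf' y hyu).hasFDerivAt hun).fderiv]
    exact hyn.le
  choose! V hV C hC using hloc
  obtain ⟨t, ht, hcov⟩ := hM.elim_nhds_subcover V hV
  refine ⟨∑ x ∈ t, |C x|, fun y hy => ?_⟩
  obtain ⟨x, hx, hyx⟩ := mem_iUnion₂.1 (hcov (interior_subset hy))
  calc _ ≤ C x := hC x (ht x hx) y ⟨hy, hyx⟩
    _ ≤ |C x| := le_abs_self _
    _ ≤ _ := Finset.single_le_sum (f := fun x => |C x|) (fun _ _ => abs_nonneg _) hx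

namespace GasPlanet

variable (P : GasPlanet)

/-- The field `b = (ρ₀² / κ) g₀' = ∇ρ₀ - s̃`. -/
noncomputable def drift (x : E3) : E3 := (P.ρ x ^ 2 / P.κ x) • P.g x

theorem gradientWithin_eq {x : E3} (hx : x ∈ P.Ω) : gradientWithin P.ρ P.M x = gradient P.ρ x := by
  simp only [gradientWithin, gradient]
  rw [fderivWithin_of_mem_nhds (mem_interior_iff_mem_nhds.1 hx)]

theorem sTilde_eq {x : E3} (hx : x ∈ P.Ω) : P.sTilde x = gradient P.ρ x - P.drift x := by
  rw [sTilde, P.gradientWithin_eq hx, drift]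

theorem drift_continuousOn : ContinuousOn P.drift P.M := by
  have hρ := P.ρ_contDiffOn.continuousOn
  refine ContinuousOn.smul ((hρ.pow 2).div ((P.c_continuousOn.pow 2).mul hρ) fun x hx => ?_)
    P.g_continuousOn
  exact (mul_pos (P.c_sq_pos x hx) (P.ρ_pos x hx)).ne'

theorem exists_drift_le : ∃ C, ∀ x ∈ P.Ω, ‖P.drift x‖ ≤ C := by
  obtain ⟨C, hC⟩ := P.isCompact.exists_bound_of_continuousOn P.drift_continuousOn
  exact ⟨C, fun x hx => hC x (interior_subset hx)⟩

theorem exists_ρ_le : ∃ R, 0 < R ∧ ∀ x ∈ P.Ω, P.ρ x ≤ R := by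
  obtain ⟨C, hC⟩ := P.isCompact.exists_bound_of_continuousOn P.ρ_contDiffOn.continuousOn
  exact ⟨|C| + 1, by positivity, fun x hx =>
    (le_abs_self _).trans ((hC x (interior_subset hx)).trans ((le_abs_self C).trans (by linarith)))⟩

theorem exists_le_ρ : ∃ m, 0 < m ∧ ∀ x ∈ P.Ω, m ≤ P.ρ x := by
  rcases P.M.eq_empty_or_nonempty with h | h
  · refine ⟨1, one_pos, fun x hx => absurd (interior_subset hx) ?_⟩
    rw [h]
    exact notMem_empty x
  · obtain ⟨x, hx, hmin⟩ := P.isCompact.exists_isMinOn h P.ρ_contDiffOn.continuousOn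
    exact ⟨P.ρ x, P.ρ_pos x hx, fun y hy => hmin (interior_subset hy)⟩

theorem ρ_ne_zero {x : E3} (hx : x ∈ P.Ω) : P.ρ x ≠ 0 := (P.ρ_pos x (interior_subset hx)).ne'

theorem isMultiplier_ρ : IsMultiplier P.Ω P.ρ := by
  obtain ⟨C, hC⟩ := P.isCompact.exists_bound_of_continuousOn P.ρ_contDiffOn.continuousOn
  exact ⟨P.ρ_contDiffOn.mono interior_subset, ⟨C, fun x hx => hC x (interior_subset hx)⟩,
    exists_norm_gradient_le P.isCompact P.ρ_contDiffOn⟩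

theorem isMultiplier_inv : IsMultiplier P.Ω fun x => (P.ρ x)⁻¹ := by
  obtain ⟨m, hm, h⟩ := P.exists_le_ρ
  exact P.isMultiplier_ρ.inv isOpen_interior hm h

theorem isMultiplier_sq : IsMultiplier P.Ω fun x => P.ρ x * P.ρ x :=
  P.isMultiplier_ρ.mul isOpen_interior P.isMultiplier_ρ

theorem isMultiplier_inv_sq : IsMultiplier P.Ω fun x => (P.ρ x)⁻¹ * (P.ρ x)⁻¹ :=
  P.isMultiplier_inv.mul isOpen_interior P.isMultiplier_inv

theorem gradient_sq {x : E3} (hx : x ∈ P.Ω) :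
    gradient (fun x => P.ρ x * P.ρ x) x = (2 * P.ρ x) • gradient P.ρ x := by
  have h := P.isMultiplier_ρ.differentiableAt isOpen_interior hx
  rw [gradient_mul_eq h h, ← add_smul, two_mul]

theorem gradient_inv_sq {x : E3} (hx : x ∈ P.Ω) :
    gradient (fun x => (P.ρ x)⁻¹ * (P.ρ x)⁻¹) x =
      (-(2 * ((P.ρ x)⁻¹ * (P.ρ x)⁻¹ * (P.ρ x)⁻¹))) • gradient P.ρ x := by
  have h := P.isMultiplier_inv.differentiableAt isOpen_interior hx
  have h1 := smul_gradient_inv (P.isMultiplier_ρ.differentiableAt isOpen_interior hx)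
    (P.ρ_ne_zero hx)
  have h2 : gradient (fun y => (P.ρ y)⁻¹) x = (-((P.ρ x)⁻¹ * (P.ρ x)⁻¹)) • gradient P.ρ x := by
    rw [neg_smul, ← smul_smul, ← smul_neg, ← h1, smul_smul, inv_mul_cancel₀ (P.ρ_ne_zero hx),
      one_smul]
  rw [gradient_mul_eq h h, ← add_smul, h2, smul_smul]
  congr 1
  ring

theorem gradient_ρ_continuousOn : ContinuousOn (gradient P.ρ) P.Ω :=
  continuousOn_gradient isOpen_interior P.isMultiplier_ρ.contDiffOn

/-- The zeroth order coefficient `2 ∇ρ₀ - b = ∇ρ₀ + s̃` of `-T*`. -/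
noncomputable def lower (x : E3) : E3 := (2 : ℝ) • gradient P.ρ x - P.drift x

theorem lower_continuousOn : ContinuousOn P.lower P.Ω :=
  (P.gradient_ρ_continuousOn.const_smul (2 : ℝ)).sub (P.drift_continuousOn.mono interior_subset)

theorem exists_lower_le : ∃ C, ∀ x ∈ P.Ω, ‖P.lower x‖ ≤ C := by
  obtain ⟨A, hA⟩ := P.isMultiplier_ρ.gradient_bounded
  obtain ⟨B, hB⟩ := P.exists_drift_le
  refine ⟨2 * A + B, fun x hx => (norm_sub_le _ _).trans (add_le_add ?_ (hB x hx))⟩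
  rw [norm_smul, Real.norm_of_nonneg (by norm_num)]
  exact mul_le_mul_of_nonneg_left (hA x hx) (by norm_num)

/-! ### The weighted measure -/

theorem aemeasurable_ρ : AEMeasurable P.ρ (volume.restrict P.Ω) :=
  (P.ρ_contDiffOn.continuousOn.mono interior_subset).aemeasurable isOpen_interior.measurableSet

theorem ac_volume : P.μ ≪ volume.restrict P.Ω := withDensity_absolutelyContinuous _ _

theorem ae_iff {p : E3 → Prop} : (∀ᵐ x ∂P.μ, p x) ↔ ∀ᵐ x ∂volume.restrict P.Ω, p x :=
  ⟨P.ae_of_ae, fun h => P.ac_volume.ae_le h⟩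

theorem ae_mem : ∀ᵐ x ∂volume.restrict P.Ω, x ∈ P.Ω :=
  ae_restrict_mem isOpen_interior.measurableSet

theorem exists_μ_le : ∃ R : ENNReal, R ≠ ⊤ ∧ P.μ ≤ R • volume.restrict P.Ω := by
  obtain ⟨R, hR, h⟩ := P.exists_ρ_le
  refine ⟨ENNReal.ofReal R, ENNReal.ofReal_ne_top, ?_⟩
  rw [← withDensity_const]
  refine withDensity_mono ?_
  filter_upwards [P.ae_mem] with x hx
  exact ENNReal.ofReal_le_ofReal (h x hx)

theorem exists_volume_le : ∃ R : ENNReal, R ≠ ⊤ ∧ volume.restrict P.Ω ≤ R • P.μ := by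
  obtain ⟨m, hm, h⟩ := P.exists_le_ρ
  refine ⟨(ENNReal.ofReal m)⁻¹, ENNReal.inv_ne_top.2 (by simpa using hm), ?_⟩
  rw [μ, ← withDensity_smul' _ _ (ENNReal.inv_ne_top.2 (by simpa using hm))]
  conv_lhs => rw [← withDensity_one (μ := volume.restrict P.Ω)]
  refine withDensity_mono ?_
  filter_upwards [P.ae_mem] with x hx
  rw [Pi.one_apply, Pi.smul_apply, smul_eq_mul, ← ENNReal.inv_mul_cancel
    (a := ENNReal.ofReal m) (by simpa using hm) ENNReal.ofReal_ne_top]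
  gcongr
  exact h x hx

variable {P} in
theorem memLp_iff {F : Type*} [NormedAddCommGroup F] {f : E3 → F} :
    MemLp f 2 P.μ ↔ MemLp f 2 (volume.restrict P.Ω) := by
  obtain ⟨R, hR, h⟩ := P.exists_μ_le
  obtain ⟨R', hR', h'⟩ := P.exists_volume_le
  exact ⟨fun hf => hf.of_measure_le_smul hR' h', fun hf => hf.of_measure_le_smul hR h⟩

theorem memLp_volume {F : Type*} [NormedAddCommGroup F] (f : Lp F 2 P.μ) :
    MemLp f 2 (volume.restrict P.Ω) := memLp_iff.1 (Lp.memLp f)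

theorem eLpNorm_le_of_le_smul {α F : Type*} [MeasurableSpace α] [NormedAddCommGroup F]
    {m m' : Measure α} {R : ENNReal} (hR : R ≠ ⊤) (h : m ≤ R • m') {f : α → F}
    (hf : MemLp f 2 m') :
    (eLpNorm f 2 m).toReal ≤ Real.sqrt R.toReal * (eLpNorm f 2 m').toReal := by
  have h1 : eLpNorm f 2 m ^ 2 ≤ R * eLpNorm f 2 m' ^ 2 := by
    rw [eLpNorm_two_sq, eLpNorm_two_sq, ← smul_eq_mul, ← lintegral_smul_measure]
    exact lintegral_mono' h le_rfl
  have h2 := ENNReal.toReal_mono (ENNReal.mul_ne_top hR (ENNReal.pow_ne_top hf.2.ne)) h1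
  rw [ENNReal.toReal_mul, ENNReal.toReal_pow, ENNReal.toReal_pow] at h2
  refine (abs_le_of_sq_le_sq' ?_ (by positivity)).2
  rwa [mul_pow, Real.sq_sqrt ENNReal.toReal_nonneg]

theorem exists_norm_le : ∃ C : ℝ, 0 < C ∧ (∀ {F : Type} [NormedAddCommGroup F] {f : E3 → F},
    MemLp f 2 (volume.restrict P.Ω) →
      (eLpNorm f 2 P.μ).toReal ≤ C * (eLpNorm f 2 (volume.restrict P.Ω)).toReal ∧
      (eLpNorm f 2 (volume.restrict P.Ω)).toReal ≤ C * (eLpNorm f 2 P.μ).toReal) := by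
  obtain ⟨R, hR, h⟩ := P.exists_μ_le
  obtain ⟨R', hR', h'⟩ := P.exists_volume_le
  refine ⟨Real.sqrt R.toReal + Real.sqrt R'.toReal + 1, by positivity, fun hf => ⟨?_, ?_⟩⟩
  · refine (eLpNorm_le_of_le_smul hR h hf).trans ?_
    gcongr
    linarith [Real.sqrt_nonneg R'.toReal]
  · refine (eLpNorm_le_of_le_smul hR' h' (memLp_iff.2 hf)).trans ?_
    gcongr
    linarith [Real.sqrt_nonneg R.toReal]

/-- Expresses weighted inner products as `dx` integrals, the form in which the weak identities and
the trace condition are stated. -/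
theorem inner_eq {F : Type*} [NormedAddCommGroup F] [InnerProductSpace ℂ F] (f g : Lp F 2 P.μ) :
    ⟪f, g⟫_ℂ = ∫ x in P.Ω, (P.ρ x : ℂ) * ⟪f x, g x⟫_ℂ := by
  rw [L2.inner_def]
  change ∫ x, ⟪f x, g x⟫_ℂ ∂((volume.restrict P.Ω).withDensity fun x => ENNReal.ofReal (P.ρ x)) = _
  rw [integral_withDensity_eq_integral_toReal_smul₀
    P.aemeasurable_ρ.ennreal_ofReal (ae_of_all _ fun x => ENNReal.ofReal_lt_top)]
  refine integral_congr_ae ?_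
  filter_upwards [P.ae_mem] with x hx
  rw [ENNReal.toReal_ofReal (P.ρ_pos x (interior_subset hx)).le, Complex.real_smul]

theorem integrable_inner {F : Type*} [NormedAddCommGroup F] [InnerProductSpace ℂ F]
    (f g : Lp F 2 P.μ) :
    Integrable (fun x => (P.ρ x : ℂ) * ⟪f x, g x⟫_ℂ) (volume.restrict P.Ω) := by
  have h : Integrable (fun x => ⟪f x, g x⟫_ℂ)
    ((volume.restrict P.Ω).withDensity fun x => ENNReal.ofReal (P.ρ x)) :=
    L2.integrable_inner (𝕜 := ℂ) f g
  rw [integrable_withDensity_iff_integrable_smul₀'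
    P.aemeasurable_ρ.ennreal_ofReal (ae_of_all _ fun x => ENNReal.ofReal_lt_top)] at h
  refine h.congr ?_
  filter_upwards [P.ae_mem] with x hx
  rw [ENNReal.toReal_ofReal (P.ρ_pos x (interior_subset hx)).le, Complex.real_smul]

end GasPlanet

/-! ### Bounded multiplication operators -/

theorem exists_clm_of_pointwise {F F' : Type} [NormedAddCommGroup F] [NormedSpace ℂ F]
    [NormedAddCommGroup F'] [NormedSpace ℂ F'] {m : Measure E3} (A : E3 → F →ₗ[ℂ] F') {C : ℝ}
    (hmeas : ∀ f : Lp F 2 m, AEStronglyMeasurable (fun x => A x (f x)) m)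
    (hC : ∀ᵐ x ∂m, ∀ v, ‖A x v‖ ≤ C * ‖v‖) :
    ∃ L : Lp F 2 m →L[ℂ] Lp F' 2 m, ∀ f, L f =ᵐ[m] fun x => A x (f x) := by
  have hmem : ∀ f : Lp F 2 m, MemLp (fun x => A x (f x)) 2 m := fun f =>
    MemLp.of_le_mul (c := C) (Lp.memLp f) (hmeas f) (hC.mono fun x hx => hx _)
  let L : Lp F 2 m →ₗ[ℂ] Lp F' 2 m :=
    { toFun := fun f => (hmem f).toLp _
      map_add' := fun f g => by
        rw [← MemLp.toLp_add]
        refine MemLp.toLp_congr _ _ ?_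
        filter_upwards [Lp.coeFn_add f g] with x hx
        rw [hx, Pi.add_apply, Pi.add_apply, map_add]
      map_smul' := fun k f => by
        rw [RingHom.id_apply, ← MemLp.toLp_const_smul]
        refine MemLp.toLp_congr _ _ ?_
        filter_upwards [Lp.coeFn_smul k f] with x hx
        simp [hx] }
  refine ⟨L.mkContinuous C fun f => ?_, fun f => (hmem f).coeFn_toLp⟩
  refine Lp.norm_le_mul_norm_of_ae_le_mul ?_
  filter_upwards [(hmem f).coeFn_toLp, hC] with x h1 h2
  change ‖(hmem f).toLp _ x‖ ≤ _
  rw [h1]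
  exact h2 _

namespace GasPlanet

variable (P : GasPlanet)

theorem aestronglyMeasurable_of_continuousOn {F : Type} [NormedAddCommGroup F]
    [SecondCountableTopology F] {a : E3 → F} (ha : ContinuousOn a P.Ω) :
    AEStronglyMeasurable a P.μ :=
  (ha.aestronglyMeasurable isOpen_interior.measurableSet).mono_ac P.ac_volume

theorem exists_mul_clm (F : Type) [NormedAddCommGroup F] [NormedSpace ℂ F] {a : E3 → ℝ}
    (ha : ContinuousOn a P.Ω) {C : ℝ} (hC : ∀ x ∈ P.Ω, |a x| ≤ C) :
    ∃ L : Lp F 2 P.μ →L[ℂ] Lp F 2 P.μ,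
      ∀ f, L f =ᵐ[volume.restrict P.Ω] fun x => (a x : ℂ) • f x := by
  obtain ⟨L, hL⟩ := exists_clm_of_pointwise (m := P.μ) (C := C)
    (fun x => (a x : ℂ) • (LinearMap.id : F →ₗ[ℂ] F))
    (fun f => (P.aestronglyMeasurable_of_continuousOn
      (Complex.continuous_ofReal.comp_continuousOn ha)).fun_smul (Lp.aestronglyMeasurable f))
    (by
      rw [P.ae_iff]
      filter_upwards [P.ae_mem] with x hx v
      simp only [LinearMap.smul_apply, LinearMap.id_apply, norm_smul, Complex.norm_real]
      exact mul_le_mul_of_nonneg_right (hC x hx) (norm_nonneg _))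
  exact ⟨L, fun f => P.aeEq_of_aeEq (hL f)⟩

theorem exists_smulField_clm {v : E3 → E3} (hv : ContinuousOn v P.Ω) {C : ℝ}
    (hC : ∀ x ∈ P.Ω, ‖v x‖ ≤ C) :
    ∃ L : P.L2 →L[ℂ] P.H, ∀ f, L f =ᵐ[volume.restrict P.Ω] fun x => f x • toC3 (v x) := by
  obtain ⟨L, hL⟩ := exists_clm_of_pointwise (m := P.μ) (C := C)
    (fun x => LinearMap.toSpanSingleton ℂ C3 (toC3 (v x)))
    (fun f => (Lp.aestronglyMeasurable f).fun_smul (P.aestronglyMeasurable_of_continuousOn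
      (continuous_toC3.comp_continuousOn hv)))
    (by
      rw [P.ae_iff]
      filter_upwards [P.ae_mem] with x hx k
      rw [LinearMap.toSpanSingleton_apply, norm_smul, norm_toC3, mul_comm]
      exact mul_le_mul_of_nonneg_right (hC x hx) (norm_nonneg _))
  exact ⟨L, fun f => P.aeEq_of_aeEq (hL f)⟩

theorem exists_dotField_clm {v : E3 → E3} (hv : ContinuousOn v P.Ω) {C : ℝ}
    (hC : ∀ x ∈ P.Ω, ‖v x‖ ≤ C) :
    ∃ L : P.H →L[ℂ] P.L2, ∀ f, L f =ᵐ[volume.restrict P.Ω] fun x => cdot (toC3 (v x)) (f x) := by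
  obtain ⟨L, hL⟩ := exists_clm_of_pointwise (m := P.μ) (C := C)
    (fun x =>
      { toFun := fun w => cdot (toC3 (v x)) w
        map_add' := fun w w' => cdot_add_right _ _ _
        map_smul' := fun k w => cdot_smul_right _ _ _ })
    (fun f => aestronglyMeasurable_cdot (P.aestronglyMeasurable_of_continuousOn
      (continuous_toC3.comp_continuousOn hv)) (Lp.aestronglyMeasurable f))
    (by
      rw [P.ae_iff]
      filter_upwards [P.ae_mem] with x hx w
      refine (norm_cdot_le _ _).trans ?_
      rw [norm_toC3]
      exact mul_le_mul_of_nonneg_right (hC x hx) (norm_nonneg _))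
  exact ⟨L, fun f => P.aeEq_of_aeEq (hL f)⟩

theorem exists_ofVolume (F : Type) [NormedAddCommGroup F] [NormedSpace ℂ F] :
    ∃ L : Lp F 2 (volume.restrict P.Ω) →L[ℂ] Lp F 2 P.μ,
      ∀ f, L f =ᵐ[volume.restrict P.Ω] f := by
  obtain ⟨C, -, hC⟩ := P.exists_norm_le
  have hmem : ∀ f : Lp F 2 (volume.restrict P.Ω), MemLp f 2 P.μ := fun f =>
    memLp_iff.2 (Lp.memLp f)
  let L : Lp F 2 (volume.restrict P.Ω) →ₗ[ℂ] Lp F 2 P.μ :=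
    { toFun := fun f => (hmem f).toLp _
      map_add' := fun f g => by
        rw [← MemLp.toLp_add]
        exact MemLp.toLp_congr _ _ (P.ae_iff.2 (Lp.coeFn_add f g))
      map_smul' := fun k f => by
        rw [RingHom.id_apply, ← MemLp.toLp_const_smul]
        exact MemLp.toLp_congr _ _ (P.ae_iff.2 (Lp.coeFn_smul k f)) }
  refine ⟨L.mkContinuous C fun f => ?_, fun f => P.aeEq_of_aeEq (hmem f).coeFn_toLp⟩
  change ‖(hmem f).toLp f‖ ≤ _
  rw [Lp.norm_toLp]
  exact (hC (Lp.memLp f)).1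

/-! ### The embedding of `H¹(M)`, the differential operators on it, and the a priori estimate -/

/-- The identity map from `L²(dx)` to `L²(ρ₀ dx)`. -/
noncomputable def ofVolume (F : Type) [NormedAddCommGroup F] [NormedSpace ℂ F] :
    Lp F 2 (volume.restrict P.Ω) →L[ℂ] Lp F 2 P.μ := (P.exists_ofVolume F).choose

theorem ofVolume_ae {F : Type} [NormedAddCommGroup F] [NormedSpace ℂ F]
    (f : Lp F 2 (volume.restrict P.Ω)) : P.ofVolume F f =ᵐ[volume.restrict P.Ω] f :=
  (P.exists_ofVolume F).choose_spec f

theorem ext_ae {F : Type*} [NormedAddCommGroup F] {f g : Lp F 2 P.μ}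
    (h : f =ᵐ[volume.restrict P.Ω] g) : f = g := Lp.ext (P.ae_iff.2 h)

/-- The embedding of `H¹(M)` into `L²(ρ₀ dx)`. -/
noncomputable def embed : H1 P.M →L[ℂ] P.L2 := (P.ofVolume ℂ).comp (H1.toL2 P.M)

theorem embed_ae (φ : H1 P.M) : P.embed φ =ᵐ[volume.restrict P.Ω] φ.1.fst := P.ofVolume_ae _

theorem sameFunction_iff (p : P.L2) (φ : H1 P.M) : P.SameFunction p φ ↔ p = P.embed φ :=
  ⟨fun h => P.ext_ae (h.trans (P.embed_ae φ).symm), fun h => by rw [h]; exact P.embed_ae φ⟩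

theorem isCompactOperator_embed : IsCompactOperator P.embed :=
  (H1.isCompactOperator_toL2 P.isCompact P.smoothBoundary).clm_comp (P.ofVolume ℂ)

/-- The embedding of the gradients of the elements of `H¹(M)` into `H`. -/
noncomputable def embedGrad : H1 P.M →L[ℂ] P.H :=
  (P.ofVolume C3).comp ((WithLp.sndL 2 ℂ _ _).comp (H1 P.M).subtypeL)

theorem embedGrad_ae (φ : H1 P.M) : P.embedGrad φ =ᵐ[volume.restrict P.Ω] φ.1.snd :=
  P.ofVolume_ae _

variable {P} in
/-- Multiplication by `a`. -/
noncomputable def mulClm {a : E3 → ℝ} (ha : IsMultiplier P.Ω a) (F : Type) [NormedAddCommGroup F]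
    [NormedSpace ℂ F] : Lp F 2 P.μ →L[ℂ] Lp F 2 P.μ :=
  (P.exists_mul_clm F ha.contDiffOn.continuousOn ha.bounded.choose_spec).choose

variable {P} in
theorem mulClm_ae {a : E3 → ℝ} (ha : IsMultiplier P.Ω a) {F : Type} [NormedAddCommGroup F]
    [NormedSpace ℂ F] (f : Lp F 2 P.μ) :
    mulClm ha F f =ᵐ[volume.restrict P.Ω] fun x => (a x : ℂ) • f x :=
  (P.exists_mul_clm F ha.contDiffOn.continuousOn ha.bounded.choose_spec).choose_spec f

/-- The map `φ ↦ (∇ρ₀ + s̃) φ`. -/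
noncomputable def smulLower : P.L2 →L[ℂ] P.H :=
  (P.exists_smulField_clm P.lower_continuousOn P.exists_lower_le.choose_spec).choose

theorem smulLower_ae (f : P.L2) :
    P.smulLower f =ᵐ[volume.restrict P.Ω] fun x => f x • toC3 (P.lower x) :=
  (P.exists_smulField_clm P.lower_continuousOn P.exists_lower_le.choose_spec).choose_spec f

/-- The map `u ↦ b · u`. -/
noncomputable def dotDrift : P.H →L[ℂ] P.L2 :=
  (P.exists_dotField_clm (P.drift_continuousOn.mono interior_subset)
    P.exists_drift_le.choose_spec).choose

theorem dotDrift_ae (u : P.H) :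
    P.dotDrift u =ᵐ[volume.restrict P.Ω] fun x => cdot (toC3 (P.drift x)) (u x) :=
  (P.exists_dotField_clm (P.drift_continuousOn.mono interior_subset)
    P.exists_drift_le.choose_spec).choose_spec u

/-- The operator `φ ↦ -(∇(ρ₀ φ) + s̃ φ) = -(ρ₀ ∇φ + (∇ρ₀ + s̃) φ)` on `H¹(M)`. -/
noncomputable def tstar : H1 P.M →L[ℂ] P.H :=
  -((mulClm P.isMultiplier_ρ C3).comp P.embedGrad + P.smulLower.comp P.embed)

theorem tstar_apply (φ : H1 P.M) : P.tstar φ =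
    -(mulClm P.isMultiplier_ρ C3 (P.embedGrad φ) + P.smulLower (P.embed φ)) := rfl

theorem tstar_ae (φ : H1 P.M) : P.tstar φ =ᵐ[volume.restrict P.Ω]
    fun x => -((P.ρ x : ℂ) • φ.1.snd x + φ.1.fst x • toC3 (P.lower x)) := by
  rw [tstar_apply]
  filter_upwards [P.aeEq_of_aeEq (Lp.coeFn_neg
      (mulClm P.isMultiplier_ρ C3 (P.embedGrad φ) + P.smulLower (P.embed φ))),
    P.aeEq_of_aeEq (Lp.coeFn_add (mulClm P.isMultiplier_ρ C3 (P.embedGrad φ))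
      (P.smulLower (P.embed φ))), mulClm_ae P.isMultiplier_ρ (P.embedGrad φ),
    P.smulLower_ae (P.embed φ), P.embed_ae φ, P.embedGrad_ae φ] with x h1 h2 h3 h4 h5 h6
  simp only [h1, Pi.neg_apply, h2, Pi.add_apply, h3, h4, h5, h6]

/-- The operator `(u, ∇ · u) ↦ ∇ · (ρ₀ u) - s̃ · u = ρ₀ ∇ · u + b · u`. -/
noncomputable def tmap : WithLp 2 (P.H × P.L2) →L[ℂ] P.L2 :=
  (mulClm P.isMultiplier_ρ ℂ).comp (WithLp.sndL 2 ℂ P.H P.L2) +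
    P.dotDrift.comp (WithLp.fstL 2 ℂ P.H P.L2)

theorem tmap_apply (w : WithLp 2 (P.H × P.L2)) :
    P.tmap w = mulClm P.isMultiplier_ρ ℂ w.snd + P.dotDrift w.fst := rfl

theorem tmap_ae (w : WithLp 2 (P.H × P.L2)) : P.tmap w =ᵐ[volume.restrict P.Ω]
    fun x => (P.ρ x : ℂ) * w.snd x + cdot (toC3 (P.drift x)) (w.fst x) := by
  rw [tmap_apply]
  filter_upwards [P.aeEq_of_aeEq (Lp.coeFn_add (mulClm P.isMultiplier_ρ ℂ w.snd)
    (P.dotDrift w.fst)), mulClm_ae P.isMultiplier_ρ w.snd, P.dotDrift_ae w.fst] with x h1 h2 h3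
  rw [h1, Pi.add_apply, h2, h3, smul_eq_mul]

/-- Solves the formula for `T*φ` for the gradient: since `ρ₀` is invertible, the full gradient is
recovered from `T*φ` and `φ`. This is the source of the a priori estimate. -/
theorem embedGrad_eq (φ : H1 P.M) : P.embedGrad φ =
    -mulClm P.isMultiplier_inv C3 (P.tstar φ + P.smulLower (P.embed φ)) := by
  refine P.ext_ae ?_
  filter_upwards [P.aeEq_of_aeEq (Lp.coeFn_neg
      (mulClm P.isMultiplier_inv C3 (P.tstar φ + P.smulLower (P.embed φ)))),
    P.aeEq_of_aeEq (Lp.coeFn_add (P.tstar φ) (P.smulLower (P.embed φ))),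
    mulClm_ae P.isMultiplier_inv (P.tstar φ + P.smulLower (P.embed φ)),
    P.smulLower_ae (P.embed φ), P.embed_ae φ, P.embedGrad_ae φ, P.tstar_ae φ, P.ae_mem]
    with x h1 h2 h3 h4 h5 h6 h7 hx
  have h0 : (P.ρ x : ℂ) ≠ 0 := by exact_mod_cast P.ρ_ne_zero hx
  simp only [h1, Pi.neg_apply, h3, h2, Pi.add_apply, h4, h5, h6, h7, neg_add,
    neg_add_cancel_right, smul_neg, neg_neg, smul_smul, Complex.ofReal_inv, inv_mul_cancel₀ h0,
    one_smul]

theorem exists_norm_le_embed : ∃ C : ℝ, 0 < C ∧ ∀ φ : H1 P.M,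
    ‖φ.1.fst‖ ≤ C * ‖P.embed φ‖ ∧ ‖φ.1.snd‖ ≤ C * ‖P.embedGrad φ‖ := by
  refine P.exists_norm_le.imp fun C hC => ⟨hC.1, fun φ => ⟨?_, ?_⟩⟩
  · have h := (hC.2 (Lp.memLp φ.1.fst)).2
    rwa [← eLpNorm_congr_ae (P.ae_iff.2 (P.embed_ae φ))] at h
  · have h := (hC.2 (Lp.memLp φ.1.snd)).2
    rwa [← eLpNorm_congr_ae (P.ae_iff.2 (P.embedGrad_ae φ))] at h

theorem H1_norm_le (φ : H1 P.M) : ‖φ‖ ≤ ‖φ.1.fst‖ + ‖φ.1.snd‖ := by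
  refine (abs_le_of_sq_le_sq' ?_ (by positivity)).2
  rw [H1.norm_sq]
  nlinarith [norm_nonneg φ.1.fst, norm_nonneg φ.1.snd]

/-- The a priori estimate for `T*`. -/
theorem exists_norm_le_tstar : ∃ C, ∀ φ : H1 P.M, ‖φ‖ ≤ C * (‖P.tstar φ‖ + ‖P.embed φ‖) := by
  refine P.exists_norm_le_embed.elim fun C hC => ⟨C * (1 + ‖mulClm P.isMultiplier_inv C3‖ +
    ‖mulClm P.isMultiplier_inv C3‖ * ‖P.smulLower‖), fun φ => ?_⟩
  have h2 : ‖P.embedGrad φ‖ ≤ ‖mulClm P.isMultiplier_inv C3‖ *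
      (‖P.tstar φ‖ + ‖P.smulLower‖ * ‖P.embed φ‖) := by
    rw [embedGrad_eq]
    refine (norm_neg (E := P.H) _).le.trans ?_
    refine (ContinuousLinearMap.le_opNorm _ _).trans ?_
    refine mul_le_mul_of_nonneg_left ?_ (norm_nonneg _)
    exact (norm_add_le _ _).trans (add_le_add_right (P.smulLower.le_opNorm _) _)
  have h1 := (P.H1_norm_le φ).trans (add_le_add (hC.2 φ).1
    ((hC.2 φ).2.trans (mul_le_mul_of_nonneg_left h2 hC.1.le)))
  have aux : ∀ {a b l l' : ℝ}, 0 ≤ a → 0 ≤ b → 0 ≤ l → 0 ≤ l' →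
      C * b + C * (l * (a + l' * b)) ≤ C * (1 + l + l * l') * (a + b) := by
    intro a b l l' ha hb hl hl'
    have h0 := hC.1
    have h7 : 0 ≤ C * (a + l * b + l * l' * a) := by positivity
    nlinarith
  exact h1.trans (aux (norm_nonneg _) (norm_nonneg _) (norm_nonneg _) (norm_nonneg _))

end GasPlanet

/-! ### The operator `T` and its adjoint -/

theorem integrable_cdot {m : Measure E3} {f g : E3 → C3} (hf : MemLp f 2 m) (hg : MemLp g 2 m) :
    Integrable (fun x => cdot (f x) (g x)) m := by
  refine (hf.norm.integrable_mul hg.norm).mono' (aestronglyMeasurable_cdot hf.1 hg.1) ?_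
  exact ae_of_all _ fun x => norm_cdot_le _ _

theorem cdot_comm (a b : C3) : cdot a b = cdot b a := by
  simp only [cdot, mul_comm]

theorem IsWeakDiv.unique {Ω : Set E3} (hΩ : IsOpen Ω) {u : E3 → C3} {d d' : E3 → ℂ}
    (h : IsWeakDiv Ω u d) (h' : IsWeakDiv Ω u d') : d =ᵐ[volume.restrict Ω] d' := by
  have h1 := hΩ.ae_eq_zero_of_integral_contDiff_smul_eq_zero (h.locInt_right.sub h'.locInt_right)
    (fun ψ h1 h2 h3 => by
      have hψ : IsTestFunction Ω ψ := ⟨h1, h2, h3⟩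
      rw [← setIntegral_eq_integral_of_forall_compl_eq_zero (s := Ω) fun x hx => by
        rw [image_eq_zero_of_notMem_tsupport fun h => hx (h3 h), zero_smul]]
      simp only [Pi.sub_apply, smul_sub]
      rw [integral_sub (hψ.integrableOn_smul h.2) (hψ.integrableOn_smul h'.2), sub_eq_zero]
      exact neg_injective ((h.eq ψ hψ).symm.trans (h'.eq ψ hψ)))
  filter_upwards [(ae_restrict_iff' hΩ.measurableSet).2 h1] with x hx
  exact sub_eq_zero.1 hx

namespace GasPlanet

variable (P : GasPlanet)

theorem integrable_trace (w : WithLp 2 (P.H × P.L2)) (χ : H1 P.M) :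
    Integrable (fun x => cdot (w.fst x) (χ.1.snd x) + w.snd x * χ.1.fst x)
      (volume.restrict P.Ω) :=
  (integrable_cdot (P.memLp_volume w.fst) (Lp.memLp χ.1.snd)).add
    ((P.memLp_volume w.snd).integrable_mul (Lp.memLp χ.1.fst))

/-- The boundary condition alone implies that `w.snd` is the divergence of `w.fst`. -/
theorem mem_HDivZero_of_forall {w : WithLp 2 (P.H × P.L2)}
    (h : ∀ χ : H1 P.M,
      ∫ x in P.Ω, (cdot (w.fst x) (χ.1.snd x) + w.snd x * χ.1.fst x) = 0) :
    w ∈ P.HDivZero := by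
  have m1 := P.memLp_volume w.fst
  have m2 := P.memLp_volume w.snd
  refine ⟨⟨locallyIntegrableOn_of_memLp isOpen_interior m1,
    locallyIntegrableOn_of_memLp isOpen_interior m2, fun ψ hψ => ?_⟩,
    fun χ => ⟨P.integrable_trace w χ, h χ⟩⟩
  -- Test functions belong to `H¹(M)`, so the weak divergence identity is a special case of the
  -- trace condition.
  refine hψ.exists_H1.elim fun χ hχ => ?_
  have h1 := h χ
  have e : ∫ x in P.Ω, (cdot (w.fst x) (χ.1.snd x) + w.snd x * χ.1.fst x) =
      ∫ x in P.Ω, (cdot (toC3 (gradient ψ x)) (w.fst x) + ψ x • w.snd x) := by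
    refine integral_congr_ae ?_
    filter_upwards [hχ.1, hχ.2] with x h2 h3
    simp only [h2, h3, cdot_comm (w.fst x), Complex.real_smul, mul_comm]
  have i1 := hψ.integrableOn_cdot (locallyIntegrableOn_of_memLp isOpen_interior m1)
  have i2 := hψ.integrableOn_smul (locallyIntegrableOn_of_memLp isOpen_interior m2)
  refine eq_neg_of_add_eq_zero_left ?_
  rw [← integral_add i1 i2]
  exact e.symm.trans h1

/-- Integration by parts. -/
theorem inner_tstar {w : WithLp 2 (P.H × P.L2)} (hw : w ∈ P.HDivZero) (φ : H1 P.M) :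
    ⟪P.tstar φ, w.fst⟫_ℂ = ⟪P.embed φ, P.tmap w⟫_ℂ := by
  -- One factor `ρ₀` comes from the measure and one from the operator; the conjugate appears because
  -- the trace pairing is bilinear while the inner product is sesquilinear.
  refine (P.isMultiplier_sq.exists_H1_conj_mul φ).elim fun χ hχ => ?_
  rw [eq_comm, ← sub_eq_zero, P.inner_eq, P.inner_eq,
    ← integral_sub (P.integrable_inner _ _) (P.integrable_inner _ _)]
  refine Eq.trans (integral_congr_ae ?_) (hw.2 χ).2
  filter_upwards [hχ.1, hχ.2, P.embed_ae φ, P.tstar_ae φ, P.tmap_ae w, P.ae_mem]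
    with x h1 h2 h3 h4 h5 hx
  simp only [h1, h2, h3, h4, h5, P.gradient_sq hx, lower]
  simp only [inner_eq_cdot, cdot, Fin.sum_univ_three, RCLike.inner_apply, conj3_apply,
    PiLp.neg_apply, PiLp.add_apply, PiLp.sub_apply, PiLp.smul_apply, toC3_apply, smul_eq_mul,
    map_neg, map_add, map_sub, map_mul, map_ofNat, Complex.conj_ofReal, Complex.ofReal_mul, Complex.ofReal_sub,
    Complex.ofReal_ofNat]
  ring

/-- The orthogonal complement of the range of `T*` is the kernel of `T`. -/
theorem exists_mem_HDivZero_of_inner_eq_zero {u : P.H}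
    (hu : ∀ φ, ⟪P.tstar φ, u⟫_ℂ = 0) :
    ∃ d : P.L2, WithLp.toLp 2 (u, d) ∈ P.HDivZero ∧ P.tmap (WithLp.toLp 2 (u, d)) = 0 := by
  -- The divergence is forced: `ρ₀ d + b · u = 0`.
  have hd : -mulClm P.isMultiplier_inv ℂ (P.dotDrift u) =ᵐ[volume.restrict P.Ω]
      fun x => -(((P.ρ x)⁻¹ : ℝ) * cdot (toC3 (P.drift x)) (u x) : ℂ) := by
    filter_upwards [P.aeEq_of_aeEq (Lp.coeFn_neg (mulClm P.isMultiplier_inv ℂ (P.dotDrift u))),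
      mulClm_ae P.isMultiplier_inv (P.dotDrift u), P.dotDrift_ae u] with x h1 h2 h3
    simp only [h1, Pi.neg_apply, h2, h3, smul_eq_mul]
  refine ⟨-mulClm P.isMultiplier_inv ℂ (P.dotDrift u), P.mem_HDivZero_of_forall fun χ => ?_,
    P.ext_ae ?_⟩
  -- The factor `ρ₀⁻²` reverses the substitution in `inner_tstar`, so orthogonality to `T*φ` becomes
  -- the trace condition against `χ`.
  · refine (P.isMultiplier_inv_sq.exists_H1_conj_mul χ).elim fun φ hφ => ?_
    have h0 := hu φ
    rw [P.inner_eq, ← neg_eq_zero, ← integral_neg] at h0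
    refine Eq.trans (integral_congr_ae ?_) h0
    filter_upwards [hφ.1, hφ.2, P.tstar_ae φ, hd, P.ae_mem] with x h1 h2 h3 h4 hx
    have hρ : (P.ρ x : ℂ) ≠ 0 := by exact_mod_cast P.ρ_ne_zero hx
    simp only [WithLp.toLp_fst, WithLp.toLp_snd]
    simp only [h1, h2, h3, h4, P.gradient_inv_sq hx, lower]
    simp only [inner_eq_cdot, cdot, Fin.sum_univ_three, conj3_apply,
      PiLp.neg_apply, PiLp.add_apply, PiLp.sub_apply, PiLp.smul_apply, toC3_apply, smul_eq_mul,
      map_neg, map_add, map_sub, map_mul, map_ofNat, Complex.conj_ofReal, Complex.ofReal_mul, Complex.ofReal_sub,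
      Complex.ofReal_ofNat, Complex.ofReal_inv, Complex.ofReal_neg, Complex.conj_conj]
    field_simp
    ring
  · filter_upwards [P.tmap_ae (WithLp.toLp 2 (u, -mulClm P.isMultiplier_inv ℂ (P.dotDrift u))), hd,
      P.aeEq_of_aeEq (Lp.coeFn_zero ℂ 2 P.μ), P.ae_mem] with x h1 h2 h3 hx
    have hρ : (P.ρ x : ℂ) ≠ 0 := by exact_mod_cast P.ρ_ne_zero hx
    simp only [WithLp.toLp_fst, WithLp.toLp_snd] at h1
    simp only [h1, h2, h3, Pi.zero_apply, Complex.ofReal_inv]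
    field_simp
    ring

/-- In `∇·(ρ₀ u) - s̃·u` the terms with `∇ρ₀` cancel and `ρ₀ ∇·u + b·u` remains. -/
theorem mem_graphT {w : WithLp 2 (P.H × P.L2)} (hw : w ∈ P.HDivZero) :
    (w.fst, P.tmap w) ∈ P.graphT := by
  refine ⟨⟨w.snd, hw⟩, ?_⟩
  have h : IsWeakDiv P.Ω w.fst w.snd := hw.1
  refine (h.mul isOpen_interior P.isMultiplier_ρ.contDiffOn).congr isOpen_interior
    (Filter.EventuallyEq.rfl) ?_
  filter_upwards [P.tmap_ae w, P.ae_mem] with x h1 hx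
  simp only [h1, P.sTilde_eq hx, toC3_sub]
  simp only [cdot, Fin.sum_univ_three, PiLp.sub_apply]
  ring

theorem mem_domain_iff (u : P.H) :
    u ∈ P.T.domain ↔ ∃ d : P.L2, WithLp.toLp 2 (u, d) ∈ P.HDivZero := by
  constructor
  · intro hu
    have h : (u, P.T ⟨u, hu⟩) ∈ P.T.graph := P.T.mem_graph ⟨u, hu⟩
    rw [P.T_graph] at h
    exact h.1
  · rintro ⟨d, hd⟩
    have h : (u, P.tmap (WithLp.toLp 2 (u, d))) ∈ P.T.graph := by
      rw [P.T_graph]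
      exact P.mem_graphT hd
    exact LinearPMap.mem_domain_of_mem_graph h

theorem T_apply {u : P.H} {d : P.L2} (hd : WithLp.toLp 2 (u, d) ∈ P.HDivZero)
    (hu : u ∈ P.T.domain) : P.T ⟨u, hu⟩ = P.tmap (WithLp.toLp 2 (u, d)) := by
  have h : (u, P.tmap (WithLp.toLp 2 (u, d))) ∈ P.T.graph := by
    rw [P.T_graph]
    exact P.mem_graphT hd
  exact LinearPMap.mem_graph_snd_inj _ (P.T.mem_graph ⟨u, hu⟩) h rfl

/-! ### Test fields, density of the domain, and the domain of the adjoint -/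

/-- The fields `ψ eᵢ` with a test function `ψ` are in the domain of `T`. -/
theorem exists_test_field {ψ : E3 → ℝ} (hψ : IsTestFunction P.Ω ψ) (i : Fin 3) :
    ∃ w ∈ P.HDivZero, w.fst =ᵐ[volume.restrict P.Ω]
        (fun x => (ψ x : ℂ) • EuclideanSpace.single i (1 : ℂ)) ∧
      w.snd =ᵐ[volume.restrict P.Ω] fun x => (gradient ψ x i : ℂ) := by
  have m1 : MemLp (fun x => (ψ x : ℂ) • EuclideanSpace.single i (1 : ℂ)) 2 P.μ :=
    memLp_iff.2 (hψ.memLp_field _ i)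
  have m2 : MemLp (fun x => (gradient ψ x i : ℂ)) 2 P.μ :=
    memLp_iff.2 (hψ.memLp_gradient _ i).ofReal
  have e1 := P.aeEq_of_aeEq m1.coeFn_toLp
  have e2 := P.aeEq_of_aeEq m2.coeFn_toLp
  refine ⟨WithLp.toLp 2 (m1.toLp, m2.toLp), P.mem_HDivZero_of_forall fun χ => ?_, e1, e2⟩
  have hχ : IsWeakGrad P.Ω χ.1.fst χ.1.snd := χ.2
  have h := hχ.integral_partial hψ i
  have i1 : Integrable (fun x => gradient ψ x i • χ.1.fst x) (volume.restrict P.Ω) :=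
    locInt_integrableOn_smul hχ.1 (hψ.gradient_apply i).1 (hψ.gradient_apply i).2.1
      (hψ.gradient_apply i).2.2
  have i2 : Integrable (fun x => ψ x • χ.1.snd x i) (volume.restrict P.Ω) :=
    hψ.integrableOn_smul (locInt_apply hχ.2 i)
  rw [← sub_eq_zero, sub_neg_eq_add, ← integral_add i1 i2] at h
  refine Eq.trans (integral_congr_ae ?_) h
  filter_upwards [e1, e2] with x h1 h2
  simp only [WithLp.toLp_fst, WithLp.toLp_snd]
  simp only [h1, h2]
  rw [cdot_comm, cdot_single, Complex.real_smul, Complex.real_smul]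
  ring

/-- A vector orthogonal to all fields `ψ eᵢ` satisfies `ρ₀ vᵢ = 0` by the fundamental lemma, hence
vanishes. -/
theorem dense_domain : Dense (P.T.domain : Set P.H) := by
  rw [Submodule.dense_iff_topologicalClosure_eq_top, Submodule.topologicalClosure_eq_top_iff,
    Submodule.eq_bot_iff]
  intro v hv
  have hz : ∀ i : Fin 3, ∀ᵐ x ∂volume.restrict P.Ω, (P.ρ x : ℂ) * v x i = 0 := by
    intro i
    have hli : LocallyIntegrableOn (fun x => (P.ρ x : ℂ) * v x i) P.Ω := by
      have := (locInt_apply (locallyIntegrableOn_of_memLp isOpen_interior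
        (P.memLp_volume v)) i).continuousOn_smul isOpen_interior.isLocallyClosed
        P.isMultiplier_ρ.contDiffOn.continuousOn
      simpa using this
    have h1 := isOpen_interior.ae_eq_zero_of_integral_contDiff_smul_eq_zero hli
      (fun ψ h1 h2 h3 => by
        have hψ : IsTestFunction P.Ω ψ := ⟨h1, h2, h3⟩
        refine (P.exists_test_field hψ i).elim fun w hw => ?_
        have hwd : w.fst ∈ P.T.domain := (P.mem_domain_iff _).2 ⟨w.snd, hw.1⟩
        have h4 := Submodule.inner_right_of_mem_orthogonal hwd hv
        rw [P.inner_eq] at h4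
        rw [← setIntegral_eq_integral_of_forall_compl_eq_zero (s := P.Ω) fun x hx => by
          rw [image_eq_zero_of_notMem_tsupport fun h => hx (h3 h), zero_smul]]
        refine Eq.trans (integral_congr_ae ?_) h4
        filter_upwards [hw.2.1] with x hx
        simp only [hx, inner_real_smul_single, Complex.real_smul]
        ring)
    exact (ae_restrict_iff' isOpen_interior.measurableSet).2 h1
  refine P.ext_ae ?_
  filter_upwards [hz 0, hz 1, hz 2, P.aeEq_of_aeEq (Lp.coeFn_zero C3 2 P.μ), P.ae_mem]
    with x h0 h1 h2 h3 hx
  have hρ : (P.ρ x : ℂ) ≠ 0 := by exact_mod_cast P.ρ_ne_zero hx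
  rw [h3]
  ext i
  fin_cases i
  · exact (mul_eq_zero.1 h0).resolve_left hρ
  · exact (mul_eq_zero.1 h1).resolve_left hρ
  · exact (mul_eq_zero.1 h2).resolve_left hρ

theorem inner_tstar_T (φ : H1 P.M) (u : P.T.domain) :
    ⟪P.tstar φ, (u : P.H)⟫_ℂ = ⟪P.embed φ, P.T u⟫_ℂ := by
  refine ((P.mem_domain_iff _).1 u.2).elim fun d hd => ?_
  have h := P.T_apply hd u.2
  rw [Subtype.coe_eta] at h
  rw [h]
  exact P.inner_tstar hd φ

theorem embed_mem_adjoint_domain (φ : H1 P.M) : P.embed φ ∈ P.T†.domain :=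
  LinearPMap.mem_adjoint_domain_of_exists _ ⟨P.tstar φ, P.inner_tstar_T φ⟩

theorem adjoint_apply (φ : H1 P.M) (h : P.embed φ ∈ P.T†.domain) :
    P.T† ⟨P.embed φ, h⟩ = P.tstar φ :=
  LinearPMap.adjoint_apply_eq P.dense_domain _ (P.inner_tstar_T φ)

/-- Inserting `u = ψ eᵢ`, for which `T u = ρ₀ ∂ᵢψ + bᵢ ψ`, and conjugating, one reads off `∇(ρ₀² q)
= ρ₀ (q b - v)`. So `ρ₀² q` is in `H¹(M)`, and it remains to divide by `ρ₀²`. -/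
theorem exists_eq_embed_of_inner {q : P.L2} {v : P.H}
    (hadj : ∀ u : P.T.domain, ⟪v, (u : P.H)⟫_ℂ = ⟪q, P.T u⟫_ℂ) :
    ∃ φ : H1 P.M, q = P.embed φ := by
  have mq := P.memLp_volume q
  have mv := P.memLp_volume v
  have hsm : ∀ {F : Type} [NormedAddCommGroup F] [NormedSpace ℂ F] {f : E3 → F} {a : E3 → ℝ},
      IsMultiplier P.Ω a → MemLp f 2 (volume.restrict P.Ω) →
      MemLp (fun x => (a x : ℂ) • f x) 2 (volume.restrict P.Ω) := by
    intro F _ _ f a ha hf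
    refine ha.bounded.elim fun C hC => ?_
    simpa only [Complex.coe_smul] using
      MemLp.bounded_smul isOpen_interior hf ha.contDiffOn.continuousOn hC
  have mqb : MemLp (fun x => q x • toC3 (P.drift x)) 2 (volume.restrict P.Ω) :=
    P.exists_drift_le.elim fun C hC =>
      MemLp.smul_toC3 isOpen_interior mq (P.drift_continuousOn.mono interior_subset) hC
  have mG : MemLp (fun x => (P.ρ x : ℂ) • (q x • toC3 (P.drift x) - v x)) 2
      (volume.restrict P.Ω) := hsm P.isMultiplier_ρ (mqb.sub mv)
  have mφ : MemLp (fun x => ((P.ρ x * P.ρ x : ℝ) : ℂ) * q x) 2 (volume.restrict P.Ω) :=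
    hsm P.isMultiplier_sq mq
  have hw : IsWeakGrad P.Ω (fun x => ((P.ρ x * P.ρ x : ℝ) : ℂ) * q x)
      (fun x => (P.ρ x : ℂ) • (q x • toC3 (P.drift x) - v x)) := by
    refine isWeakGrad_of_forall (locallyIntegrableOn_of_memLp isOpen_interior mφ)
      (locallyIntegrableOn_of_memLp isOpen_interior mG) fun ψ hψ i => ?_
    refine (P.exists_test_field hψ i).elim fun w hw => ?_
    have hwd : w.fst ∈ P.T.domain := (P.mem_domain_iff _).2 ⟨w.snd, hw.1⟩
    have h : ⟪v, w.fst⟫_ℂ = ⟪q, P.tmap w⟫_ℂ :=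
      (hadj ⟨w.fst, hwd⟩).trans (congrArg (inner ℂ q) (P.T_apply (d := w.snd) hw.1 hwd))
    rw [← sub_eq_zero, P.inner_eq, P.inner_eq,
      ← integral_sub (P.integrable_inner _ _) (P.integrable_inner _ _)] at h
    have i1 : Integrable (fun x => gradient ψ x i • (((P.ρ x * P.ρ x : ℝ) : ℂ) * q x))
        (volume.restrict P.Ω) :=
      locInt_integrableOn_smul (locallyIntegrableOn_of_memLp isOpen_interior mφ)
        (hψ.gradient_apply i).1 (hψ.gradient_apply i).2.1 (hψ.gradient_apply i).2.2
    have i2 : Integrable (fun x => ψ x • ((P.ρ x : ℂ) • (q x • toC3 (P.drift x) - v x)) i)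
        (volume.restrict P.Ω) :=
      hψ.integrableOn_smul (locInt_apply (locallyIntegrableOn_of_memLp isOpen_interior mG) i)
    rw [← sub_eq_zero, sub_neg_eq_add, ← integral_add i1 i2, ← neg_eq_zero, ← integral_neg]
    have h' := congrArg (starRingEnd ℂ) h
    rw [← integral_conj, map_zero] at h'
    refine Eq.trans (integral_congr_ae ?_) h'
    filter_upwards [hw.2.1, hw.2.2, P.tmap_ae w] with x h1 h2 h3
    change _ = (starRingEnd ℂ) ((P.ρ x : ℂ) * ⟪v x, w.fst x⟫_ℂ -
      (P.ρ x : ℂ) * ⟪q x, P.tmap w x⟫_ℂ)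
    simp only [h3]
    simp only [h1, h2, inner_eq_cdot, cdot_single, conj3_apply, RCLike.inner_apply, map_sub,
      map_mul, map_add, Complex.conj_ofReal, Complex.conj_conj, PiLp.smul_apply, PiLp.sub_apply,
      toC3_apply, smul_eq_mul, Complex.real_smul, Complex.ofReal_mul]
    ring
  refine (exists_H1 hw mφ mG).elim fun φ₀ h₀ => ?_
  -- Division by `ρ₀` is done twice: each step also conjugates, and the two conjugations cancel.
  refine (P.isMultiplier_inv.exists_H1_conj_mul φ₀).elim fun φ₁ h₁ => ?_
  refine (P.isMultiplier_inv.exists_H1_conj_mul φ₁).imp fun φ₂ h₂ => ?_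
  rw [← P.sameFunction_iff]
  filter_upwards [h₀.1, h₁.1, h₂.1, P.ae_mem] with x e0 e1 e2 hx
  have hρ : (P.ρ x : ℂ) ≠ 0 := by exact_mod_cast P.ρ_ne_zero hx
  simp only [e2, e1, e0, map_mul, map_inv₀, Complex.conj_ofReal, Complex.conj_conj, Complex.ofReal_inv,
    Complex.ofReal_mul]
  field_simp

/-- Elements of the domain of `T*` are in `H¹(M)`. -/
theorem exists_eq_embed (p : P.T†.domain) : ∃ φ : H1 P.M, (p : P.L2) = P.embed φ :=
  P.exists_eq_embed_of_inner fun u => LinearPMap.adjoint_isFormalAdjoint P.dense_domain p u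

end GasPlanet

/-! ### The range of `T*` -/

theorem isCompactOperator_fst_of_norm_sq_le {E F : Type} [NormedAddCommGroup E] [NormedSpace ℂ E]
    [CompleteSpace E] [NormedAddCommGroup F] [NormedSpace ℂ F] (V : Submodule ℂ (WithLp 2 (E × F)))
    (W : Submodule ℂ V) {J : E →L[ℂ] F} (hJ : IsCompactOperator J) {C : ℝ} (hC : 0 ≤ C)
    (h : ∀ w : W, ‖(w : V).1.fst‖ ^ 2 ≤ ‖J (w : V).1.fst‖ * (C * ‖(w : V).1‖)) :
    IsCompactOperator (fun w : W => (w : V).1.fst) := by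
  let K : W →L[ℂ] E := (WithLp.fstL 2 ℂ E F).comp (V.subtypeL.comp W.subtypeL)
  have key := isCompactOperator_of_norm_le (X := W) (Y := E)
  refine key K.toLinearMap fun ε hε => ?_
  refine ⟨F, inferInstance, inferInstance, ((C / ε : ℝ) : ℂ) • (J.comp K).toLinearMap,
    (hJ.comp_clm K).smul ((C / ε : ℝ) : ℂ), fun w => ?_⟩
  -- Young's inequality: `b (C k)` is the product of `C / ε * b` and `ε * k`, hence at most the
  -- square of their sum.
  have aux : ∀ {a b k : ℝ}, 0 ≤ a → 0 ≤ b → 0 ≤ k → a ^ 2 ≤ b * (C * k) →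
      a ≤ ε * k + C / ε * b := by
    intro a b k ha hb hk h
    have e : C / ε * b * (ε * k) = b * (C * k) := by field_simp
    have h1 : 0 ≤ C / ε * b := by positivity
    refine (abs_le_of_sq_le_sq' ?_ (by positivity)).2
    nlinarith [sq_nonneg (ε * k), sq_nonneg (C / ε * b), mul_nonneg h1 (mul_nonneg hε.le hk)]
  have h2 : ‖(((C / ε : ℝ) : ℂ) • (J.comp K).toLinearMap) w‖ = C / ε * ‖J (w : V).1.fst‖ := by
    rw [LinearMap.smul_apply, norm_smul, Complex.norm_real, Real.norm_of_nonneg (by positivity)]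
    rfl
  rw [h2]
  exact aux (norm_nonneg _) (norm_nonneg _) (norm_nonneg _) (h w)

theorem norm_sq_eq_of_inner_self_eq {E : Type*} [NormedAddCommGroup E] [InnerProductSpace ℂ E]
    {x : E} {z : ℂ} (h : ⟪x, x⟫_ℂ = z) : ‖x‖ ^ 2 = ‖z‖ := by
  rw [← h, inner_self_eq_norm_sq_to_K]
  simp

namespace GasPlanet

variable (P : GasPlanet)

theorem ranTstar_eq : P.ranTstar = LinearMap.range P.tstar.toLinearMap := by
  ext v
  constructor
  · rintro ⟨p, rfl⟩
    refine (P.exists_eq_embed p).elim fun φ hφ => ⟨φ, ?_⟩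
    have hp : p = ⟨P.embed φ, P.embed_mem_adjoint_domain φ⟩ := Subtype.ext hφ
    rw [hp]
    exact (P.adjoint_apply φ _).symm
  · rintro ⟨φ, rfl⟩
    exact ⟨⟨P.embed φ, P.embed_mem_adjoint_domain φ⟩, P.adjoint_apply φ _⟩

/-- One inclusion is integration by parts. For the other, orthogonality itself supplies the
divergence and the boundary condition that put the vector in the domain of `T`. -/
theorem kerT_eq : P.kerT = (LinearMap.range P.tstar.toLinearMap)ᗮ := by
  ext u
  rw [Submodule.mem_orthogonal]
  constructor
  · rintro ⟨u, hu, rfl⟩ _ ⟨φ, rfl⟩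
    refine (P.inner_tstar_T φ u).trans ?_
    rw [show P.T u = 0 from hu, inner_zero_right]
  · intro h
    refine (P.exists_mem_HDivZero_of_inner_eq_zero fun φ => h _ ⟨φ, rfl⟩).elim fun d hd => ?_
    have hu : u ∈ P.T.domain := (P.mem_domain_iff u).2 ⟨d, hd.1⟩
    exact ⟨⟨u, hu⟩, (P.T_apply hd.1 hu).trans hd.2, rfl⟩

theorem exists_tstar_lower_bound : ∃ c, 0 < c ∧
    ∀ φ ∈ (LinearMap.ker P.tstar.toLinearMap)ᗮ, ‖φ‖ ≤ c * ‖P.tstar φ‖ :=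
  P.exists_norm_le_tstar.elim fun _ hC =>
    exists_norm_le_of_compact P.tstar P.embed P.isCompactOperator_embed hC

theorem isClosed_ranTstar : IsClosed (P.ranTstar : Set P.H) := by
  rw [ranTstar_eq]
  exact P.exists_tstar_lower_bound.elim fun _ h => isClosed_range_of_norm_le h.2

theorem isCompl_ranTstar_kerT : IsCompl P.ranTstar P.kerT := by
  rw [kerT_eq, ← ranTstar_eq]
  have : CompleteSpace P.ranTstar := P.isClosed_ranTstar.completeSpace_coe
  exact Submodule.isCompl_orthogonal _

/-- Recasts potentials as least-squares solutions for the bounded operator `tstar`, the form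
required by `pseudoInverse_eq_iff`. -/
theorem isPotential_iff (u : P.H) (φ : H1 P.M) :
    P.IsPotential u φ ↔ u - P.tstar φ ∈ (LinearMap.range P.tstar.toLinearMap)ᗮ := by
  rw [← kerT_eq]
  constructor
  · rintro ⟨p, hp, u₂, hu₂, hu⟩
    have hp' : p = ⟨P.embed φ, P.embed_mem_adjoint_domain φ⟩ :=
      Subtype.ext ((P.sameFunction_iff _ _).1 hp)
    rw [hp', P.adjoint_apply] at hu
    rwa [hu, add_sub_cancel_left]
  · intro h
    refine ⟨⟨P.embed φ, P.embed_mem_adjoint_domain φ⟩, (P.sameFunction_iff _ _).2 rfl, _, h, ?_⟩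
    rw [P.adjoint_apply, add_sub_cancel]

theorem exists_potential : ∃ Φ : P.H →L[ℂ] H1 P.M, ∀ u, P.IsPotential u (Φ u) ∧
    ∀ φ, Φ u = φ ↔ P.IsMinNormPotential u φ := by
  refine P.exists_tstar_lower_bound.elim fun c hc => (exists_pseudoInverse hc.2).imp fun Φ hΦ u =>
    ⟨(P.isPotential_iff _ _).2 (hΦ u).2, fun φ => ?_⟩
  simp only [IsMinNormPotential, isPotential_iff]
  exact pseudoInverse_eq_iff hΦ u φ

theorem isWeakGrad_adjoint (p : P.T†.domain) :
    IsWeakGrad P.Ω (fun x => (P.ρ x : ℂ) * (p : P.L2) x)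
      (fun x => -(P.T† p) x - (p : P.L2) x • toC3 (P.sTilde x)) := by
  refine (P.exists_eq_embed p).elim fun φ hφ => ?_
  have hp : p = ⟨P.embed φ, P.embed_mem_adjoint_domain φ⟩ := Subtype.ext hφ
  rw [hp, P.adjoint_apply]
  have h : IsWeakGrad P.Ω φ.1.fst φ.1.snd := φ.2
  refine (h.mul isOpen_interior P.isMultiplier_ρ.contDiffOn).congr isOpen_interior ?_ ?_
  · filter_upwards [P.embed_ae φ] with x h1
    simp only [h1]
  · filter_upwards [P.embed_ae φ, P.tstar_ae φ, P.ae_mem] with x h1 h2 hx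
    simp only [h1, h2, P.sTilde_eq hx, lower]
    ext i
    simp only [PiLp.add_apply, PiLp.smul_apply, PiLp.sub_apply, PiLp.neg_apply, toC3_apply,
      smul_eq_mul, Complex.ofReal_sub, Complex.ofReal_mul, Complex.ofReal_ofNat]
    ring

/-- The difference `u - T*Φu` lies both in the range and in its orthogonal complement. -/
theorem tstar_potential {Φ : P.H →L[ℂ] H1 P.M} (hΦ : ∀ u, P.IsPotential u (Φ u)) {u : P.H}
    (hu : u ∈ P.ranTstar) : P.tstar (Φ u) = u := by
  rw [ranTstar_eq] at hu
  refine (sub_eq_zero.1 ((Submodule.orthogonal_disjoint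
    (LinearMap.range P.tstar.toLinearMap)).le_bot ⟨Submodule.sub_mem _ hu ⟨_, rfl⟩, ?_⟩)).symm
  exact (P.isPotential_iff _ _).1 (hΦ _)

/-- `‖u‖² = ⟪T*Φu, u⟫ = ⟪Φu, T u⟫`: the weak `L²` norm of the potential appears, on which
compactness is available. -/
theorem norm_sq_le {Φ : P.H →L[ℂ] H1 P.M} (hΦ : ∀ u, P.IsPotential u (Φ u))
    {w : WithLp 2 (P.H × P.L2)} (hw : w ∈ P.HDivZero) (hr : w.fst ∈ P.ranTstar) :
    ‖w.fst‖ ^ 2 ≤ ‖P.embed (Φ w.fst)‖ * (‖P.tmap‖ * ‖w‖) := by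
  have h3 : ⟪w.fst, w.fst⟫_ℂ = ⟪P.embed (Φ w.fst), P.tmap w⟫_ℂ :=
    (congrArg (fun v => inner ℂ v w.fst) (P.tstar_potential hΦ hr).symm).trans
      (P.inner_tstar hw _)
  refine (norm_sq_eq_of_inner_self_eq h3).trans_le ?_
  exact (norm_inner_le_norm _ _).trans
    (mul_le_mul_of_nonneg_left (P.tmap.le_opNorm _) (norm_nonneg _))

/-- The weak divergence is unique, so the second component of `w` is the one for which the trace
condition holds. -/
theorem mem_HDivZero_of_mem_domain {w : WithLp 2 (P.H × P.L2)} (hw : w ∈ P.HDiv)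
    (hd : w.fst ∈ P.T.domain) : w ∈ P.HDivZero := by
  refine ((P.mem_domain_iff _).1 hd).elim fun d hd0 => ?_
  have h1 : IsWeakDiv P.Ω w.fst d := hd0.1
  have h2 : IsWeakDiv P.Ω w.fst w.snd := hw
  have h3 : d = w.snd := P.ext_ae (h1.unique isOpen_interior h2)
  rwa [h3] at hd0

theorem isCompactOperator_fst :
    IsCompactOperator (fun w : P.ranTstarInterDomain => (w : P.HDiv).1.fst) :=
  P.exists_potential.elim fun Φ hΦ =>
    isCompactOperator_fst_of_norm_sq_le P.HDiv P.ranTstarInterDomain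
      (J := P.embed.comp Φ) (P.isCompactOperator_embed.comp_clm Φ) (norm_nonneg P.tmap)
      fun w => P.norm_sq_le (fun u => (hΦ u).1)
        (P.mem_HDivZero_of_mem_domain (w : P.HDiv).2 w.2.2) w.2.1

end GasPlanet

theorem lemma3p2 (P : GasPlanet) :
    -- `T` has domain `H_{Div,0}(M)` and is densely defined
    ((∀ u : P.H, u ∈ P.T.domain ↔ ∃ d : P.L2, WithLp.toLp 2 (u, d) ∈ P.HDivZero) ∧
      Dense (P.T.domain : Set P.H)) ∧
    -- `D(T*) = H¹(M)` and `T* φ = -(∇(ρ₀ φ) + s̃ φ)`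
    ((∀ p : P.L2, p ∈ P.T†.domain ↔ ∃ φ : H1 P.M, P.SameFunction p φ) ∧
      (∀ φ : H1 P.M, ∃ p : P.L2, P.SameFunction p φ) ∧
      ∀ p : P.T†.domain, IsWeakGrad P.Ω (fun x => (P.ρ x : ℂ) * (p : P.L2) x)
        (fun x => -(P.T† p) x - (p : P.L2) x • toC3 (P.sTilde x))) ∧
    -- the range of `T*` is closed
    IsClosed (P.ranTstar : Set P.H) ∧
    -- `H` is the orthogonal direct sum of `Ran(T*)` and `Ker(T)`
    (P.ranTstar ⟂ P.kerT ∧ IsCompl P.ranTstar P.kerT) ∧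
    -- the minimum norm potential exists, is unique, and depends continuously on `u`
    (∃ Φ : P.H →L[ℂ] H1 P.M, ∀ u φ, Φ u = φ ↔ P.IsMinNormPotential u φ) ∧
    -- the injection of `Ran(T*) ∩ D(T)`, with the `H_Div(M)` topology, into `H` is compact
    IsCompactOperator (fun w : P.ranTstarInterDomain => (w : P.HDiv).1.fst) := by
  refine ⟨⟨P.mem_domain_iff, P.dense_domain⟩, ⟨fun p => ⟨fun hp => ?_, ?_⟩,
    fun φ => ⟨P.embed φ, (P.sameFunction_iff _ _).2 rfl⟩, P.isWeakGrad_adjoint⟩,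
    P.isClosed_ranTstar, ⟨?_, P.isCompl_ranTstar_kerT⟩,
    P.exists_potential.imp fun Φ hΦ u => (hΦ u).2, P.isCompactOperator_fst⟩
  · exact (P.exists_eq_embed ⟨p, hp⟩).imp fun φ hφ => (P.sameFunction_iff _ _).2 hφ
  · rintro ⟨φ, hφ⟩
    rw [(P.sameFunction_iff _ _).1 hφ]
    exact P.embed_mem_adjoint_domain φ
  · rw [P.kerT_eq, ← P.ranTstar_eq]
    exact Submodule.isOrtho_orthogonal_right _
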